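/- **Proposition 2.1 (smooth case).** Let $V$ be a compact Kähler manifold equipped with a Kähler form $\omega$ (a smooth closed positive real $(1,1)$-form), and let $X\subset V$ be a nonempty closed complex submanifold (its connected components may have different dimensions). Write $d=\partial+\bar\partial$ and $d^c=\frac{1}{2\pi i}(\partial-\bar\partial)$. For an open set $U\subset V$, a function $u:U\to[-\infty,+\infty)$ is *psh* if it is upper semicontinuous, $u\not\equiv-\infty$, and $u(f(0))\le\frac1{2\pi}\int_0^{2\pi}u(f(e^{i\theta}))\,d\theta$ for every holomorphic map $f$ from a neighbourhood of the closed unit disc to $V$ which maps the closed unit disc into $U$. For a closed real $(1,1)$-form $\eta$ on $V$ and a closed complex submanifold $Y$ of $V$ (possibly $Y=V$), an upper semicontinuous function $\varphi:Y\to[-\infty,+\infty)$ is *$\eta|_Y$-psh* if $\varphi\not\equiv-\infty$ and $Y$ can be covered by open sets $U_i\subset V$ on which there are psh functions $\varphi_i,\rho_i$, with $\rho_i$ smooth (real valued) and $dd^c\rho_i=\eta$ on $U_i$, such that $\rho_i+\varphi=\varphi_i$ on $Y\cap U_i$. It is *strictly $\omega|_Y$-psh* if it is $(1-\varepsilon)\omega|_Y$-psh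 for some $\varepsilon\in(0,1)$. Let $PSH^+(Y,\omega|_Y)$ be the set of strictly $\omega|_Y$-psh functions on $Y$, and $PSH^+(V,\omega)$ the same set for $Y=V$. Then $$PSH^+(X,\omega|_X)\cap\mathcal C^\infty(X,\mathbb R)=\left(PSH^+(V,\omega)\cap\mathcal C^\infty(V,\mathbb R)\right)\big|_X ,$$ that is, every smooth strictly $\omega|_X$-psh function on $X$ is the restriction to $X$ of a smooth strictly $\omega$-psh function on $V$, and conversely the restriction to $X$ of every smooth strictly $\omega$-psh function on $V$ is a smooth strictly $\omega|_X$-psh function on $X$. -/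

import Mathlib

open scoped Manifold ContDiff
open Set

namespace OmegaPsh

/-- The model space `ℂⁿ`. A complex manifold `V` of dimension `n` is a charted space over `ℂⁿ` whose
chart changes are holomorphic; the same atlas makes `V` a real smooth manifold modelled on the
underlying real vector space (model with corners `𝓘(ℝ, Cn n)`). -/
abbrev Cn (n : ℕ) : Type := EuclideanSpace ℂ (Fin n)

/-! ### Differential forms of degree two and the operator `dd^c` -/

/-- Multiplication by `i` on `ℂⁿ`, as a real linear map. -/
noncomputable def mulI (n : ℕ) : Cn n →L[ℝ] Cn n :=
  (Complex.I • ContinuousLinearMap.id ℂ (Cn n)).restrictScalars ℝ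

/-- The operator `d^c = (1 / (2πi)) (∂ - ∂̄)` on real functions on (an open part of) `ℂⁿ`. Since
`∂u(v) = (du(v) - i du(iv)) / 2` and `∂̄u(v) = (du(v) + i du(iv)) / 2`, it is the real one-form
`d^c u (v) = - du(iv) / (2π)`. -/
noncomputable def dcModel {n : ℕ} (u : Cn n → ℝ) (z : Cn n) : Cn n [⋀^Fin 1]→L[ℝ] ℝ :=
  ContinuousAlternatingMap.ofSubsingleton ℝ (Cn n) ℝ (0 : Fin 1)
    (-(2 * Real.pi)⁻¹ • (fderiv ℝ u z).comp (mulI n))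

section Manifold

variable {n : ℕ} {V : Type*} [TopologicalSpace V] [ChartedSpace (Cn n) V]

variable (n V) in
/-- Real differential forms of degree two on `V`, with no regularity imposed: a real alternating
bilinear form on every tangent space. -/
abbrev TwoForm : Type _ :=
  (x : V) → TangentSpace 𝓘(ℝ, Cn n) x [⋀^Fin 2]→L[ℝ] ℝ

/-- The complex structure of the (real) tangent space at `x`. -/
noncomputable def complexStructure (x : V) :
    TangentSpace 𝓘(ℝ, Cn n) x →L[ℝ] TangentSpace 𝓘(ℝ, Cn n) x :=
  mulI n

/-- The expression of a two-form in a chart `e`: its pull-back by `e⁻¹` (meaningful on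
`e.target`). -/
noncomputable def TwoForm.inChart (κ : TwoForm n V) (e : OpenPartialHomeomorph V (Cn n))
    (z : Cn n) : Cn n [⋀^Fin 2]→L[ℝ] ℝ :=
  (κ (e.symm z)).compContinuousLinearMap (mfderiv 𝓘(ℝ, Cn n) 𝓘(ℝ, Cn n) e.symm z)

/-- Kähler forms: smooth, closed, real two-forms of type `(1,1)` which are positive. -/
structure IsKahlerForm (κ : TwoForm n V) : Prop where
  /-- `κ` is smooth. -/
  smooth : ∀ e ∈ atlas (Cn n) V, ContDiffOn ℝ ∞ (κ.inChart e) e.target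
  /-- `dκ = 0`. -/
  closed : ∀ e ∈ atlas (Cn n) V, ∀ z ∈ e.target, extDeriv (κ.inChart e) z = 0
  /-- `κ` is of type `(1,1)`, i.e. `κ(Jv, Jw) = κ(v, w)`. -/
  type_one_one : ∀ (x : V) (v w : TangentSpace 𝓘(ℝ, Cn n) x),
    κ x ![complexStructure x v, complexStructure x w] = κ x ![v, w]
  /-- `κ(v, Jv) > 0` for every tangent vector `v ≠ 0`. -/
  pos : ∀ (x : V) (v : TangentSpace 𝓘(ℝ, Cn n) x), v ≠ 0 → 0 < κ x ![v, complexStructure x v]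

/-- `dd^c ρ` for a real function `ρ` on `V`. It is computed at `x` in the preferred chart at `x`,
which is the chart through which the tangent space at `x` is identified with `ℂⁿ`. -/
noncomputable def ddc (ρ : V → ℝ) : TwoForm n V := fun x =>
  extDeriv (dcModel (ρ ∘ (chartAt (Cn n) x).symm)) (chartAt (Cn n) x x)

/-! ### Plurisubharmonic functions -/

variable (n) in
/-- `u : U → [-∞, +∞)` is plurisubharmonic on the open set `U` of `V`: it is upper semicontinuous,
not identically `-∞`, and for every holomorphic map `f` from a neighbourhood of the closed unit disc
to `V` which maps the closed unit disc into `U`, the mean value inequality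
`u (f 0) ≤ (1 / 2π) ∫ u (f (e ^ (iθ))) dθ` holds. Since `u ∘ f` is upper semicontinuous on
the circle with values in `[-∞, +∞)`, the integral on the right (possibly `-∞`) is the infimum of
the integrals of the continuous functions `g ≥ u ∘ f`. -/
def IsPshOn (U : Set V) (u : V → EReal) : Prop :=
  UpperSemicontinuousOn u U ∧ (∀ x ∈ U, u x ≠ ⊤) ∧ (∃ x ∈ U, u x ≠ ⊥) ∧
    ∀ (D : Set ℂ) (f : ℂ → V), IsOpen D → Metric.closedBall 0 1 ⊆ D →
      ContMDiffOn 𝓘(ℂ, ℂ) 𝓘(ℂ, Cn n) ω f D → MapsTo f (Metric.closedBall 0 1) U →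
      ∀ g : ℂ → ℝ, Continuous g → (∀ z ∈ Metric.sphere (0 : ℂ) 1, u (f z) ≤ (g z : EReal)) →
        u (f 0) ≤ ((Real.circleAverage g 0 1 : ℝ) : EReal)

/-- `φ : X → [-∞, +∞)` is `κ|_X`-plurisubharmonic: it is upper semicontinuous, not identically
`-∞`, and `X` is covered by open sets `U` of `V` on which there are plurisubharmonic functions
`ρ` and `u`, with `ρ` smooth and `dd^c ρ = κ`, such that `ρ + φ = u` on `X ∩ U`. -/
def IsOmegaPsh (κ : TwoForm n V) (X : Set V) (φ : X → EReal) : Prop :=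
  UpperSemicontinuous φ ∧ (∀ x, φ x ≠ ⊤) ∧ (∃ x, φ x ≠ ⊥) ∧
    ∀ x ∈ X, ∃ U : Set V, IsOpen U ∧ x ∈ U ∧ ∃ (ρ : V → ℝ) (u : V → EReal),
      ContMDiffOn 𝓘(ℝ, Cn n) 𝓘(ℝ, ℝ) ∞ ρ U ∧ IsPshOn n U (fun y => (ρ y : EReal)) ∧
      (∀ y ∈ U, ddc ρ y = κ y) ∧ IsPshOn n U u ∧
      ∀ y : X, (y : V) ∈ U → (ρ y : EReal) + φ y = u y

/-- `φ` is strictly `κ|_X`-plurisubharmonic: it is `(1 - ε)κ|_X`-plurisubharmonic for some small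
`ε > 0`. -/
def IsStrictlyOmegaPsh (κ : TwoForm n V) (X : Set V) (φ : X → EReal) : Prop :=
  ∃ ε : ℝ, 0 < ε ∧ ε < 1 ∧ IsOmegaPsh (fun x => (1 - ε) • κ x) X φ

/-! ### Complex submanifolds -/

/-- `e` is a holomorphic chart of `V` which flattens `X`: in it, `X` is the complex linear
subspace `W`. -/
def IsSubmanifoldChart (X : Set V) (e : OpenPartialHomeomorph V (Cn n))
    (W : Submodule ℂ (Cn n)) : Prop :=
  e ∈ IsManifold.maximalAtlas 𝓘(ℂ, Cn n) ω V ∧ ∀ y ∈ e.source, y ∈ X ↔ e y ∈ W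

variable (n) in
/-- (Closed) complex submanifolds of `V`. Different connected components may have different
dimensions. -/
def IsComplexSubmanifold (X : Set V) : Prop :=
  IsClosed X ∧ ∀ x ∈ X, ∃ (e : OpenPartialHomeomorph V (Cn n)) (W : Submodule ℂ (Cn n)),
    x ∈ e.source ∧ IsSubmanifoldChart X e W

variable (n) in
/-- `φ : X → ℝ` is smooth on the submanifold `X`: it is smooth when read in the charts
`X ∩ e.source → W` of `X`. The extension of `φ` by zero to `V` only serves to write the composition,
as `e⁻¹` maps `W ∩ e.target` into `X`. -/
def IsSmoothOnSubmanifold (X : Set V) (φ : X → ℝ) : Prop :=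
  ∀ (e : OpenPartialHomeomorph V (Cn n)) (W : Submodule ℂ (Cn n)), IsSubmanifoldChart X e W →
    ContDiffOn ℝ ∞ (fun w : W => Function.extend Subtype.val φ 0 (e.symm (w : Cn n)))
      {w : W | (w : Cn n) ∈ e.target}

end Manifold

end OmegaPsh

/-!
The restriction of a strictly `κ`-psh function to `X` is clearly strictly `κ|_X`-psh, with the same
local potentials. For the converse, smooth functions `u` are handled through their Levi forms
`lev u = 4 ∂∂̄u`, to be compared with the Hermitian form `hermForm κ` of the Kähler form `κ`.

* *Dictionary.* Locally `κ = dd^c ρ` with `ρ` smooth (`exists_local_potential`), and then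
  `lev ρ = hermForm κ`. This is the local `dd^c`-lemma `exists_extDeriv_dcModel_eq`, proved by the
  Poincaré lemma followed by the solution of a `∂̄`-equation with the Cauchy transform. A smooth
  function with nonnegative Levi form is psh, by the mean value inequality
  (`isPshOn_of_lev_nonneg`). Conversely, if a smooth function agrees on `X` with a psh function, its
  Levi form is nonnegative in the directions tangent to `X`, as one sees on small discs contained in
  `X` (`lev_nonneg_of_isPshOn`).

* *A defining function of `X`.* There is a smooth `g ≥ 0` with zero set `X` such that
  `|∂g|² ≤ g (∂∂̄g + C g κ)`, that is, `log g` is quasi-psh, and such that `lev g` is positive at the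
  points of `X` in the directions which are not tangent to `X` (`exists_defining_function`). It is
  a finite sum `∑ θⱼ² qⱼ` with cut-off functions `θⱼ`, where `qⱼ` is the squared distance to `X` in a
  chart which flattens `X`, or `1` away from `X`. The estimate holds for each `qⱼ`, and it survives
  the summation by the Cauchy–Schwarz inequality, since the `qⱼ` are comparable to each other.

* *Conclusion.* Let `f` be a smooth extension to `V` of the given function `φ` on `X`, which is
  `(1 - ε)κ|_X`-psh, and let `c = 1 - ε / 2`. For `A` large, `Φ = f + A g` satisfies
  `lev Φ + c hermForm κ > 0` at the points of `X`, hence on a neighbourhood of `X`. The regularised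
  maximum `ψ = δ log (e ^ (Φ / δ) + B g)` of `Φ` and `δ log (B g)` is smooth, equals `Φ = φ` on `X`,
  and satisfies, with `P = e ^ (Φ / δ)` and `Q = B g`,
  `(P + Q) lev ψ ≥ P lev Φ - δ C Q hermForm κ`. So `lev ψ + c hermForm κ > 0` on the whole of `V`
  when `δ` is small and then `B` is large (`exists_lev_add_hermForm_pos`), and `ψ` is the extension
  wanted.
-/

set_option linter.unusedSectionVars false

namespace OmegaPsh

open Filter Topology

/-! ### Levi forms on complex normed spaces -/

section Levi

variable {E : Type*} [NormedAddCommGroup E] [NormedSpace ℂ E] [NormedSpace ℝ E]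

/-- The Levi form of a real function `u` at `z` in the direction `v`, i.e. `4 ∂∂̄u(v, v̄)`: the
Laplacian at `0` of `ζ ↦ u (z + ζ v)`. -/
noncomputable def leviForm (u : E → ℝ) (z v : E) : ℝ :=
  fderiv ℝ (fderiv ℝ u) z v v + fderiv ℝ (fderiv ℝ u) z (Complex.I • v) (Complex.I • v)

/-- The squared gradient `4 |∂u(v)|²` at `0` of `ζ ↦ u (z + ζ v)`. -/
noncomputable def gradSq (u : E → ℝ) (z v : E) : ℝ :=
  fderiv ℝ u z v ^ 2 + fderiv ℝ u z (Complex.I • v) ^ 2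

theorem leviForm_congr {u w : E → ℝ} {z : E} (h : u =ᶠ[𝓝 z] w) (v : E) :
    leviForm u z v = leviForm w z v := by
  simp only [leviForm, h.fderiv.fderiv_eq]

theorem gradSq_congr {u w : E → ℝ} {z : E} (h : u =ᶠ[𝓝 z] w) (v : E) :
    gradSq u z v = gradSq w z v := by
  simp only [gradSq, h.fderiv_eq]

theorem hasFDerivAt_fderiv {F G : Type*} [NormedAddCommGroup F] [NormedSpace ℝ F]
    [NormedAddCommGroup G] [NormedSpace ℝ G] {u : F → G} {z : F} (h : ContDiffAt ℝ 2 u z) :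
    HasFDerivAt (fderiv ℝ u) (fderiv ℝ (fderiv ℝ u) z) z :=
  ((h.fderiv_right (m := 1) (by norm_num)).differentiableAt (by norm_num)).hasFDerivAt

theorem eventually_differentiableAt {F G : Type*} [NormedAddCommGroup F] [NormedSpace ℝ F]
    [NormedAddCommGroup G] [NormedSpace ℝ G] {u : F → G} {z : F} (h : ContDiffAt ℝ 2 u z) :
    ∀ᶠ y in 𝓝 z, DifferentiableAt ℝ u y :=
  (h.eventually (by simp)).mono fun _ hy => hy.differentiableAt (by norm_num)

theorem leviForm_smul [IsScalarTower ℝ ℂ E] (u : E → ℝ) (z v : E) (c : ℂ) :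
    leviForm u z (c • v) = ‖c‖ ^ 2 * leviForm u z v := by
  have key : ∀ (r : ℝ) (x : E), (r : ℂ) • x = r • x := fun r x => algebraMap_smul ℂ r x
  have h1 : c • v = c.re • v + c.im • (Complex.I • v) := by
    rw [← key, ← key, smul_smul, ← add_smul, Complex.re_add_im]
  have h2 : Complex.I • (c • v) = -c.im • v + c.re • (Complex.I • v) := by
    rw [← key, ← key, smul_smul, smul_smul, ← add_smul]
    congr 1
    apply Complex.ext <;> simp
  simp only [leviForm]
  rw [h2, h1, ← Complex.normSq_eq_norm_sq, Complex.normSq_apply]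
  simp only [map_add, map_smul, add_apply, smul_apply,
    smul_eq_mul]
  ring

theorem leviForm_zero_right (u : E → ℝ) (z : E) : leviForm u z 0 = 0 := by
  simp [leviForm]

theorem leviForm_add {u w : E → ℝ} {z : E} (hu : ContDiffAt ℝ 2 u z) (hw : ContDiffAt ℝ 2 w z)
    (v : E) : leviForm (fun y => u y + w y) z v = leviForm u z v + leviForm w z v := by
  have h : fderiv ℝ (fun y => u y + w y) =ᶠ[𝓝 z] fun y => fderiv ℝ u y + fderiv ℝ w y := by
    filter_upwards [eventually_differentiableAt hu, eventually_differentiableAt hw] with y h1 h2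
    exact fderiv_fun_add h1 h2
  simp only [leviForm, h.fderiv_eq,
    ((hasFDerivAt_fderiv hu).fun_add (hasFDerivAt_fderiv hw)).fderiv, add_apply]
  ring

theorem leviForm_const_mul {u : E → ℝ} {z : E} (c : ℝ) (v : E) :
    leviForm (fun y => c * u y) z v = c * leviForm u z v := by
  have h : fderiv ℝ (fun y => c * u y) = fun y => c • fderiv ℝ u y := by
    ext1 y
    exact congrFun (fderiv_const_smul_field (𝕜 := ℝ) (f := u) c) y
  have h' : fderiv ℝ (fun y => c • fderiv ℝ u y) z = c • fderiv ℝ (fderiv ℝ u) z :=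
    congrFun (fderiv_const_smul_field (𝕜 := ℝ) (f := fderiv ℝ u) c) z
  simp only [leviForm, h, h']
  simp only [smul_apply, smul_eq_mul]
  ring

theorem leviForm_const (c : ℝ) (z v : E) : leviForm (fun _ => c) z v = 0 := by
  simp [leviForm]

theorem leviForm_sum {ι : Type*} (s : Finset ι) {u : ι → E → ℝ} {z : E}
    (hu : ∀ i ∈ s, ContDiffAt ℝ 2 (u i) z) (v : E) :
    leviForm (fun y => ∑ i ∈ s, u i y) z v = ∑ i ∈ s, leviForm (u i) z v := by
  classical
  induction s using Finset.induction_on with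
  | empty => simp [leviForm_const]
  | insert a s ha ih =>
    simp only [Finset.sum_insert ha]
    rw [leviForm_add (hu a (by simp)) (ContDiffAt.sum fun i hi => hu i (by simp [hi])),
      ih fun i hi => hu i (by simp [hi])]

theorem leviForm_mul {u w : E → ℝ} {z : E} (hu : ContDiffAt ℝ 2 u z) (hw : ContDiffAt ℝ 2 w z)
    (v : E) : leviForm (fun y => u y * w y) z v = u z * leviForm w z v + w z * leviForm u z v +
      2 * (fderiv ℝ u z v * fderiv ℝ w z v +
        fderiv ℝ u z (Complex.I • v) * fderiv ℝ w z (Complex.I • v)) := by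
  have h : fderiv ℝ (fun y => u y * w y) =ᶠ[𝓝 z] fun y => u y • fderiv ℝ w y + w y • fderiv ℝ u y := by
    filter_upwards [eventually_differentiableAt hu, eventually_differentiableAt hw] with y h1 h2
    exact fderiv_fun_mul h1 h2
  have hu1 := (hu.differentiableAt (by norm_num)).hasFDerivAt
  have hw1 := (hw.differentiableAt (by norm_num)).hasFDerivAt
  have := (hu1.fun_smul (hasFDerivAt_fderiv hw)).fun_add (hw1.fun_smul (hasFDerivAt_fderiv hu))
  simp only [leviForm, h.fderiv_eq, this.fderiv, add_apply,
    smul_apply, ContinuousLinearMap.smulRight_apply, smul_eq_mul]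
  ring

/-- Chain rule for the Levi form, with an outer function of one real variable. -/
theorem leviForm_comp {u : E → ℝ} {z : E} (hu : ContDiffAt ℝ 2 u z) {F F' : ℝ → ℝ} {F'' : ℝ}
    (hF : ∀ᶠ t in 𝓝 (u z), HasDerivAt F (F' t) t) (hF' : HasDerivAt F' F'' (u z)) (v : E) :
    leviForm (fun y => F (u y)) z v = F' (u z) * leviForm u z v + F'' * gradSq u z v := by
  have h : fderiv ℝ (fun y => F (u y)) =ᶠ[𝓝 z] fun y => F' (u y) • fderiv ℝ u y := by
    filter_upwards [eventually_differentiableAt hu, hu.continuousAt.eventually hF] with y h1 h2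
    exact (h2.comp_hasFDerivAt y h1.hasFDerivAt).fderiv
  have hu1 := (hu.differentiableAt (by norm_num)).hasFDerivAt
  have := (hF'.comp_hasFDerivAt z hu1).fun_smul (hasFDerivAt_fderiv hu)
  simp only [Function.comp_def] at this
  simp only [leviForm, gradSq, h.fderiv_eq, this.fderiv, add_apply,
    smul_apply, ContinuousLinearMap.smulRight_apply, smul_eq_mul]
  ring

/-- At a zero of a nonnegative function the differential vanishes. -/
theorem fderiv_eq_zero_of_nonneg {F : Type*} [NormedAddCommGroup F] [NormedSpace ℝ F]
    {u : F → ℝ} {z : F} (h : ∀ᶠ y in 𝓝 z, 0 ≤ u y) (h0 : u z = 0) : fderiv ℝ u z = 0 :=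
  IsLocalMin.fderiv_eq_zero (h.mono fun y hy => by rw [h0]; exact hy)

theorem gradSq_eq_zero_of_nonneg {u : E → ℝ} {z : E} (h : ∀ᶠ y in 𝓝 z, 0 ≤ u y) (h0 : u z = 0)
    (v : E) : gradSq u z v = 0 := by
  simp [gradSq, fderiv_eq_zero_of_nonneg h h0]

/-- At a zero of a nonnegative function the Hessian is nonnegative. -/
theorem fderiv_fderiv_nonneg_of_nonneg {F : Type*} [NormedAddCommGroup F] [NormedSpace ℝ F]
    {u : F → ℝ} {z : F} (hu : ContDiffAt ℝ 2 u z)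
    (h : ∀ᶠ y in 𝓝 z, 0 ≤ u y) (h0 : u z = 0) (v : F) : 0 ≤ fderiv ℝ (fderiv ℝ u) z v v := by
  by_contra! hneg
  have hline : ∀ t : ℝ, HasDerivAt (fun t : ℝ => z + t • v) v t := fun t => by
    simpa using ((hasDerivAt_id t).smul_const v).const_add z
  have hc : ContinuousAt (fun t : ℝ => z + t • v) 0 := (hline 0).continuousAt
  have hz : z + (0 : ℝ) • v = z := by simp
  have hev : ∀ᶠ t in 𝓝 (0 : ℝ), deriv (fun t : ℝ => u (z + t • v)) t = fderiv ℝ u (z + t • v) v := by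
    have := hc.eventually (p := fun y => DifferentiableAt ℝ u y)
      (by simpa using eventually_differentiableAt hu)
    filter_upwards [this] with t ht
    exact (ht.hasFDerivAt.comp_hasDerivAt t (hline t)).deriv
  have hd1 : deriv (fun t : ℝ => u (z + t • v)) 0 = 0 := by
    rw [hev.self_of_nhds, hz, fderiv_eq_zero_of_nonneg h h0]; simp
  have hd2 : deriv (deriv (fun t : ℝ => u (z + t • v))) 0 = fderiv ℝ (fderiv ℝ u) z v v := by
    rw [EventuallyEq.deriv_eq hev]
    have h1 : HasFDerivAt (fderiv ℝ u) (fderiv ℝ (fderiv ℝ u) z) (z + (0 : ℝ) • v) := by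
      rw [hz]; exact hasFDerivAt_fderiv hu
    have h2 := h1.comp_hasDerivAt (0 : ℝ) (hline 0)
    have := (h2.clm_apply (hasDerivAt_const (0 : ℝ) v)).deriv
    simpa using this
  have hca : ContinuousAt (fun t : ℝ => u (z + t • v)) 0 :=
    ContinuousAt.comp (by rw [hz]; exact hu.continuousAt) hc
  have hmax := isLocalMax_of_deriv_deriv_neg (by rw [hd2]; exact hneg) hd1 hca
  have hconst : (fun t : ℝ => u (z + t • v)) =ᶠ[𝓝 0] fun _ => 0 := by
    filter_upwards [hmax, hc.eventually (p := fun y => 0 ≤ u y) (by simpa using h)]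
      with t h1 h2
    refine le_antisymm ?_ h2
    simpa [h0] using h1
  have := hconst.deriv.deriv_eq
  rw [hd2] at this
  simp at this
  linarith

theorem leviForm_nonneg_of_nonneg {u : E → ℝ} {z : E} (hu : ContDiffAt ℝ 2 u z)
    (h : ∀ᶠ y in 𝓝 z, 0 ≤ u y) (h0 : u z = 0) (v : E) : 0 ≤ leviForm u z v :=
  add_nonneg (fderiv_fderiv_nonneg_of_nonneg hu h h0 _) (fderiv_fderiv_nonneg_of_nonneg hu h h0 _)

variable {E' : Type*} [NormedAddCommGroup E'] [NormedSpace ℂ E'] [NormedSpace ℝ E']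
  [IsScalarTower ℝ ℂ E] [IsScalarTower ℝ ℂ E']

/-- The Levi form is invariant under holomorphic changes of variables: the terms with second
derivatives of `F` cancel since `D²F` is complex bilinear. -/
theorem leviForm_comp_holomorphic {F : E → E'} {h : E' → ℝ} {z : E} (hF : ContDiffAt ℂ 2 F z)
    (hh : ContDiffAt ℝ 2 h (F z)) (v : E) :
    leviForm (h ∘ F) z v = leviForm h (F z) (fderiv ℂ F z v) := by
  have hFd : ∀ᶠ y in 𝓝 z, DifferentiableAt ℂ F y :=
    (hF.eventually (by simp)).mono fun _ hy => hy.differentiableAt (by norm_num)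
  have h1 : fderiv ℝ (h ∘ F) =ᶠ[𝓝 z]
      fun y => (fderiv ℝ h (F y)).comp ((fderiv ℂ F y).restrictScalars ℝ) := by
    filter_upwards [hFd, hF.continuousAt.eventually (eventually_differentiableAt hh)] with y h1 h2
    exact (h2.hasFDerivAt.comp y (h1.hasFDerivAt.restrictScalars ℝ)).fderiv
  have hF1 := (hF.differentiableAt (by norm_num)).hasFDerivAt
  have hF2 : HasFDerivAt (fderiv ℂ F) (fderiv ℂ (fderiv ℂ F) z) z :=
    ((hF.fderiv_right (m := 1) (by norm_num)).differentiableAt (by norm_num)).hasFDerivAt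
  have hF3 : HasFDerivAt (fun y => (fderiv ℂ F y).restrictScalars ℝ)
      ((ContinuousLinearMap.restrictScalarsL ℂ E E' ℝ ℝ).comp
        ((fderiv ℂ (fderiv ℂ F) z).restrictScalars ℝ)) z :=
    (ContinuousLinearMap.restrictScalarsL ℂ E E' ℝ ℝ).hasFDerivAt.comp z (hF2.restrictScalars ℝ)
  have h2 := ((hasFDerivAt_fderiv hh).comp z (hF1.restrictScalars ℝ)).clm_comp hF3
  simp only [Function.comp_def] at h2
  simp only [leviForm, h1.fderiv_eq, h2.fderiv]
  simp
  rw [smul_smul, Complex.I_mul_I]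
  simp
  ring

end Levi

/-! ### Subharmonic functions and circle averages -/

theorem two_le_infty : (2 : ℕ∞ω) ≤ ∞ :=
  show ((2 : ℕ∞) : ℕ∞ω) ≤ ((⊤ : ℕ∞) : ℕ∞ω) from WithTop.coe_le_coe.2 le_top

section Parametric

variable {P F : Type*} [NormedAddCommGroup P] [NormedSpace ℝ P] [FiniteDimensional ℝ P]
  [NormedAddCommGroup F] [NormedSpace ℝ F]

/-- Differentiation under the integral sign over a compact interval. -/
theorem hasFDerivAt_intervalIntegral {G : P → ℝ → F} {G' : P → ℝ → P →L[ℝ] F} (a b : ℝ)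
    (hG : Continuous (Function.uncurry G)) (hG' : Continuous (Function.uncurry G'))
    (h : ∀ p t, HasFDerivAt (fun q => G q t) (G' p t) p) (p : P) :
    HasFDerivAt (fun q => ∫ t in a..b, G q t) (∫ t in a..b, G' p t) p := by
  have hcp : IsCompact (Metric.closedBall p 1 ×ˢ uIcc a b) :=
    (isCompact_closedBall p 1).prod isCompact_uIcc
  obtain ⟨C, hC⟩ := hcp.exists_bound_of_continuousOn hG'.continuousOn
  refine intervalIntegral.hasFDerivAt_integral_of_dominated_of_fderiv_le (bound := fun _ => C)
    (Metric.closedBall_mem_nhds p one_pos) (Eventually.of_forall fun q => ?_) ?_ ?_ ?_ (by simp)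
    (Eventually.of_forall fun t _ q _ => h q t)
  · exact (hG.comp (Continuous.prodMk_right q)).aestronglyMeasurable
  · exact (hG.comp (Continuous.prodMk_right p)).intervalIntegrable _ _
  · exact (hG'.comp (Continuous.prodMk_right p)).aestronglyMeasurable
  · exact Eventually.of_forall fun t ht q hq => hC (q, t) ⟨hq, uIoc_subset_uIcc ht⟩

theorem hasDerivAt_intervalIntegral {G G' : ℝ → ℝ → F} (a b : ℝ)
    (hG : Continuous (Function.uncurry G)) (hG' : Continuous (Function.uncurry G'))
    (h : ∀ p t, HasDerivAt (fun q => G q t) (G' p t) p) (p : ℝ) :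
    HasDerivAt (fun q => ∫ t in a..b, G q t) (∫ t in a..b, G' p t) p := by
  have hc : Continuous (Function.uncurry fun (p t : ℝ) =>
      ContinuousLinearMap.toSpanSingleton ℝ (G' p t)) :=
    (ContinuousLinearMap.toSpanSingletonCLE (𝕜 := ℝ) (E := F)).continuous.comp hG'
  have := (hasFDerivAt_intervalIntegral (P := ℝ) a b hG hc (fun p t => (h p t).hasFDerivAt)
    p).hasDerivAt
  rwa [ContinuousLinearMap.intervalIntegral_apply, intervalIntegral.integral_congr
    (g := fun t => G' p t) (by intro t _; simp)] at this
  exact (hc.comp (Continuous.prodMk_right p)).intervalIntegrable _ _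

/-- A function which is smooth on a neighbourhood of a compact set agrees near that set with a
function which is smooth on the whole space. -/
theorem exists_contDiff_eq_near_compact {K U : Set P} (hK : IsCompact K) (hU : IsOpen U)
    (hKU : K ⊆ U) {u : P → F} (hu : ContDiffOn ℝ ∞ u U) :
    ∃ (w : P → F) (U' : Set P), ContDiff ℝ ∞ w ∧ IsOpen U' ∧ K ⊆ U' ∧ U' ⊆ U ∧ EqOn w u U' := by
  have : ProperSpace P := FiniteDimensional.proper ℝ P
  obtain ⟨L, hL, hKL, hLU⟩ := exists_compact_between hK hU hKU
  obtain ⟨f, hf1, hf0, -⟩ := exists_contMDiffMap_one_nhds_of_subset_interior 𝓘(ℝ, P) (n := ⊤)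
    hK.isClosed hKL
  obtain ⟨U', hU', hKU', hU'1⟩ := mem_nhdsSet_iff_exists.1 hf1
  refine ⟨fun x => f x • u x, U' ∩ U, ?_, hU'.inter hU, subset_inter hKU' hKU, inter_subset_right,
    fun x hx => by simp [show f x = 1 from hU'1 hx.1]⟩
  rw [contDiff_iff_contDiffAt]
  intro x
  by_cases hx : x ∈ U
  · exact (contMDiff_iff_contDiff.1 f.contMDiff).contDiffAt.smul (hu.contDiffAt (hU.mem_nhds hx))
  · have : (fun x => f x • u x) =ᶠ[𝓝 x] fun _ => 0 := by
      filter_upwards [hL.isClosed.isOpen_compl.mem_nhds fun h => hx (hLU h)] with y hy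
      simp [hf0 y hy]
    exact contDiffAt_const.congr_of_eventuallyEq this

end Parametric

section MeanValue

open Real

/-- The mean value inequality for smooth subharmonic functions. With
`N(r) = ∫ Dh(r e^{iθ})(r e^{iθ}) dθ = r M'(r)`, where `M(r) = ∫ h(r e^{iθ}) dθ`, one has
`N'(r) = r ∫ Δh(r e^{iθ}) dθ ≥ 0`. -/
theorem le_circleAverage_of_leviForm_nonneg_of_contDiff {h : ℂ → ℝ} (hh : ContDiff ℝ ∞ h)
    (hpos : ∀ z ∈ Metric.closedBall (0 : ℂ) 1, ∀ v, 0 ≤ leviForm h z v) :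
    h 0 ≤ circleAverage h 0 1 := by
  set e : ℝ → ℂ := fun θ => Complex.exp (θ * Complex.I) with he
  have hec : Continuous e := by fun_prop
  have hed : ∀ θ, HasDerivAt e (Complex.I * e θ) θ := fun θ => by
    have := ((Complex.hasDerivAt_exp (θ * Complex.I)).comp θ
      ((Complex.ofRealCLM.hasDerivAt (x := θ)).mul_const Complex.I))
    simpa [he, mul_comm, Function.comp_def] using this
  have hen : ∀ θ, ‖e θ‖ = 1 := fun θ => Complex.norm_exp_ofReal_mul_I θ
  have hc0 : Continuous h := hh.continuous
  have hd1 : ContDiff ℝ ∞ (fderiv ℝ h) := hh.fderiv_right (by simp)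
  have hd2 : ContDiff ℝ ∞ (fderiv ℝ (fderiv ℝ h)) := hd1.fderiv_right (by simp)
  have hc1 := hd1.continuous
  have hc2 := hd2.continuous
  have hH : ∀ z, HasFDerivAt h (fderiv ℝ h z) z := fun z =>
    (hh.differentiable (by simp) z).hasFDerivAt
  have hH1 : ∀ z, HasFDerivAt (fderiv ℝ h) (fderiv ℝ (fderiv ℝ h) z) z := fun z =>
    (hd1.differentiable (by simp) z).hasFDerivAt
  have hr : ∀ (r θ : ℝ), HasDerivAt (fun r : ℝ => r • e θ) (e θ) r := fun r θ => by
    simpa using (hasDerivAt_id r).smul_const (e θ)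
  set M : ℝ → ℝ := fun r => ∫ θ in (0 : ℝ)..2 * π, h (r • e θ)
  set N : ℝ → ℝ := fun r => ∫ θ in (0 : ℝ)..2 * π, fderiv ℝ h (r • e θ) (r • e θ)
  have hM : ∀ r, HasDerivAt M (∫ θ in (0 : ℝ)..2 * π, fderiv ℝ h (r • e θ) (e θ)) r := fun r =>
    hasDerivAt_intervalIntegral (G := fun r θ => h (r • e θ))
      (G' := fun r θ => fderiv ℝ h (r • e θ) (e θ)) 0 (2 * π)
      (by simp only [Function.uncurry_def]; fun_prop) (by simp only [Function.uncurry_def]; fun_prop)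
      (fun r θ => (hH _).comp_hasDerivAt r (hr r θ)) r
  have hN : ∀ r, HasDerivAt N (∫ θ in (0 : ℝ)..2 * π,
      (fderiv ℝ (fderiv ℝ h) (r • e θ) (e θ) (r • e θ) + fderiv ℝ h (r • e θ) (e θ))) r := fun r =>
    hasDerivAt_intervalIntegral (G := fun r θ => fderiv ℝ h (r • e θ) (r • e θ))
      (G' := fun r θ => fderiv ℝ (fderiv ℝ h) (r • e θ) (e θ) (r • e θ) +
        fderiv ℝ h (r • e θ) (e θ)) 0 (2 * π)
      (by simp only [Function.uncurry_def]; fun_prop) (by simp only [Function.uncurry_def]; fun_prop)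
      (fun r θ => ((hH1 _).comp_hasDerivAt r (hr r θ)).clm_apply (hr r θ)) r
  -- the integral of an angular derivative over the circle vanishes
  have hang : ∀ r : ℝ, ∫ θ in (0 : ℝ)..2 * π,
      (fderiv ℝ (fderiv ℝ h) (r • e θ) (r • (Complex.I * e θ)) (Complex.I * e θ) +
        fderiv ℝ h (r • e θ) (Complex.I * (Complex.I * e θ))) = 0 := fun r => by
    have hd : ∀ θ, HasDerivAt (fun θ => fderiv ℝ h (r • e θ) (Complex.I * e θ))
        (fderiv ℝ (fderiv ℝ h) (r • e θ) (r • (Complex.I * e θ)) (Complex.I * e θ) +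
        fderiv ℝ h (r • e θ) (Complex.I * (Complex.I * e θ))) θ := fun θ =>
      ((hH1 _).comp_hasDerivAt θ ((hed θ).const_smul r)).clm_apply ((hed θ).const_mul Complex.I)
    rw [intervalIntegral.integral_eq_sub_of_hasDerivAt (fun θ _ => hd θ)
      (Continuous.intervalIntegrable (by fun_prop) _ _)]
    have h1 : e (2 * π) = e 0 := by
      simp only [he]
      push_cast
      rw [Complex.exp_two_pi_mul_I]
      simp
    rw [h1, sub_self]
  -- adding the angular term of integral zero completes the radial derivative to the Levi form
  have hN' : ∀ r, HasDerivAt N (∫ θ in (0 : ℝ)..2 * π, r * leviForm h (r • e θ) (e θ)) r := by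
    intro r
    have := hN r
    have hsum := intervalIntegral.integral_add (μ := MeasureTheory.volume) (a := 0) (b := 2 * π)
      (f := fun θ => fderiv ℝ (fderiv ℝ h) (r • e θ) (e θ) (r • e θ) + fderiv ℝ h (r • e θ) (e θ))
      (g := fun θ => fderiv ℝ (fderiv ℝ h) (r • e θ) (r • (Complex.I * e θ)) (Complex.I * e θ) +
        fderiv ℝ h (r • e θ) (Complex.I * (Complex.I * e θ)))
      (Continuous.intervalIntegrable (by fun_prop) _ _)
      (Continuous.intervalIntegrable (by fun_prop) _ _)
    rw [hang r, add_zero] at hsum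
    rw [← hsum] at this
    convert this using 3 with θ
    have hI : Complex.I * (Complex.I * e θ) = -e θ := by
      rw [← mul_assoc, Complex.I_mul_I, neg_one_mul]
    simp only [leviForm, hI, map_neg, map_smul, smul_apply, smul_eq_mul]
    ring
  have hN0 : N 0 = 0 := by simp [N]
  have hNmono : MonotoneOn N (Icc 0 1) := by
    refine monotoneOn_of_deriv_nonneg (convex_Icc 0 1)
      (fun r _ => (hN' r).continuousAt.continuousWithinAt)
      (fun r _ => (hN' r).differentiableAt.differentiableWithinAt) fun r hr => ?_
    rw [interior_Icc] at hr
    rw [(hN' r).deriv]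
    refine intervalIntegral.integral_nonneg (by positivity) fun θ _ => ?_
    refine mul_nonneg hr.1.le (hpos _ ?_ _)
    simp [hen, abs_of_pos hr.1, hr.2.le]
  have hMmono : MonotoneOn M (Icc 0 1) := by
    refine monotoneOn_of_deriv_nonneg (convex_Icc 0 1)
      (fun r _ => (hM r).continuousAt.continuousWithinAt)
      (fun r _ => (hM r).differentiableAt.differentiableWithinAt) fun r hr => ?_
    rw [interior_Icc] at hr
    rw [(hM r).deriv]
    have h1 : N r = r * ∫ θ in (0 : ℝ)..2 * π, fderiv ℝ h (r • e θ) (e θ) := by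
      rw [← intervalIntegral.integral_const_mul]
      simp only [N, map_smul, smul_eq_mul]
    have h2 : 0 ≤ N r := by
      rw [← hN0]
      exact hNmono ⟨le_rfl, zero_le_one⟩ ⟨hr.1.le, hr.2.le⟩ hr.1.le
    rw [h1] at h2
    exact (mul_nonneg_iff_of_pos_left hr.1).1 h2
  have h01 := hMmono (left_mem_Icc.2 zero_le_one) (right_mem_Icc.2 zero_le_one) zero_le_one
  have hM0 : M 0 = (2 * π) * h 0 := by simp [M]
  have hM1 : circleAverage h 0 1 = (2 * π)⁻¹ * M 1 := by
    simp only [circleAverage_def, M, circleMap, smul_eq_mul, he]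
    simp
  rw [hM1, le_inv_mul_iff₀ (by positivity), ← hM0]
  exact h01

theorem le_circleAverage_of_leviForm_nonneg {h : ℂ → ℝ} {D : Set ℂ} (hD : IsOpen D)
    (hD1 : Metric.closedBall 0 1 ⊆ D) (hh : ContDiffOn ℝ ∞ h D)
    (hpos : ∀ z ∈ Metric.closedBall (0 : ℂ) 1, ∀ v, 0 ≤ leviForm h z v) :
    h 0 ≤ circleAverage h 0 1 := by
  obtain ⟨w, U, hw, hU, hKU, -, heq⟩ :=
    exists_contDiff_eq_near_compact (isCompact_closedBall (0 : ℂ) 1) hD hD1 hh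
  have := le_circleAverage_of_leviForm_nonneg_of_contDiff hw fun z hz v => by
    rw [leviForm_congr (heq.eventuallyEq_of_mem (hU.mem_nhds (hKU hz)))]
    exact hpos z hz v
  rw [heq (hKU (by simp))] at this
  rwa [circleAverage_congr_sphere (f₂ := h)] at this
  intro z hz
  exact heq (hKU (by simpa using (by simpa using hz : ‖z‖ = 1).le))

/-- A smooth function on a neighbourhood of `0` whose mean over small circles is at least its value
at the centre has nonnegative Laplacian there. -/
theorem leviForm_nonneg_of_le_circleAverage {h : ℂ → ℝ} {D : Set ℂ} (hD : D ∈ 𝓝 (0 : ℂ))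
    (hh : ContDiffOn ℝ ∞ h D) (hmean : ∀ᶠ t in 𝓝[>] (0 : ℝ), h 0 ≤ circleAverage h 0 t) :
    0 ≤ leviForm h 0 1 := by
  obtain ⟨D', hD'D, hD', h0D'⟩ := mem_nhds_iff.1 hD
  obtain ⟨w, U, hw, hU, hKU, hUD, heq⟩ := exists_contDiff_eq_near_compact
    (isCompact_singleton (x := (0 : ℂ))) hD' (by simpa using h0D') (hh.mono hD'D)
  rw [singleton_subset_iff] at hKU
  rw [← leviForm_congr (heq.eventuallyEq_of_mem (hU.mem_nhds hKU))]
  -- otherwise `-w` is strictly subharmonic near `0`, and the strict mean value inequality for `-w`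
  -- contradicts the hypothesis
  by_contra! hneg
  have hcd : ContDiff ℝ ∞ (fun z : ℂ => ‖z‖ ^ 2) := contDiff_norm_sq ℝ
  have hsq : ∀ z : ℂ, leviForm (fun z : ℂ => ‖z‖ ^ 2) z 1 = 4 := by
    intro z
    have hd1 : fderiv ℝ (fun z : ℂ => ‖z‖ ^ 2) = fun z => 2 • (innerSL ℝ z) :=
      fderiv_norm_sq
    have hd2 : fderiv ℝ (fun z : ℂ => 2 • (innerSL ℝ z)) z = 2 • (innerSL ℝ) :=
      ((innerSL ℝ (E := ℂ)).hasFDerivAt.const_smul 2).fderiv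
    simp only [leviForm, hd1, hd2]
    have hin : ∀ a : ℂ, innerSL ℝ a a = ‖a‖ ^ 2 := fun a => real_inner_self_eq_norm_sq a
    simp [hin]
    norm_num
  set c : ℝ := - leviForm w 0 1 / 8 with hc
  have hcpos : 0 < c := by rw [hc]; linarith
  -- the comparison function `-w - c |z|²` is still strictly subharmonic near the origin
  have hlap : ∀ z v, leviForm (fun z => (-1) * w z + (-c) * ‖z‖ ^ 2) z v =
      ‖v‖ ^ 2 * (- leviForm w z 1 - 4 * c) := by
    intro z v
    have : v = v • (1 : ℂ) := by simp
    rw [this, leviForm_smul, leviForm_add, leviForm_const_mul, leviForm_const_mul, hsq]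
    · rw [smul_eq_mul, mul_one]; ring
    · exact (contDiff_const.mul hw).contDiffAt.of_le two_le_infty
    · exact (contDiff_const.mul hcd).contDiffAt.of_le two_le_infty
  have hcont : Continuous fun z => leviForm w z 1 := by
    have hd1 : ContDiff ℝ ∞ (fderiv ℝ w) := hw.fderiv_right (by simp)
    have := (hd1.fderiv_right (m := ∞) (by simp)).continuous
    simp only [leviForm]
    fun_prop
  have hev : ∀ᶠ z in 𝓝 (0 : ℂ), leviForm w z 1 < -4 * c :=
    hcont.continuousAt.eventually_lt continuousAt_const (by rw [hc]; linarith)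
  obtain ⟨r, hr, hball⟩ := Metric.mem_nhds_iff.1 (hev.and (hU.mem_nhds hKU))
  obtain ⟨t, ht, ht0, htr⟩ := (hmean.and (Ioo_mem_nhdsGT hr)).exists
  set W : ℂ → ℝ := fun z => (-1) * w z + (-c) * ‖z‖ ^ 2 with hW
  have hWc : ContDiff ℝ ∞ W := (contDiff_const.mul hw).add (contDiff_const.mul hcd)
  have hkey := le_circleAverage_of_leviForm_nonneg_of_contDiff
    (h := W ∘ fun z => (t : ℂ) * z) (hWc.comp (contDiff_const.mul contDiff_id)) fun z hz v => by
      rw [leviForm_comp_holomorphic (by fun_prop) (hWc.contDiffAt.of_le two_le_infty), hlap]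
      refine mul_nonneg (by positivity) ?_
      have : (t : ℂ) * z ∈ Metric.ball (0 : ℂ) r := by
        have : ‖z‖ ≤ 1 := by simpa using hz
        simp only [Metric.mem_ball, dist_zero_right, norm_mul, Complex.norm_real, Real.norm_eq_abs,
          abs_of_pos ht0]
        nlinarith
      have := (hball this).1
      linarith
  have h1 : circleAverage (W ∘ fun z => (t : ℂ) * z) 0 1 = circleAverage W 0 t := by
    rw [circleAverage_eq_circleAverage_zero_one (f := W)]
    simp [Function.comp_def]
  have h2 : circleAverage W 0 t = circleAverage (fun z => -h z + -(c * t ^ 2)) 0 t := by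
    apply circleAverage_congr_sphere
    intro z hz
    have hz : ‖z‖ = t := by simpa [abs_of_pos ht0] using hz
    have : w z = h z := heq (hball (by simpa [hz] using htr)).2
    simp only [hW, hz, this]
    ring
  have hci : CircleIntegrable h 0 t := by
    apply ContinuousOn.circleIntegrable ht0.le
    refine (hh.continuousOn.mono ?_)
    intro z hz
    have hz : ‖z‖ = t := by simpa using hz
    exact hD'D (hUD (hball (by simpa [hz] using htr)).2)
  have h3 : circleAverage (fun z => -h z + -(c * t ^ 2)) 0 t =
      - circleAverage h 0 t - c * t ^ 2 := by
    have e1 := circleAverage_fun_add (f₁ := fun z => -h z) (f₂ := fun _ => -(c * t ^ 2))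
      hci.neg (circleIntegrable_const _ _ _)
    rw [e1, circleAverage_const]
    have e2 := circleAverage_fun_smul (f := h) (a := (-1 : ℝ)) (c := 0) (R := t)
    simp only [smul_eq_mul, neg_one_mul] at e2
    rw [e2]; ring
  have h4 : W 0 = - h 0 := by simp [hW, show w 0 = h 0 from heq hKU]
  rw [h1, h2, h3] at hkey
  simp only [Function.comp_apply, mul_zero, h4] at hkey
  have : 0 < c * t ^ 2 := by positivity
  linarith

end MeanValue

/-! ### The Poincaré lemma -/

section Poincare

open MeasureTheory
open scoped Convolution

variable {P F : Type*} [NormedAddCommGroup P] [NormedSpace ℝ P] [FiniteDimensional ℝ P]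
  [NormedAddCommGroup F] [NormedSpace ℝ F]

omit [FiniteDimensional ℝ P] in
/-- An integral over a compact interval depending smoothly on a parameter is smooth: at `0`, it is
the convolution of the indicator function of the interval with a reflected and truncated
integrand. -/
theorem contDiff_intervalIntegral {G : P → ℝ → F} (hG : ContDiff ℝ ∞ (Function.uncurry G))
    {a b : ℝ} (hab : a ≤ b) : ContDiff ℝ ∞ fun p => ∫ t in a..b, G p t := by
  let χ : ContDiffBump (0 : ℝ) := ⟨|a| + |b| + 1, |a| + |b| + 2, by positivity, by linarith⟩
  let f : ℝ → ℝ := (Ioc a b).indicator fun _ => 1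
  let g : P → ℝ → F := fun p s => χ s • G p (-s)
  have hf : LocallyIntegrable f volume := by
    refine Integrable.locallyIntegrable ?_
    exact (integrable_indicator_iff measurableSet_Ioc).2 (by simp)
  have hg : ContDiff ℝ ∞ (Function.uncurry g) := by
    have h1 : ContDiff ℝ ∞ fun q : P × ℝ => G q.1 (-q.2) :=
      hG.comp (contDiff_fst.prodMk contDiff_snd.neg)
    exact (χ.contDiff.comp contDiff_snd).smul h1
  have hconv := contDiffOn_convolution_right_with_param_comp (𝕜 := ℝ) (μ := volume) (n := ⊤)
    (ContinuousLinearMap.lsmul ℝ ℝ) (s := univ) (v := fun _ : P => (0 : ℝ)) contDiffOn_const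
    (f := f) (g := g) (k := Metric.closedBall 0 (|a| + |b| + 2)) isOpen_univ
    (isCompact_closedBall _ _) (fun p x _ hx => by
      have : χ x = 0 := χ.zero_of_le_dist (by
        simp only [Metric.mem_closedBall, not_le] at hx
        exact hx.le)
      simp [g, this]) hf hg.contDiffOn
  rw [contDiffOn_univ] at hconv
  convert hconv using 2 with p
  rw [convolution, intervalIntegral.integral_of_le hab, ← integral_indicator measurableSet_Ioc]
  refine integral_congr_ae (Eventually.of_forall fun t => ?_)
  by_cases ht : t ∈ Ioc a b
  · have : χ (0 - t) = 1 := χ.one_of_mem_closedBall (by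
      simp only [Metric.mem_closedBall, dist_zero_right, zero_sub, norm_neg, Real.norm_eq_abs]
      have := abs_le_max_abs_abs ht.1.le ht.2
      have h1 := le_abs_self a
      have : |t| ≤ |a| + |b| := this.trans (max_le_add_of_nonneg (abs_nonneg _) (abs_nonneg _))
      change |t| ≤ |a| + |b| + 1
      linarith)
    simp only [f, g, indicator_of_mem ht, this]
    simp
  · simp [f, indicator_of_notMem ht]

set_option maxSynthPendingDepth 3 in
/-- The Poincaré lemma for smooth two-forms `Ω` on a ball; a two-form is given as a family of
alternating bilinear maps. The primitive is the cone integral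
`α z v = ∫₀¹ t Ω(z₀ + t (z - z₀)) (z - z₀, v) dt`. -/
theorem exists_primitive_of_closed {Ω : P → P →L[ℝ] P →L[ℝ] ℝ} (hΩ : ContDiff ℝ ∞ Ω) (z₀ : P)
    {r : ℝ} (halt : ∀ z ∈ Metric.ball z₀ r, ∀ v w, Ω z v w = -Ω z w v)
    (hcl : ∀ z ∈ Metric.ball z₀ r, ∀ a b c,
      fderiv ℝ Ω z a b c - fderiv ℝ Ω z b a c + fderiv ℝ Ω z c a b = 0) :
    ∃ α : P → P →L[ℝ] ℝ, ContDiff ℝ ∞ α ∧ ∀ z ∈ Metric.ball z₀ r, ∀ v w,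
      fderiv ℝ α z v w - fderiv ℝ α z w v = Ω z v w := by
  set p : P → ℝ → P := fun z t => z₀ + t • (z - z₀) with hp
  set G : P → ℝ → P →L[ℝ] ℝ := fun z t => t • Ω (p z t) (z - z₀) with hGdef
  set G' : P → ℝ → P →L[ℝ] P →L[ℝ] ℝ := fun z t =>
    t • (Ω (p z t) + (t • fderiv ℝ Ω (p z t)).flip (z - z₀)) with hG'def
  have hpc : ContDiff ℝ ∞ (Function.uncurry p) := by
    simp only [hp, Function.uncurry_def]; fun_prop
  have hΩp : ContDiff ℝ ∞ fun q : P × ℝ => Ω (p q.1 q.2) := hΩ.comp hpc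
  have hG : ContDiff ℝ ∞ (Function.uncurry G) := by
    simp only [hGdef, Function.uncurry_def]; fun_prop
  have hdΩ : ContDiff ℝ ∞ (fderiv ℝ Ω) := hΩ.fderiv_right (by simp)
  have hpc' : Continuous fun q : P × ℝ => p q.1 q.2 := hpc.continuous
  have hG' : Continuous (Function.uncurry G') := by
    have h1 : Continuous fun q : P × ℝ => Ω (p q.1 q.2) := hΩp.continuous
    have h2 : Continuous fun q : P × ℝ => fderiv ℝ Ω (p q.1 q.2) := hdΩ.continuous.comp hpc'
    have h3 : Continuous fun q : P × ℝ => (q.2 • fderiv ℝ Ω (p q.1 q.2)).flip :=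
      (ContinuousLinearMap.flipₗᵢ ℝ P P (P →L[ℝ] ℝ)).continuous.comp (by fun_prop)
    simp only [hG'def, Function.uncurry_def]
    fun_prop
  have hder : ∀ z t, HasFDerivAt (fun z => G z t) (G' z t) z := by
    intro z t
    have h1 : HasFDerivAt (fun z => p z t) (t • ContinuousLinearMap.id ℝ P) z :=
      (((hasFDerivAt_id z).sub_const z₀).const_smul t).const_add z₀
    have h2 := ((hΩ.differentiable (by simp) (p z t)).hasFDerivAt.comp z h1).clm_apply
      ((hasFDerivAt_id z).sub_const z₀)
    convert! h2.const_smul t using 1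
    ext v w
    simp [hG'def]
  refine ⟨fun z => ∫ t in (0 : ℝ)..1, G z t, contDiff_intervalIntegral hG zero_le_one,
    fun z hz v w => ?_⟩
  have hGi : IntervalIntegrable (G' z) volume 0 1 :=
    (hG'.comp (Continuous.prodMk_right z)).intervalIntegrable _ _
  have happ : ∀ v w, (∫ t in (0 : ℝ)..1, G' z t) v w = ∫ t in (0 : ℝ)..1, G' z t v w := by
    intro v w
    rw [ContinuousLinearMap.intervalIntegral_apply hGi, ContinuousLinearMap.intervalIntegral_apply]
    exact ((hG'.comp (Continuous.prodMk_right z)).clm_apply continuous_const).intervalIntegrable _ _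
  have hii : ∀ v w, IntervalIntegrable (fun t => G' z t v w) volume 0 1 := fun v w =>
    (((hG'.comp (Continuous.prodMk_right z)).clm_apply continuous_const).clm_apply
      continuous_const).intervalIntegrable _ _
  have hd : ∀ t, HasDerivAt (fun t => t ^ 2 * Ω (p z t) v w)
      (2 * t * Ω (p z t) v w + t ^ 2 * fderiv ℝ Ω (p z t) (z - z₀) v w) t := by
    intro t
    have h1 : HasDerivAt (fun t => p z t) (z - z₀) t := by
      simpa [hp] using ((hasDerivAt_id t).smul_const (z - z₀)).const_add z₀
    have h2 := (hΩ.differentiable (by simp) (p z t)).hasFDerivAt.comp_hasDerivAt t h1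
    have h3 := (h2.clm_apply (hasDerivAt_const t v)).clm_apply (hasDerivAt_const t w)
    have h4 := (hasDerivAt_pow 2 t).mul h3
    convert! h4 using 1
    simp
  rw [(hasFDerivAt_intervalIntegral 0 1 hG.continuous hG' hder z).fderiv, happ, happ,
    ← intervalIntegral.integral_sub (hii _ _) (hii _ _)]
  -- as `Ω` is closed, `dα` is the integral of `d/dt (t² Ω)`
  have hint : ∀ t ∈ uIcc (0 : ℝ) 1, G' z t v w - G' z t w v =
      2 * t * Ω (p z t) v w + t ^ 2 * fderiv ℝ Ω (p z t) (z - z₀) v w := by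
    intro t ht
    rw [uIcc_of_le zero_le_one] at ht
    have hmem : p z t ∈ Metric.ball z₀ r := by
      have := (convex_ball z₀ r).add_smul_sub_mem (Metric.mem_ball_self (dist_nonneg.trans_lt hz))
        hz ht
      simpa [hp] using this
    have h1 := halt _ hmem v w
    have h2 := hcl _ hmem (z - z₀) v w
    simp only [hG'def, add_apply, smul_apply, ContinuousLinearMap.flip_apply, smul_eq_mul]
    linear_combination -t * h1 - t ^ 2 * h2
  rw [intervalIntegral.integral_congr hint, intervalIntegral.integral_eq_sub_of_hasDerivAt
    (fun t _ => hd t)]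
  · simp [hp]
  · have hc1 : Continuous fun t => Ω (p z t) := hΩ.continuous.comp
      (hpc'.comp (Continuous.prodMk_right z))
    have hc2 : Continuous fun t => fderiv ℝ Ω (p z t) := hdΩ.continuous.comp
      (hpc'.comp (Continuous.prodMk_right z))
    exact Continuous.intervalIntegrable (by fun_prop) _ _

end Poincare

/-! ### The Cauchy transform -/

section Cauchy

open MeasureTheory Real
open scoped Convolution

/-- The fundamental solution `1 / (2πζ)` of the operator `2∂̄` on `ℂ`. -/
noncomputable def cauchyKernel (ζ : ℂ) : ℂ := (2 * π * ζ)⁻¹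

theorem locallyIntegrable_cauchyKernel : LocallyIntegrable cauchyKernel volume := by
  refine locallyIntegrable_of_norm_le_rpow (C := (2 * π)⁻¹) (α := 1)
    (by rw [Complex.finrank_real_complex]; norm_num)
    (by rw [Complex.finrank_real_complex]; norm_num) (Eventually.of_forall fun ζ => ?_) ?_
  · rw [cauchyKernel, Real.rpow_neg_one]
    simp [abs_of_pos pi_pos, mul_comm]
  · exact (Measurable.inv (by fun_prop)).aestronglyMeasurable

variable {E : Type*} [NormedAddCommGroup E] [NormedSpace ℂ E] [NormedSpace ℝ E]

/-- Twice the antilinear part of the differential of a complex function: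
`dbar f z v = 2 ∂̄f(v)`. -/
noncomputable def dbar (f : E → ℂ) (z v : E) : ℂ :=
  fderiv ℝ f z v + Complex.I * fderiv ℝ f z (Complex.I • v)

/-- The Cauchy–Pompeiu formula for compactly supported functions: in polar coordinates the
integrand is a radial derivative plus an angular derivative. -/
theorem integral_cauchyKernel_mul_dbar {G : ℂ → ℂ} (hG : ContDiff ℝ ∞ G)
    (hGc : HasCompactSupport G) (w : ℂ) :
    ∫ ζ, cauchyKernel ζ * dbar G (w - ζ) 1 = G w := by
  set e : ℝ → ℂ := fun θ => Complex.exp (θ * Complex.I) with he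
  have hec : Continuous e := by fun_prop
  have hed : ∀ θ, HasDerivAt e (Complex.I * e θ) θ := fun θ => by
    have := ((Complex.hasDerivAt_exp (θ * Complex.I)).comp θ
      ((Complex.ofRealCLM.hasDerivAt (x := θ)).mul_const Complex.I))
    simpa [he, mul_comm, Function.comp_def] using this
  have hen : ∀ θ, ‖e θ‖ = 1 := fun θ => Complex.norm_exp_ofReal_mul_I θ
  have hd1 : ContDiff ℝ ∞ (fderiv ℝ G) := hG.fderiv_right (by simp)
  have hc1 := hd1.continuous
  have hH : ∀ z, HasFDerivAt G (fderiv ℝ G z) z := fun z =>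
    (hG.differentiable (by simp) z).hasFDerivAt
  -- beyond the radius `R` everything vanishes
  obtain ⟨R, hRpos, hR⟩ : ∃ R : ℝ, 0 < R ∧ ∀ (r θ : ℝ), R ≤ r → w - r • e θ ∉ tsupport G := by
    obtain ⟨C, hC⟩ := hGc.isCompact.isBounded.exists_norm_le
    refine ⟨|C| + ‖w‖ + 1, by positivity, fun r θ hr hmem => ?_⟩
    have h1 := hC _ hmem
    have h2 : ‖r • e θ‖ ≤ ‖w - r • e θ‖ + ‖w‖ := by
      calc ‖r • e θ‖ = ‖w - (w - r • e θ)‖ := by congr 1; ring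
        _ ≤ _ := (norm_sub_le _ _).trans (by rw [add_comm])
    rw [norm_smul, hen, mul_one, Real.norm_eq_abs] at h2
    have := le_abs_self r
    have := le_abs_self C
    linarith
  have hG0 : ∀ r θ, R ≤ r → G (w - r • e θ) = 0 := fun r θ h => image_eq_zero_of_notMem_tsupport
    (hR r θ h)
  have hdG0 : ∀ r θ, R ≤ r → fderiv ℝ G (w - r • e θ) = 0 := fun r θ h =>
    image_eq_zero_of_notMem_tsupport fun h' => hR r θ h (tsupport_fderiv_subset ℝ h')
  set A1 : ℝ × ℝ → ℂ := fun p => fderiv ℝ G (w - p.1 • e p.2) (e p.2) with hA1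
  set A2 : ℝ × ℝ → ℂ := fun p => fderiv ℝ G (w - p.1 • e p.2) (Complex.I * e p.2) with hA2
  have hA1c : Continuous A1 := by simp only [hA1]; fun_prop
  have hA2c : Continuous A2 := by simp only [hA2]; fun_prop
  have hint : ∀ A : ℝ × ℝ → ℂ, Continuous A →
      IntegrableOn A (Ioc 0 R ×ˢ Ioo (-π) π) (volume.prod volume) := fun A hA =>
    (hA.continuousOn.integrableOn_compact (isCompact_Icc.prod isCompact_Icc)).mono_set
      (prod_mono Ioc_subset_Icc_self Ioo_subset_Icc_self)
  rw [← Complex.integral_comp_polarCoord_symm]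
  have hstep1 : ∫ p in polarCoord.target, p.1 • (cauchyKernel (Complex.polarCoord.symm p) *
      dbar G (w - Complex.polarCoord.symm p) 1) =
      ∫ p in polarCoord.target, (2 * π : ℂ)⁻¹ * (A1 p + Complex.I * A2 p) := by
    refine setIntegral_congr_fun (by exact polarCoord.open_target.measurableSet) fun p hp => ?_
    have hp1 : 0 < p.1 := hp.1
    have hsymm : Complex.polarCoord.symm p = p.1 • e p.2 := by
      rw [Complex.polarCoord_symm_apply, Complex.real_smul]
      simp only [he]
      rw [Complex.exp_mul_I]
      simp
    -- `2∂̄` in the rotated frame `(e^{iθ}, i e^{iθ})`; the factor `e^{iθ}` cancels the argument of the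
    -- kernel
    have heq : ∀ T : ℂ →L[ℝ] ℂ, ∀ θ : ℝ,
        T 1 + Complex.I * T Complex.I = e θ * (T (e θ) + Complex.I * T (Complex.I * e θ)) := by
      intro T θ
      have h1 : e θ = cos θ • (1 : ℂ) + sin θ • Complex.I := by
        simp [he, Complex.exp_mul_I]
      have h2 : Complex.I * e θ = -(sin θ) • (1 : ℂ) + cos θ • Complex.I := by
        rw [h1]
        apply Complex.ext <;> simp
      have t1 : T (e θ) = cos θ * T 1 + sin θ * T Complex.I := by
        rw [h1, map_add, map_smul, map_smul, Complex.real_smul, Complex.real_smul]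
      have t2 : T (Complex.I * e θ) = -sin θ * T 1 + cos θ * T Complex.I := by
        rw [h2, map_add, map_smul, map_smul, Complex.real_smul, Complex.real_smul]
        push_cast
        ring
      have hcs : (cos θ : ℂ) ^ 2 + (sin θ : ℂ) ^ 2 = 1 := by
        exact_mod_cast cos_sq_add_sin_sq θ
      rw [t1, t2, h1, Complex.real_smul, Complex.real_smul]
      linear_combination (-(T 1) - Complex.I * T Complex.I) * hcs +
        (sin θ ^ 2 * T 1 - sin θ * cos θ * T Complex.I) * Complex.I_sq
    have hene : e p.2 ≠ 0 := by rw [← norm_ne_zero_iff, hen]; exact one_ne_zero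
    have hpc : (p.1 : ℂ) ≠ 0 := by exact_mod_cast hp1.ne'
    have hpi : (π : ℂ) ≠ 0 := by exact_mod_cast pi_ne_zero
    simp only [dbar, smul_eq_mul, mul_one, hsymm, cauchyKernel, heq _ p.2, hA1, hA2]
    rw [Complex.real_smul, Complex.real_smul]
    field_simp
  rw [hstep1]
  have hstep2 : ∫ p in polarCoord.target, (2 * π : ℂ)⁻¹ * (A1 p + Complex.I * A2 p) =
      ∫ p in Ioc 0 R ×ˢ Ioo (-π) π, (2 * π : ℂ)⁻¹ * (A1 p + Complex.I * A2 p) := by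
    refine (setIntegral_eq_of_subset_of_forall_sdiff_eq_zero ?_ ?_ ?_)
    · exact polarCoord.open_target.measurableSet
    · exact prod_mono (fun x hx => hx.1) subset_rfl
    · rintro ⟨r, θ⟩ ⟨h1, h2⟩
      have hr : R ≤ r := by
        by_contra! hlt
        exact h2 ⟨⟨h1.1, hlt.le⟩, h1.2⟩
      simp only [hA1, hA2, hdG0 r θ hr]
      simp
  rw [hstep2, integral_const_mul]
  have hsum : ∫ p in Ioc 0 R ×ˢ Ioo (-π) π, (A1 p + Complex.I * A2 p) =
      (∫ p in Ioc 0 R ×ˢ Ioo (-π) π, A1 p) + Complex.I * ∫ p in Ioc 0 R ×ˢ Ioo (-π) π, A2 p := by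
    rw [← integral_const_mul]
    exact integral_add (hint A1 hA1c) ((hint A2 hA2c).const_mul _)
  rw [hsum]
  -- on each circle, `A2` is the angular derivative of a periodic function
  have hang : ∫ p in Ioc 0 R ×ˢ Ioo (-π) π, A2 p = 0 := by
    rw [Measure.volume_eq_prod, setIntegral_prod _ (hint A2 hA2c)]
    refine setIntegral_eq_zero_of_forall_eq_zero fun r hr => ?_
    rw [← integral_Ioc_eq_integral_Ioo, ← intervalIntegral.integral_of_le (by linarith [pi_pos])]
    have hd : ∀ θ, HasDerivAt (fun θ => -(r : ℂ)⁻¹ * G (w - r • e θ)) (A2 (r, θ)) θ := by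
      intro θ
      have h1 := (hH _).comp_hasDerivAt θ (((hed θ).const_smul r).const_sub w)
      have hrc : (r : ℂ) ≠ 0 := by exact_mod_cast hr.1.ne'
      convert! h1.const_mul (-(r : ℂ)⁻¹) using 1
      simp only [hA2, map_neg, map_smul]
      simp only [Complex.real_smul, Pi.smul_apply]
      field_simp
    rw [intervalIntegral.integral_eq_sub_of_hasDerivAt (fun θ _ => hd θ)
      ((hA2c.comp (Continuous.prodMk_right r)).intervalIntegrable _ _)]
    have : e π = e (-π) := by
      simp only [he]
      push_cast
      rw [Complex.exp_pi_mul_I, neg_mul, Complex.exp_neg, Complex.exp_pi_mul_I]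
      norm_num
    rw [this, sub_self]
  -- on each ray, `A1` is a radial derivative, whose integral leaves the value of `G` at the centre
  have hrad : ∫ p in Ioc 0 R ×ˢ Ioo (-π) π, A1 p = 2 * π * G w := by
    rw [Measure.volume_eq_prod, ← setIntegral_prod_swap, setIntegral_prod]
    · have : ∀ θ ∈ Ioo (-π) π, ∫ r in Ioc 0 R, A1 ((θ, r) : ℝ × ℝ).swap = G w := by
        intro θ _
        rw [← intervalIntegral.integral_of_le hRpos.le]
        have hd : ∀ r, HasDerivAt (fun r : ℝ => - G (w - r • e θ)) (A1 (r, θ)) r := by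
          intro r
          have h0 : HasDerivAt (fun r : ℝ => r • e θ) (e θ) r := by
            simpa using (hasDerivAt_id r).smul_const (e θ)
          have h1 := ((hH _).comp_hasDerivAt r (h0.const_sub w)).neg
          convert! h1 using 1
          simp [hA1]
        simp only [Prod.swap_prod_mk]
        rw [intervalIntegral.integral_eq_sub_of_hasDerivAt (fun r _ => hd r)
          ((hA1c.comp (Continuous.prodMk_left θ)).intervalIntegrable _ _)]
        simp only [hG0 R θ le_rfl]
        simp
      rw [setIntegral_congr_fun measurableSet_Ioo this, setIntegral_const]
      simp [Measure.real, two_mul, pi_pos.le]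
    · exact ((hA1c.comp continuous_swap).continuousOn.integrableOn_compact
        (isCompact_Icc.prod isCompact_Icc)).mono_set
          (prod_mono Ioo_subset_Icc_self Ioc_subset_Icc_self)
  rw [hang, hrad]
  have hpi : (π : ℂ) ≠ 0 := by exact_mod_cast pi_ne_zero
  field_simp
  simp

/-- The Cauchy transform of `B` along the complex line spanned by `e`. -/
noncomputable def cauchyTransform (B : E → ℂ) (e z : E) : ℂ :=
  ∫ ζ, cauchyKernel ζ * B (z - ζ • e)

/-- Differentiation under the integral sign. The function `B` has compact support in the direction
`e` only, so the integral is written as a convolution over `ℂ` with parameters. -/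
theorem contDiff_and_fderiv_cauchyTransform {B : E → ℂ} (hB : ContDiff ℝ ∞ B) {L : E →L[ℂ] ℂ} {e : E}
    (hLe : L e = 1) {K : Set ℂ} (hK : IsCompact K) (hBK : ∀ z, L z ∉ K → B z = 0) :
    ContDiff ℝ ∞ (cauchyTransform B e) ∧ ∀ z v,
      Integrable (fun ζ => cauchyKernel ζ * fderiv ℝ B (z - ζ • e) v) ∧
      fderiv ℝ (cauchyTransform B e) z v = ∫ ζ, cauchyKernel ζ * fderiv ℝ B (z - ζ • e) v := by
  let g : E → ℂ → ℂ := fun p x => B (p + (x - L p) • e)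
  have hsm : ContDiff ℝ ∞ fun q : E × ℂ => q.1 + (q.2 - L q.1) • e := by
    have hL : ContDiff ℝ ∞ fun q : E × ℂ => L q.1 :=
      (L.restrictScalars ℝ).contDiff.comp contDiff_fst
    have h2 : ContDiff ℝ ∞ fun q : E × ℂ => (q.2 - L q.1) • e :=
      ((ContinuousLinearMap.toSpanSingleton ℂ e).restrictScalars ℝ).contDiff.comp
        (contDiff_snd.sub hL)
    exact contDiff_fst.add h2
  have hg : ContDiff ℝ ∞ (Function.uncurry g) := hB.comp hsm
  have hgs : ∀ p x, p ∈ (univ : Set E) → x ∉ K → g p x = 0 := by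
    intro p x _ hx
    apply hBK
    simpa [hLe] using hx
  have hf : cauchyTransform B e =
      fun z => (cauchyKernel ⋆[ContinuousLinearMap.mul ℝ ℂ, volume] g z) (L z) := by
    ext z
    simp only [cauchyTransform, convolution, g, ContinuousLinearMap.mul_apply']
    congr! 4
    simp [sub_eq_add_neg]
  have hLc : ContDiff ℝ ∞ fun z => L z := (L.restrictScalars ℝ).contDiff
  constructor
  · rw [hf, ← contDiffOn_univ]
    exact contDiffOn_convolution_right_with_param_comp (n := ⊤) _ hLc.contDiffOn isOpen_univ hK hgs
      locallyIntegrable_cauchyKernel hg.contDiffOn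
  · intro z v
    have h1 := hasFDerivAt_convolution_right_with_param (𝕜 := ℝ) (ContinuousLinearMap.mul ℝ ℂ)
      isOpen_univ hK hgs locallyIntegrable_cauchyKernel
      ((hg.of_le (by exact_mod_cast le_top)).contDiffOn) (z, L z) (mem_univ _)
    have h2 : HasFDerivAt (fun z => (z, L z))
        ((ContinuousLinearMap.id ℝ E).prod (L.restrictScalars ℝ)) z :=
      (hasFDerivAt_id z).prodMk (L.restrictScalars ℝ).hasFDerivAt
    have h3 := h1.comp z h2
    have h4 := h3.fderiv
    simp only [Function.comp_def] at h4
    rw [← hf] at h4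
    have hdg : Continuous fun x => fderiv ℝ (Function.uncurry g) (z, x) :=
      (hg.fderiv_right (m := 0) (by simp)).continuous.comp (Continuous.prodMk_right z)
    have hcs : HasCompactSupport fun x => fderiv ℝ (Function.uncurry g) (z, x) := by
      refine HasCompactSupport.intro hK fun x hx => ?_
      have : Function.uncurry g =ᶠ[𝓝 (z, x)] fun _ => 0 := by
        filter_upwards [(continuous_snd.tendsto (z, x)).eventually
          (hK.isClosed.isOpen_compl.mem_nhds hx)] with q hq
        exact hgs q.1 q.2 trivial hq
      rw [this.fderiv_eq]
      simp
    have hex := hcs.convolutionExists_right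
      (ContinuousLinearMap.precompR (E × ℂ) (ContinuousLinearMap.mul ℝ ℂ))
      (μ := volume) locallyIntegrable_cauchyKernel hdg (L z)
    have hval : ∀ ζ, ContinuousLinearMap.precompR (E × ℂ) (ContinuousLinearMap.mul ℝ ℂ)
        (cauchyKernel ζ) (fderiv ℝ (Function.uncurry g) (z, L z - ζ)) (v, L v) =
        cauchyKernel ζ * fderiv ℝ B (z - ζ • e) v := by
      intro ζ
      simp only [ContinuousLinearMap.precompR_apply]
      have hin : HasFDerivAt (fun q : E × ℂ => q.1 + (q.2 - L q.1) • e)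
          (ContinuousLinearMap.fst ℝ E ℂ + ((ContinuousLinearMap.toSpanSingleton ℂ e).restrictScalars
            ℝ).comp (ContinuousLinearMap.snd ℝ E ℂ - (L.restrictScalars ℝ).comp
              (ContinuousLinearMap.fst ℝ E ℂ))) (z, L z - ζ) := by
        refine hasFDerivAt_fst.add ?_
        exact ((ContinuousLinearMap.toSpanSingleton ℂ e).restrictScalars ℝ).hasFDerivAt.comp _
          (hasFDerivAt_snd.sub ((L.restrictScalars ℝ).hasFDerivAt.comp _ hasFDerivAt_fst))
      have hB' := ((hB.differentiable (by simp) _).hasFDerivAt.comp _ hin).fderiv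
      change fderiv ℝ (Function.uncurry g) (z, L z - ζ) = _ at hB'
      rw [hB']
      simp [← sub_eq_add_neg]
    have hint := (ContinuousLinearMap.apply ℝ ℂ (v, L v)).integrable_comp hex
    refine ⟨hint.congr (Eventually.of_forall hval), ?_⟩
    rw [h4]
    simp only [ContinuousLinearMap.comp_apply, ContinuousLinearMap.prod_apply, convolution]
    refine (ContinuousLinearMap.integral_apply hex _).trans ?_
    exact integral_congr_ae (Eventually.of_forall hval)

end Cauchy

/-! ### The `∂̄`-equation -/

section Dolbeault

open MeasureTheory

section

variable {E : Type*} [NormedAddCommGroup E] [NormedSpace ℂ E] [NormedSpace ℝ E]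

theorem contDiff_dbar {f : E → ℂ} (hf : ContDiff ℝ ∞ f) (v : E) :
    ContDiff ℝ ∞ fun z => dbar f z v := by
  have h : ContDiff ℝ ∞ (fderiv ℝ f) := hf.fderiv_right (by simp)
  simp only [dbar]
  fun_prop

theorem dbar_add {f g : E → ℂ} {z : E} (hf : DifferentiableAt ℝ f z)
    (hg : DifferentiableAt ℝ g z) (v : E) :
    dbar (fun y => f y + g y) z v = dbar f z v + dbar g z v := by
  simp only [dbar, fderiv_fun_add hf hg, add_apply]
  ring

theorem dbar_sub {f g : E → ℂ} {z : E} (hf : DifferentiableAt ℝ f z)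
    (hg : DifferentiableAt ℝ g z) (v : E) :
    dbar (fun y => f y - g y) z v = dbar f z v - dbar g z v := by
  simp only [dbar, fderiv_fun_sub hf hg, sub_apply]
  ring

theorem dbar_congr {f g : E → ℂ} {z : E} (h : f =ᶠ[𝓝 z] g) (v : E) : dbar f z v = dbar g z v := by
  simp only [dbar, h.fderiv_eq]

/-- `∂̄² = 0`. -/
theorem dbar_dbar_comm {f : E → ℂ} (hf : ContDiff ℝ ∞ f) (z v w : E) :
    dbar (fun y => dbar f y v) z w = dbar (fun y => dbar f y w) z v := by
  have h1 : ∀ v w, fderiv ℝ (fun y => dbar f y v) z w =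
      fderiv ℝ (fderiv ℝ f) z w v + Complex.I * fderiv ℝ (fderiv ℝ f) z w (Complex.I • v) := by
    intro v w
    have h2 := hasFDerivAt_fderiv (hf.contDiffAt (x := z) |>.of_le two_le_infty)
    have h3 := (h2.clm_apply (hasFDerivAt_const v z)).fun_add
      ((h2.clm_apply (hasFDerivAt_const (Complex.I • v) z)).const_mul Complex.I)
    change fderiv ℝ (fun y => fderiv ℝ f y v + Complex.I * fderiv ℝ f y (Complex.I • v)) z w = _
    rw [h3.fderiv]
    simp
  have hs : IsSymmSndFDerivAt ℝ f z :=
    hf.contDiffAt.isSymmSndFDerivAt (by simpa using two_le_infty)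
  simp only [dbar.eq_1 (fun y => dbar f y _), h1]
  rw [hs w v, hs w (Complex.I • v), hs (Complex.I • w) v, hs (Complex.I • w) (Complex.I • v)]
  ring

theorem dbar_cauchyTransform {B : E → ℂ} (hB : ContDiff ℝ ∞ B) {L : E →L[ℂ] ℂ} {e : E}
    (hLe : L e = 1) {K : Set ℂ} (hK : IsCompact K) (hBK : ∀ z, L z ∉ K → B z = 0) (z v : E) :
    dbar (cauchyTransform B e) z v = ∫ ζ, cauchyKernel ζ * dbar B (z - ζ • e) v := by
  obtain ⟨-, h⟩ := contDiff_and_fderiv_cauchyTransform hB hLe hK hBK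
  simp only [dbar, (h z _).2]
  rw [← integral_const_mul, ← integral_add (h z _).1 ((h z _).1.const_mul _)]
  congr 1
  ext ζ
  ring

/-- The Cauchy transform inverts `2∂̄` in the direction of the line of integration. -/
theorem dbar_cauchyTransform_self [IsScalarTower ℝ ℂ E] {B : E → ℂ} (hB : ContDiff ℝ ∞ B)
    {L : E →L[ℂ] ℂ} {e : E} (hLe : L e = 1) {K : Set ℂ} (hK : IsCompact K)
    (hBK : ∀ z, L z ∉ K → B z = 0) (z : E) :
    dbar (cauchyTransform B e) z e = B z := by
  rw [dbar_cauchyTransform hB hLe hK hBK]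
  set T : ℂ →L[ℝ] E := (ContinuousLinearMap.toSpanSingleton ℂ e).restrictScalars ℝ with hT
  have hTa : ∀ w, T w = w • e := fun w => by simp [hT]
  have hG : ContDiff ℝ ∞ fun w => B (z + T w) := hB.comp (contDiff_const.add T.contDiff)
  have hc : HasCompactSupport fun w => B (z + T w) := by
    refine HasCompactSupport.intro (hK.image (f := fun y => y - L z) (by fun_prop)) fun w hw => ?_
    apply hBK
    contrapose! hw
    exact ⟨L (z + T w), hw, by simp [hTa, hLe]⟩
  have := integral_cauchyKernel_mul_dbar hG hc 0
  simp only [map_zero, add_zero] at this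
  rw [← this]
  congr 1
  ext ζ
  congr 1
  have hd : ∀ w v, fderiv ℝ (fun w => B (z + T w)) w v = fderiv ℝ B (z + T w) (T v) := by
    intro w v
    have := ((hB.differentiable (by simp) (z + T w)).hasFDerivAt.comp w
      (T.hasFDerivAt.const_add z)).fderiv
    simp only [Function.comp_def] at this
    rw [this]
    rfl
  simp only [dbar, hd]
  simp [hTa, sub_eq_add_neg]

end

variable {n : ℕ}

/-- Solvability of `2∂̄f = β` near a point for smooth `∂̄`-closed `(0,1)`-forms `β = ∑ βⱼ dz̄ⱼ`, by
induction on the set of indices of the possibly nonvanishing components: the Cauchy transform in the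
variable `zₐ` of a truncation of `βₐ` removes the component `βₐ` without creating new ones. -/
theorem exists_dbar_eq_of_finset (c : Cn n) (s : Finset (Fin n)) :
    ∀ (r : ℝ) (_ : 0 < r) (β : Fin n → Cn n → ℂ) (_ : ∀ j, ContDiff ℝ ∞ (β j))
      (_ : ∀ z : Cn n, (∀ i, ‖z i - c i‖ < r) → ∀ j k,
        dbar (β k) z (EuclideanSpace.single j 1) = dbar (β j) z (EuclideanSpace.single k 1))
      (_ : ∀ z : Cn n, (∀ i, ‖z i - c i‖ < r) → ∀ j ∉ s, β j z = 0),
      ∃ f : Cn n → ℂ, ContDiff ℝ ∞ f ∧ ∃ r' > 0, ∀ z : Cn n, (∀ i, ‖z i - c i‖ < r') →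
        ∀ j, dbar f z (EuclideanSpace.single j 1) = β j z := by
  have hopen : ∀ r : ℝ, IsOpen {z : Cn n | ∀ i, ‖z i - c i‖ < r} := by
    intro r
    simp only [ofPred_forall]
    exact isOpen_iInter_of_finite fun i => isOpen_lt (by fun_prop) continuous_const
  induction s using Finset.induction_on with
  | empty =>
    intro r hr β _ _ h0
    exact ⟨fun _ => 0, contDiff_const, r, hr, fun z hz j => by
      rw [h0 z hz j (by simp)]; simp [dbar]⟩
  | insert a s ha ih =>
    intro r hr β hβ hcl h0
    let χ : ContDiffBump (c a) := ⟨r / 2, 3 * r / 4, by positivity, by linarith⟩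
    let L : Cn n →L[ℂ] ℂ := EuclideanSpace.proj a
    let e : Fin n → Cn n := fun j => EuclideanSpace.single j 1
    have hLe : L (e a) = 1 := by simp [L, e]
    have hLe' : ∀ j, j ≠ a → L (e j) = 0 := fun j hj => by simp [L, e, hj.symm]
    -- the truncation only involves `zₐ`, so that it does not disturb the other derivatives of `βₐ`
    let B : Cn n → ℂ := fun z => χ (L z) • β a z
    have hLc : ContDiff ℝ ∞ fun z => L z := (L.restrictScalars ℝ).contDiff
    have hχ : ContDiff ℝ ∞ fun z => χ (L z) := χ.contDiff.comp hLc
    have hB : ContDiff ℝ ∞ B := hχ.smul (hβ a)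
    have hK : IsCompact (Metric.closedBall (c a) (3 * r / 4)) := isCompact_closedBall _ _
    have hχ0 : ∀ w, w ∉ Metric.closedBall (c a) (3 * r / 4) → χ w = 0 := fun w hw =>
      χ.zero_of_le_dist (by
        simp only [Metric.mem_closedBall, not_le] at hw
        exact hw.le)
    have hBK : ∀ z, L z ∉ Metric.closedBall (c a) (3 * r / 4) → B z = 0 := fun z hz => by
      simp [B, hχ0 _ hz]
    have hf1 := (contDiff_and_fderiv_cauchyTransform hB hLe hK hBK).1
    set f1 := cauchyTransform B (e a) with hf1def
    have hBeq : ∀ z : Cn n, (∀ i, ‖z i - c i‖ < r / 2) → B z = β a z := fun z hz => by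
      have : χ (L z) = 1 := χ.one_of_mem_closedBall (by
        simpa [L, dist_eq_norm] using (hz a).le)
      simp [B, this]
    -- for `j ∉ insert a s`, `∂̄ⱼβₐ = ∂̄ₐβⱼ` vanishes where the truncation does not
    have hd1 : ∀ z j, j ∉ insert a s → (∀ i, ‖z i - c i‖ < r / 2) → dbar f1 z (e j) = 0 := by
      intro z j hj hz
      rw [hf1def, dbar_cauchyTransform hB hLe hK hBK]
      refine integral_eq_zero_of_ae (Eventually.of_forall fun ζ => ?_)
      have hja : j ≠ a := fun h => hj (by simp [h])
      set y := z - ζ • e a with hy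
      have hyB : dbar B y (e j) = χ (L y) • dbar (β a) y (e j) := by
        have h1 : HasFDerivAt (fun z => χ (L z))
            ((fderiv ℝ χ (L y)).comp (L.restrictScalars ℝ)) y :=
          ((χ.contDiff (n := 1)).differentiable (by simp) (L y)).hasFDerivAt.comp y
            (L.restrictScalars ℝ).hasFDerivAt
        have h2 := (h1.fun_smul ((hβ a).differentiable (by simp) y).hasFDerivAt).fderiv
        simp only [dbar, B, h2]
        simp [hLe' j hja]
        ring
      change cauchyKernel ζ * dbar B y (e j) = 0
      rw [hyB]
      by_cases hya : L y ∈ Metric.closedBall (c a) (3 * r / 4)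
      · have hyN : ∀ i, ‖y i - c i‖ < r := by
          intro i
          by_cases hi : i = a
          · subst hi
            have : ‖y i - c i‖ ≤ 3 * r / 4 := by simpa [L, dist_eq_norm] using hya
            linarith
          · have : y i = z i := by simp [hy, e, hi]
            rw [this]
            linarith [hz i]
        have hz0 : dbar (β j) y (e a) = 0 := by
          have : β j =ᶠ[𝓝 y] fun _ => 0 := by
            filter_upwards [(hopen r).mem_nhds hyN] with x hx
            exact h0 x hx j hj
          rw [dbar_congr this]
          simp [dbar]
        rw [hcl y hyN j a, hz0]
        simp
      · simp [hχ0 _ hya]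
    obtain ⟨f2, hf2, r', hr', hsol⟩ := ih (r / 2) (by positivity)
      (fun j z => β j z - dbar f1 z (e j)) (fun j => (hβ j).sub (contDiff_dbar hf1 _))
      (fun z hz j k => by
        rw [dbar_sub ((hβ k).differentiable (by simp) z)
            ((contDiff_dbar hf1 _).differentiable (by simp) z),
          dbar_sub ((hβ j).differentiable (by simp) z)
            ((contDiff_dbar hf1 _).differentiable (by simp) z),
          hcl z (fun i => (hz i).trans (by linarith)) j k, dbar_dbar_comm hf1])
      (fun z hz j hj => by
        by_cases hja : j = a
        · subst hja
          rw [hf1def, dbar_cauchyTransform_self hB hLe hK hBK, hBeq z hz, sub_self]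
        · have : j ∉ insert a s := by simp [hja, hj]
          rw [hd1 z j this hz, h0 z (fun i => (hz i).trans (by linarith)) j this, sub_self])
    refine ⟨fun z => f1 z + f2 z, hf1.add hf2, r', hr', fun z hz j => ?_⟩
    rw [dbar_add (hf1.differentiable (by simp) z) (hf2.differentiable (by simp) z), hsol z hz j]
    exact add_sub_cancel _ _

end Dolbeault

/-! ### The local `dd^c`-lemma -/

section DdcLemma

/-- The exterior derivative of a one-form, given as a family of linear forms. -/
theorem extDeriv_ofSubsingleton_apply {E : Type*} [NormedAddCommGroup E] [NormedSpace ℝ E]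
    {a : E → E →L[ℝ] ℝ} {z : E} (ha : DifferentiableAt ℝ a z) (v w : E) :
    extDeriv (fun y => ContinuousAlternatingMap.ofSubsingleton ℝ E ℝ (0 : Fin 1) (a y)) z ![v, w] =
      fderiv ℝ a z v w - fderiv ℝ a z w v := by
  have hd : DifferentiableAt ℝ
      (fun y => ContinuousAlternatingMap.ofSubsingleton ℝ E ℝ (0 : Fin 1) (a y)) z :=
    (ContinuousAlternatingMap.ofSubsingletonLIE (𝕜 := ℝ) (E := E) (F := ℝ)
      (0 : Fin 1)).differentiableAt.comp z ha
  rw [extDeriv_apply hd, Fin.sum_univ_two]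
  have h : ∀ u : E, fderiv ℝ (fun y => a y u) z = (fderiv ℝ a z).flip u := fun u => by
    have := (ha.hasFDerivAt.clm_apply (hasFDerivAt_const u z)).fderiv
    rw [this]
    simp
  simp [Fin.removeNth, h, sub_eq_add_neg]

variable {n : ℕ}

theorem mulI_apply (v : Cn n) : mulI n v = Complex.I • v := rfl

theorem extDeriv_dcModel_apply {h : Cn n → ℝ} {z : Cn n} (hh : ContDiffAt ℝ 2 h z) (v w : Cn n) :
    extDeriv (dcModel h) z ![v, w] = (2 * Real.pi)⁻¹ *
      (fderiv ℝ (fderiv ℝ h) z w (Complex.I • v) - fderiv ℝ (fderiv ℝ h) z v (Complex.I • w)) := by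
  have h1 := (hasFDerivAt_fderiv hh).clm_comp (hasFDerivAt_const (mulI n) z)
  have h2 := h1.const_smul (-(2 * Real.pi)⁻¹)
  have h3 := extDeriv_ofSubsingleton_apply h2.differentiableAt v w
  refine h3.trans ?_
  rw [h2.fderiv]
  simp [mulI_apply]
  ring

theorem extDeriv_dcModel_apply_self {h : Cn n → ℝ} {z : Cn n} (hh : ContDiffAt ℝ 2 h z)
    (v : Cn n) : 2 * Real.pi * extDeriv (dcModel h) z ![v, Complex.I • v] = leviForm h z v := by
  rw [extDeriv_dcModel_apply hh, leviForm, smul_smul, Complex.I_mul_I]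
  have := Real.pi_pos
  field_simp
  simp [add_comm]

/-- `dd^c h` is of type `(1,1)`. -/
theorem extDeriv_dcModel_smul_I {h : Cn n → ℝ} {z : Cn n} (hh : ContDiffAt ℝ 2 h z) (v w : Cn n) :
    extDeriv (dcModel h) z ![Complex.I • v, Complex.I • w] = extDeriv (dcModel h) z ![v, w] := by
  have hs : IsSymmSndFDerivAt ℝ h z := hh.isSymmSndFDerivAt (by simp)
  rw [extDeriv_dcModel_apply hh, extDeriv_dcModel_apply hh, smul_smul, smul_smul, Complex.I_mul_I,
    neg_one_smul, neg_one_smul, map_neg, map_neg, hs w, hs v]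
  ring

theorem twoForm_swap {E : Type*} [NormedAddCommGroup E] [NormedSpace ℝ E]
    (A : E [⋀^Fin 2]→L[ℝ] ℝ) (v w : E) : A ![v, w] = -A ![w, v] := by
  have := A.map_swap ![w, v] (i := 0) (j := 1) (by simp)
  have h : ![w, v] ∘ Equiv.swap (0 : Fin 2) 1 = ![v, w] := by
    ext i
    fin_cases i <;> rfl
  rw [h] at this
  exact this

theorem twoForm_ext {E : Type*} [NormedAddCommGroup E] [NormedSpace ℝ E]
    {A B : E [⋀^Fin 2]→L[ℝ] ℝ} (h : ∀ v w, A ![v, w] = B ![v, w]) : A = B := by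
  ext x
  have : x = ![x 0, x 1] := by ext i; fin_cases i <;> rfl
  rw [this]
  exact h _ _

/-- An alternating form of degree two as a bilinear map. -/
noncomputable def twoFormBilin (A : Cn n [⋀^Fin 2]→L[ℝ] ℝ) : Cn n →L[ℝ] Cn n →L[ℝ] ℝ :=
  have h0 : ∀ w x : Cn n, Function.update ![0, w] 0 x = ![x, w] := fun w x => by
    ext1 i; fin_cases i <;> rfl
  have h1 : ∀ v x : Cn n, Function.update ![v, 0] 1 x = ![v, x] := fun v x => by
    ext1 i; fin_cases i <;> rfl
  LinearMap.toContinuousBilinearMap (LinearMap.mk₂ ℝ (fun v w => A ![v, w])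
    (fun v v' w => by simpa only [h0] using A.map_update_add ![0, w] 0 v v')
    (fun c v w => by simpa only [h0] using A.map_update_smul ![0, w] 0 c v)
    (fun v w w' => by simpa only [h1] using A.map_update_add ![v, 0] 1 w w')
    (fun c v w => by simpa only [h1] using A.map_update_smul ![v, 0] 1 c w))

theorem twoFormBilin_apply (A : Cn n [⋀^Fin 2]→L[ℝ] ℝ) (v w : Cn n) :
    twoFormBilin A v w = A ![v, w] := rfl

theorem cn_sum_smul_single (v : Cn n) :
    ∑ i, v i • (EuclideanSpace.single i (1 : ℂ) : Cn n) = v := by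
  ext j
  simp [Pi.single_apply]

/-- The local `dd^c`-lemma: a smooth closed real `(1,1)`-form is locally `dd^c h` with `h` smooth.
If `Ω = dα` and `f = p + i q` solves `2∂̄f = α + i α ∘ J`, then `α = dp - dq ∘ J`, so that
`Ω = 2π dd^c q`. -/
theorem exists_extDeriv_dcModel_eq {Ω : Cn n → Cn n [⋀^Fin 2]→L[ℝ] ℝ} {U : Set (Cn n)}
    (hU : IsOpen U) (hΩ : ContDiffOn ℝ ∞ Ω U) (hcl : ∀ z ∈ U, extDeriv Ω z = 0)
    (h11 : ∀ z ∈ U, ∀ v w, Ω z ![Complex.I • v, Complex.I • w] = Ω z ![v, w]) {z₀ : Cn n}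
    (hz₀ : z₀ ∈ U) :
    ∃ h : Cn n → ℝ, ContDiff ℝ ∞ h ∧ ∀ᶠ z in 𝓝 z₀, extDeriv (dcModel h) z = Ω z := by
  obtain ⟨Ω', U', hΩ', hU', hzU', hUU', heq⟩ := exists_contDiff_eq_near_compact
    (isCompact_singleton (x := z₀)) hU (by simpa using hz₀) hΩ
  rw [singleton_subset_iff] at hzU'
  obtain ⟨r, hr, hball⟩ := Metric.mem_nhds_iff.1 (hU'.mem_nhds hzU')
  have happ : ∀ v w, ContDiff ℝ ∞ fun z => Ω' z ![v, w] := fun v w =>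
    (ContinuousAlternatingMap.apply ℝ (Cn n) ℝ ![v, w]).contDiff.comp hΩ'
  have hb : ContDiff ℝ ∞ fun z => twoFormBilin (Ω' z) := by
    rw [contDiff_clm_apply_iff]
    intro v
    rw [contDiff_clm_apply_iff]
    exact happ v
  have hbd : ∀ z a b c, fderiv ℝ (fun z => twoFormBilin (Ω' z)) z a b c =
      fderiv ℝ (fun z => Ω' z ![b, c]) z a := by
    intro z a b c
    have h1 := (((hb.differentiable (by simp) z).hasFDerivAt.clm_apply
      (hasFDerivAt_const b z)).clm_apply (hasFDerivAt_const c z)).fderiv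
    simp only [twoFormBilin_apply] at h1
    rw [h1]
    simp
  obtain ⟨α, hα, hdα⟩ := exists_primitive_of_closed hb z₀ (r := r)
    (fun z _ v w => twoForm_swap _ v w) (fun z hz a b c => by
      have h1 : extDeriv Ω' z = 0 := by
        rw [(heq.eventuallyEq_of_mem (hU'.mem_nhds (hball hz))).extDeriv_eq]
        exact hcl z (hUU' (hball hz))
      have h2 := extDeriv_apply (hΩ'.differentiable (by simp) z) ![a, b, c]
      rw [h1, Fin.sum_univ_three] at h2
      simp only [hbd]
      have e0 : (0 : Fin 3).removeNth ![a, b, c] = ![b, c] := by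
        ext i; fin_cases i <;> rfl
      have e1 : (1 : Fin 3).removeNth ![a, b, c] = ![a, c] := by
        ext i; fin_cases i <;> rfl
      have e2 : (2 : Fin 3).removeNth ![a, b, c] = ![a, b] := by
        ext i; fin_cases i <;> rfl
      simp only [e0, e1, e2] at h2
      simp at h2
      linarith)
  simp only [twoFormBilin_apply] at hdα
  let β : Fin n → Cn n → ℂ := fun j z => (α z (EuclideanSpace.single j 1) : ℂ) +
    Complex.I * (α z (Complex.I • EuclideanSpace.single j 1) : ℂ)
  have hαv : ∀ v, ContDiff ℝ ∞ fun z => (α z v : ℂ) := fun v =>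
    Complex.ofRealCLM.contDiff.comp (hα.clm_apply contDiff_const)
  have hβ : ∀ j, ContDiff ℝ ∞ (β j) := fun j => (hαv _).add (contDiff_const.mul (hαv _))
  have hαd : ∀ z v, HasFDerivAt (fun z => (α z v : ℂ))
      (Complex.ofRealCLM.comp ((fderiv ℝ α z).flip v)) z := fun z v => by
    have h1 := (hα.differentiable (by simp) z).hasFDerivAt.clm_apply (hasFDerivAt_const v z)
    have h2 := Complex.ofRealCLM.hasFDerivAt.comp z h1
    convert! h2 using 1
    ext w
    simp
  have hβd : ∀ j z v, fderiv ℝ (β j) z v = (fderiv ℝ α z v (EuclideanSpace.single j 1) : ℂ) +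
      Complex.I * (fderiv ℝ α z v (Complex.I • EuclideanSpace.single j 1) : ℂ) := by
    intro j z v
    have h1 := ((hαd z (EuclideanSpace.single j 1)).fun_add
      ((hαd z (Complex.I • EuclideanSpace.single j 1)).const_mul Complex.I)).fderiv
    simp only [β]
    rw [h1]
    simp
  have hΩ'11 : ∀ z ∈ Metric.ball z₀ r, ∀ v w,
      Ω' z ![Complex.I • v, Complex.I • w] = Ω' z ![v, w] := by
    intro z hz v w
    rw [heq (hball hz)]
    exact h11 z (hUU' (hball hz)) v w
  have hΩ'11' : ∀ z ∈ Metric.ball z₀ r, ∀ v w,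
      Ω' z ![Complex.I • v, w] = -Ω' z ![v, Complex.I • w] := by
    intro z hz v w
    rw [← hΩ'11 z hz v (Complex.I • w), smul_smul, Complex.I_mul_I]
    have := (twoFormBilin (Ω' z) (Complex.I • v)).map_neg w
    simp only [twoFormBilin_apply] at this
    rw [neg_one_smul, this, neg_neg]
  obtain ⟨ε, hε, hεr⟩ : ∃ ε > 0, ∀ z : Cn n, (∀ i, ‖z i - z₀ i‖ < ε) → z ∈ Metric.ball z₀ r := by
    have hcont : ContinuousAt (EuclideanSpace.equiv (Fin n) ℂ).symm
        (EuclideanSpace.equiv (Fin n) ℂ z₀) := ContinuousLinearEquiv.continuousAt _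
    have := hcont (Metric.ball_mem_nhds _ hr)
    obtain ⟨ε, hε, hb⟩ := Metric.mem_nhds_iff.1 this
    refine ⟨ε, hε, fun z hz => ?_⟩
    have h1 : EuclideanSpace.equiv (Fin n) ℂ z ∈
        Metric.ball (EuclideanSpace.equiv (Fin n) ℂ z₀) ε := by
      rw [Metric.mem_ball, dist_pi_lt_iff hε]
      intro i
      rw [dist_eq_norm]
      exact hz i
    exact hb h1
  -- `β` is `∂̄`-closed since `dα` is of type `(1,1)`
  obtain ⟨f, hf, r', hr', hsol⟩ := exists_dbar_eq_of_finset z₀ Finset.univ ε hε β hβ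
    (fun z hz j k => by
      have hzb := hεr z hz
      have A1 := hdα z hzb (EuclideanSpace.single j 1) (EuclideanSpace.single k 1)
      have A2 := hdα z hzb (EuclideanSpace.single j 1) (Complex.I • EuclideanSpace.single k 1)
      have A3 := hdα z hzb (Complex.I • EuclideanSpace.single j 1) (EuclideanSpace.single k 1)
      have A4 := hdα z hzb (Complex.I • EuclideanSpace.single j 1)
        (Complex.I • EuclideanSpace.single k 1)
      rw [hΩ'11' z hzb] at A3
      rw [hΩ'11 z hzb] at A4
      have B1 := A1.trans A4.symm
      have B2 := A2.trans (neg_eq_iff_eq_neg.2 A3).symm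
      simp only [dbar, hβd]
      apply Complex.ext <;> simp
      · linarith
      · linarith)
    (fun z _ j hj => absurd (Finset.mem_univ j) hj)
  have hsolv : ∀ z : Cn n, (∀ i, ‖z i - z₀ i‖ < r') → ∀ v,
      dbar f z v = (α z v : ℂ) + Complex.I * (α z (Complex.I • v) : ℂ) := by
    intro z hz v
    -- both sides are antilinear in `v`, and they agree on the standard basis
    set A : Cn n → ℂ := fun v => dbar f z v - ((α z v : ℂ) + Complex.I * (α z (Complex.I • v) : ℂ))
      with hA
    have hadd : ∀ v w, A (v + w) = A v + A w := fun v w => by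
      simp only [hA, dbar, map_add, smul_add]
      push_cast
      ring
    have hsm : ∀ (c : ℂ) v, A (c • v) = (starRingEnd ℂ c) * A v := fun c v => by
      have key : ∀ (r : ℝ) (x : Cn n), (r : ℂ) • x = r • x := fun r x => algebraMap_smul ℂ r x
      have h1 : c • v = c.re • v + c.im • (Complex.I • v) := by
        rw [← key, ← key, smul_smul, ← add_smul, Complex.re_add_im]
      have h2 : Complex.I • (c • v) = -c.im • v + c.re • (Complex.I • v) := by
        rw [← key, ← key, smul_smul, smul_smul, ← add_smul]
        congr 1
        apply Complex.ext <;> simp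
      have h3 : starRingEnd ℂ c = c.re - c.im * Complex.I := by
        apply Complex.ext <;> simp
      simp only [hA, dbar]
      rw [h2, h1, h3]
      simp only [map_add, map_smul, Complex.real_smul, smul_eq_mul]
      push_cast
      linear_combination (-c.im * fderiv ℝ f z (Complex.I • v) +
        c.im * α z (Complex.I • v)) * (-Complex.I_mul_I)
    have hA0 : A 0 = 0 := by simp [hA, dbar]
    have hsum : ∀ s : Finset (Fin n),
        A (∑ i ∈ s, v i • (EuclideanSpace.single i (1 : ℂ) : Cn n)) = 0 := by
      intro s
      induction s using Finset.induction_on with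
      | empty => simpa using hA0
      | insert a s ha ih =>
        rw [Finset.sum_insert ha, hadd, ih, hsm]
        have : A (EuclideanSpace.single a 1) = 0 := by
          simp only [hA, hsol z hz a, β, sub_self]
        rw [this]
        simp
    have := hsum Finset.univ
    rw [cn_sum_smul_single] at this
    exact sub_eq_zero.1 this
  let p : Cn n → ℝ := fun z => (f z).re
  let q : Cn n → ℝ := fun z => (f z).im
  have hp : ContDiff ℝ ∞ p := Complex.reCLM.contDiff.comp hf
  have hq : ContDiff ℝ ∞ q := Complex.imCLM.contDiff.comp hf
  have hpd : ∀ z v, fderiv ℝ p z v = (fderiv ℝ f z v).re := fun z v => by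
    have := (Complex.reCLM.hasFDerivAt.comp z (hf.differentiable (by simp) z).hasFDerivAt).fderiv
    change fderiv ℝ p z = _ at this
    rw [this]
    rfl
  have hqd : ∀ z v, fderiv ℝ q z v = (fderiv ℝ f z v).im := fun z v => by
    have := (Complex.imCLM.hasFDerivAt.comp z (hf.differentiable (by simp) z).hasFDerivAt).fderiv
    change fderiv ℝ q z = _ at this
    rw [this]
    rfl
  have hN : {z : Cn n | ∀ i, ‖z i - z₀ i‖ < r'} ∈ 𝓝 z₀ := by
    refine IsOpen.mem_nhds ?_ fun i => by simpa using hr'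
    simp only [ofPred_forall]
    exact isOpen_iInter_of_finite fun i => isOpen_lt (by fun_prop) continuous_const
  have hαeq : ∀ z : Cn n, (∀ i, ‖z i - z₀ i‖ < r') → ∀ v,
      fderiv ℝ q z (Complex.I • v) = fderiv ℝ p z v - α z v := by
    intro z hz v
    have := congrArg Complex.re (hsolv z hz v)
    simp [dbar] at this
    rw [hpd, hqd]
    linarith
  refine ⟨fun z => 2 * Real.pi * q z, contDiff_const.mul hq, ?_⟩
  have hNball : ∀ᶠ z in 𝓝 z₀, z ∈ Metric.ball z₀ r := Metric.ball_mem_nhds _ hr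
  filter_upwards [eventually_eventually_nhds.2 hN, hNball] with z hz hzb
  have hpz : ContDiffAt ℝ 2 p z := hp.contDiffAt.of_le two_le_infty
  have hqz : ContDiffAt ℝ 2 q z := hq.contDiffAt.of_le two_le_infty
  apply twoForm_ext
  intro v w
  rw [extDeriv_dcModel_apply ((contDiff_const.mul hq).contDiffAt.of_le two_le_infty)]
  have hd : fderiv ℝ (fun y => 2 * Real.pi * q y) = fun y => (2 * Real.pi) • fderiv ℝ q y := by
    ext1 y
    exact congrFun (fderiv_const_smul_field (𝕜 := ℝ) (f := q) (2 * Real.pi)) y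
  have hd2 : fderiv ℝ (fun y => (2 * Real.pi) • fderiv ℝ q y) z =
      (2 * Real.pi) • fderiv ℝ (fderiv ℝ q) z :=
    congrFun (fderiv_const_smul_field (𝕜 := ℝ) (f := fderiv ℝ q) (2 * Real.pi)) z
  have hkey : ∀ a b, fderiv ℝ (fderiv ℝ q) z a (Complex.I • b) =
      fderiv ℝ (fderiv ℝ p) z a b - fderiv ℝ α z a b := by
    intro a b
    have h1 : (fun y => fderiv ℝ q y (Complex.I • b)) =ᶠ[𝓝 z] fun y => fderiv ℝ p y b - α y b :=
      hz.mono fun y hy => hαeq y hy b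
    have h2 := h1.fderiv_eq (𝕜 := ℝ)
    have h3 := ((hasFDerivAt_fderiv hqz).clm_apply
      (hasFDerivAt_const (Complex.I • b) z)).fderiv
    have h4 := (((hasFDerivAt_fderiv hpz).clm_apply (hasFDerivAt_const b z)).fun_sub
      ((hα.differentiable (by simp) z).hasFDerivAt.clm_apply (hasFDerivAt_const b z))).fderiv
    rw [h3, h4] at h2
    have := congrArg (fun T : Cn n →L[ℝ] ℝ => T a) h2
    simpa using this
  have hs : IsSymmSndFDerivAt ℝ p z := hpz.isSymmSndFDerivAt (by simp)
  rw [hd, hd2]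
  simp only [smul_apply, smul_eq_mul, hkey]
  rw [← heq (hball hzb), ← hdα z hzb v w, hs v w]
  have := Real.pi_pos
  field_simp
  ring

end DdcLemma

/-! ### Holomorphic charts -/

section ComplexManifold

variable {n : ℕ} {V : Type*} [TopologicalSpace V] [ChartedSpace (Cn n) V]

theorem contDiffGroupoid_complex_le_real :
    contDiffGroupoid ω 𝓘(ℂ, Cn n) ≤ contDiffGroupoid ∞ 𝓘(ℝ, Cn n) := by
  intro e he
  change e ∈ (contDiffPregroupoid ω 𝓘(ℂ, Cn n)).groupoid at he
  change e ∈ (contDiffPregroupoid ∞ 𝓘(ℝ, Cn n)).groupoid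
  rw [mem_groupoid_of_pregroupoid] at he ⊢
  simp only [contDiffPregroupoid, modelWithCornersSelf_coe, modelWithCornersSelf_coe_symm,
    Function.id_comp, Function.comp_id, preimage_id, range_id, inter_univ] at he ⊢
  exact ⟨(he.1.restrict_scalars ℝ).of_le le_top, (he.2.restrict_scalars ℝ).of_le le_top⟩

theorem maximalAtlas_complex_subset_real :
    IsManifold.maximalAtlas 𝓘(ℂ, Cn n) ω V ⊆ IsManifold.maximalAtlas 𝓘(ℝ, Cn n) ∞ V :=
  StructureGroupoid.maximalAtlas_mono contDiffGroupoid_complex_le_real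

section Coordinates

variable {e : OpenPartialHomeomorph V (Cn n)} {x : V}

theorem contDiffAt_comp_symm (he : e ∈ IsManifold.maximalAtlas 𝓘(ℝ, Cn n) ∞ V) {u : V → ℝ}
    (hx : x ∈ e.source) (hu : ContMDiffAt 𝓘(ℝ, Cn n) 𝓘(ℝ, ℝ) ∞ u x) :
    ContDiffAt ℝ ∞ (u ∘ e.symm) (e x) := by
  rw [← contMDiffAt_iff_contDiffAt]
  refine ContMDiffAt.comp (e x) ?_ (contMDiffAt_symm_of_mem_maximalAtlas he (e.map_source hx))
  rwa [e.left_inv hx]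

theorem contMDiffAt_comp_chart (he : e ∈ IsManifold.maximalAtlas 𝓘(ℝ, Cn n) ∞ V) {h : Cn n → ℝ}
    (hx : x ∈ e.source) (hh : ContDiffAt ℝ ∞ h (e x)) :
    ContMDiffAt 𝓘(ℝ, Cn n) 𝓘(ℝ, ℝ) ∞ (h ∘ e) x :=
  hh.contMDiffAt.comp x (contMDiffAt_of_mem_maximalAtlas he hx)

theorem contDiffAt_transition {e' : OpenPartialHomeomorph V (Cn n)}
    (he : e ∈ IsManifold.maximalAtlas 𝓘(ℂ, Cn n) ω V)
    (he' : e' ∈ IsManifold.maximalAtlas 𝓘(ℂ, Cn n) ω V) (hx : x ∈ e.source) (hx' : x ∈ e'.source) :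
    ContDiffAt ℂ ω (e' ∘ e.symm) (e x) := by
  rw [← contMDiffAt_iff_contDiffAt]
  refine ContMDiffAt.comp (e x) ?_ (contMDiffAt_symm_of_mem_maximalAtlas he (e.map_source hx))
  rw [e.left_inv hx]
  exact contMDiffAt_of_mem_maximalAtlas he' hx'

theorem comp_symm_eventuallyEq {u w : V → ℝ} (hx : x ∈ e.source) (h : u =ᶠ[𝓝 x] w) :
    u ∘ e.symm =ᶠ[𝓝 (e x)] w ∘ e.symm := by
  have hc : ContinuousAt e.symm (e x) := e.continuousAt_symm (e.map_source hx)
  refine hc.eventually (p := fun y => u y = w y) ?_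
  rwa [e.left_inv hx]

theorem eventually_comp_symm {p : V → Prop} (hx : x ∈ e.source) (h : ∀ᶠ y in 𝓝 x, p y) :
    ∀ᶠ z in 𝓝 (e x), p (e.symm z) := by
  have hc : ContinuousAt e.symm (e x) := e.continuousAt_symm (e.map_source hx)
  refine hc.eventually (p := p) ?_
  rwa [e.left_inv hx]

/-! ### Levi forms of functions on a complex manifold -/

/-- The Levi form `4 ∂∂̄u(v, v̄)` of a function on `V`, read in the preferred chart at `x`. -/
noncomputable def lev (u : V → ℝ) (x : V) (v : Cn n) : ℝ :=
  leviForm (u ∘ (chartAt (Cn n) x).symm) (chartAt (Cn n) x x) v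

/-- The squared gradient `4 |∂u(v)|²` of a function on `V`, read in the preferred chart at `x`. -/
noncomputable def grad (u : V → ℝ) (x : V) (v : Cn n) : ℝ :=
  gradSq (u ∘ (chartAt (Cn n) x).symm) (chartAt (Cn n) x x) v

theorem lev_congr {u w : V → ℝ} (h : u =ᶠ[𝓝 x] w) (v : Cn n) : lev u x v = lev w x v :=
  leviForm_congr (comp_symm_eventuallyEq (mem_chart_source _ x) h) v

theorem lev_smul (u : V → ℝ) (v : Cn n) (c : ℂ) : lev u x (c • v) = ‖c‖ ^ 2 * lev u x v :=
  leviForm_smul _ _ _ _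

theorem lev_zero_right (u : V → ℝ) : lev u x (0 : Cn n) = 0 := leviForm_zero_right _ _

theorem lev_const_mul (u : V → ℝ) (c : ℝ) (v : Cn n) :
    lev (fun y => c * u y) x v = c * lev u x v :=
  leviForm_const_mul c v

theorem grad_eq_zero_of_nonneg {u : V → ℝ} (h : ∀ᶠ y in 𝓝 x, 0 ≤ u y) (h0 : u x = 0)
    (v : Cn n) : grad u x v = 0 :=
  gradSq_eq_zero_of_nonneg (eventually_comp_symm (p := fun y => 0 ≤ u y) (mem_chart_source _ x) h) (by simp [h0]) v

theorem grad_nonneg (u : V → ℝ) (v : Cn n) : 0 ≤ grad u x v := by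
  unfold grad gradSq
  positivity

variable [IsManifold 𝓘(ℂ, Cn n) ω V]

/-- A complex manifold is a real smooth manifold. -/
instance : IsManifold 𝓘(ℝ, Cn n) ∞ V where
  toHasGroupoid := hasGroupoid_of_le (G₁ := contDiffGroupoid ω 𝓘(ℂ, Cn n))
    inferInstance contDiffGroupoid_complex_le_real

/-- The differential at `x` of the holomorphic chart `e`, the tangent space at `x` being identified
with `ℂⁿ` by the preferred chart at `x`. -/
noncomputable def tangentCoord (e : OpenPartialHomeomorph V (Cn n)) (x : V) : Cn n →L[ℂ] Cn n :=
  fderiv ℂ (e ∘ (chartAt (Cn n) x).symm) (chartAt (Cn n) x x)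

theorem fderiv_transition_comp {e' : OpenPartialHomeomorph V (Cn n)}
    (he : e ∈ IsManifold.maximalAtlas 𝓘(ℂ, Cn n) ω V)
    (he' : e' ∈ IsManifold.maximalAtlas 𝓘(ℂ, Cn n) ω V) (hx : x ∈ e.source) (hx' : x ∈ e'.source)
    (v : Cn n) :
    fderiv ℂ (e ∘ e'.symm) (e' x) (fderiv ℂ (e' ∘ e.symm) (e x) v) = v := by
  have h1 := ((contDiffAt_transition he he' hx hx').differentiableAt (by simp)).hasFDerivAt
  have h2 := ((contDiffAt_transition he' he hx' hx).differentiableAt (by simp)).hasFDerivAt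
  have h3 : HasFDerivAt (e ∘ e'.symm) (fderiv ℂ (e ∘ e'.symm) (e' x)) ((e' ∘ e.symm) (e x)) := by
    simpa [e.left_inv hx] using h2
  have h4 := h3.comp (e x) h1
  have h5 : (e ∘ e'.symm) ∘ (e' ∘ e.symm) =ᶠ[𝓝 (e x)] id := by
    have hc : ContinuousAt e.symm (e x) := e.continuousAt_symm (e.map_source hx)
    have hm : ∀ᶠ z in 𝓝 (e x), e.symm z ∈ e'.source :=
      hc.eventually (p := fun y => y ∈ e'.source)
        (by rw [e.left_inv hx]; exact e'.open_source.mem_nhds hx')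
    filter_upwards [hm, e.open_target.mem_nhds (e.map_source hx)] with z h1 h2
    simp [e'.left_inv h1, e.right_inv h2]
  have h6 := h4.unique ((hasFDerivAt_id (𝕜 := ℂ) (e x)).congr_of_eventuallyEq h5)
  exact congrArg (fun T : Cn n →L[ℂ] Cn n => T v) h6

theorem exists_tangentCoord_inverse (he : e ∈ IsManifold.maximalAtlas 𝓘(ℂ, Cn n) ω V)
    (hx : x ∈ e.source) :
    ∃ S : Cn n →L[ℂ] Cn n, (∀ v, S (tangentCoord e x v) = v) ∧ ∀ w, tangentCoord e x (S w) = w :=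
  have h0 := IsManifold.chart_mem_maximalAtlas (I := 𝓘(ℂ, Cn n)) (n := ω) x
  ⟨fderiv ℂ (chartAt (Cn n) x ∘ e.symm) (e x),
    fderiv_transition_comp h0 he (mem_chart_source _ x) hx,
    fderiv_transition_comp he h0 hx (mem_chart_source _ x)⟩

theorem tangentCoord_ne_zero (he : e ∈ IsManifold.maximalAtlas 𝓘(ℂ, Cn n) ω V)
    (hx : x ∈ e.source) {v : Cn n} (hv : v ≠ 0) : tangentCoord e x v ≠ 0 := by
  obtain ⟨S, hS, -⟩ := exists_tangentCoord_inverse he hx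
  intro h
  exact hv (by rw [← hS v, h, map_zero])

theorem contDiffAt_chartAt {u : V → ℝ} (hu : ContMDiffAt 𝓘(ℝ, Cn n) 𝓘(ℝ, ℝ) ∞ u x) :
    ContDiffAt ℝ ∞ (u ∘ (chartAt (Cn n) x).symm) (chartAt (Cn n) x x) :=
  contDiffAt_comp_symm (IsManifold.chart_mem_maximalAtlas x) (mem_chart_source _ x) hu

theorem comp_symm_chartAt_eq (u : V → ℝ) (hx : x ∈ e.source) :
    u ∘ (chartAt (Cn n) x).symm =ᶠ[𝓝 (chartAt (Cn n) x x)]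
      (u ∘ e.symm) ∘ (e ∘ (chartAt (Cn n) x).symm) := by
  filter_upwards [eventually_comp_symm (mem_chart_source (Cn n) x) (e.open_source.mem_nhds hx)]
    with z hz
  simp [e.left_inv hz]

/-- The Levi form may be computed in any holomorphic chart. -/
theorem lev_eq_leviForm (he : e ∈ IsManifold.maximalAtlas 𝓘(ℂ, Cn n) ω V) (hx : x ∈ e.source)
    {u : V → ℝ} (hu : ContMDiffAt 𝓘(ℝ, Cn n) 𝓘(ℝ, ℝ) ∞ u x) (v : Cn n) :
    lev u x v = leviForm (u ∘ e.symm) (e x) (tangentCoord e x v) := by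
  have h0 := IsManifold.chart_mem_maximalAtlas (I := 𝓘(ℂ, Cn n)) (n := ω) x
  have hx0 := mem_chart_source (Cn n) x
  have hp : (e ∘ (chartAt (Cn n) x).symm) (chartAt (Cn n) x x) = e x := by simp
  rw [lev, leviForm_congr (comp_symm_chartAt_eq u hx), leviForm_comp_holomorphic, hp, tangentCoord]
  · exact (contDiffAt_transition h0 he hx0 hx).of_le le_top
  · rw [hp]
    exact (contDiffAt_comp_symm (maximalAtlas_complex_subset_real he) hx hu).of_le two_le_infty

theorem grad_eq_gradSq (he : e ∈ IsManifold.maximalAtlas 𝓘(ℂ, Cn n) ω V) (hx : x ∈ e.source)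
    {u : V → ℝ} (hu : ContMDiffAt 𝓘(ℝ, Cn n) 𝓘(ℝ, ℝ) ∞ u x) (v : Cn n) :
    grad u x v = gradSq (u ∘ e.symm) (e x) (tangentCoord e x v) := by
  have h0 := IsManifold.chart_mem_maximalAtlas (I := 𝓘(ℂ, Cn n)) (n := ω) x
  have hx0 := mem_chart_source (Cn n) x
  have hp : (e ∘ (chartAt (Cn n) x).symm) (chartAt (Cn n) x x) = e x := by simp
  rw [grad, gradSq_congr (comp_symm_chartAt_eq u hx)]
  have h1 := ((contDiffAt_transition h0 he hx0 hx).differentiableAt (by simp)).hasFDerivAt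
  have h2 := ((contDiffAt_comp_symm (maximalAtlas_complex_subset_real he) hx hu).differentiableAt
    (by simp)).hasFDerivAt
  rw [← hp] at h2
  have h3 := (h2.comp _ (h1.restrictScalars ℝ)).fderiv
  simp only [gradSq, h3, tangentCoord]
  simp

theorem lev_add {u w : V → ℝ} (hu : ContMDiffAt 𝓘(ℝ, Cn n) 𝓘(ℝ, ℝ) ∞ u x)
    (hw : ContMDiffAt 𝓘(ℝ, Cn n) 𝓘(ℝ, ℝ) ∞ w x) (v : Cn n) :
    lev (fun y => u y + w y) x v = lev u x v + lev w x v :=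
  leviForm_add ((contDiffAt_chartAt hu).of_le two_le_infty)
    ((contDiffAt_chartAt hw).of_le two_le_infty) v

theorem lev_nonneg_of_nonneg {u : V → ℝ} (hu : ContMDiffAt 𝓘(ℝ, Cn n) 𝓘(ℝ, ℝ) ∞ u x)
    (h : ∀ᶠ y in 𝓝 x, 0 ≤ u y) (h0 : u x = 0) (v : Cn n) : 0 ≤ lev u x v :=
  leviForm_nonneg_of_nonneg ((contDiffAt_chartAt hu).of_le two_le_infty)
    (eventually_comp_symm (p := fun y => 0 ≤ u y) (mem_chart_source _ x) h) (by simp [h0]) v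

end Coordinates

end ComplexManifold

/-! ### Local potentials of a Kähler form -/

section Kahler

variable {n : ℕ} {V : Type*} [TopologicalSpace V] [ChartedSpace (Cn n) V]
  [IsManifold 𝓘(ℂ, Cn n) ω V]

/-- The Hermitian quadratic form `2π κ(v, Jv)` attached to a real two-form `κ`. The constant is
chosen so that it is the Levi form of `ρ` when `κ = dd^c ρ`. -/
noncomputable def hermForm (κ : TwoForm n V) (x : V) (v : TangentSpace 𝓘(ℝ, Cn n) x) : ℝ :=
  2 * Real.pi * κ x ![v, complexStructure x v]

theorem lev_eq_hermForm {ρ : V → ℝ} {κ : TwoForm n V} {x : V}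
    (hρ : ContMDiffAt 𝓘(ℝ, Cn n) 𝓘(ℝ, ℝ) ∞ ρ x) (h : ddc ρ x = κ x) (v : Cn n) :
    lev ρ x v = hermForm κ x v := by
  change lev ρ x v = 2 * Real.pi * κ x ![v, complexStructure x v]
  rw [← h]
  exact (extDeriv_dcModel_apply_self ((contDiffAt_chartAt hρ).of_le two_le_infty) v).symm

/-- A form of type `(1,1)` is determined by its values on the pairs `(v, Jv)`. -/
theorem twoForm_ext_of_type_one_one {A B : Cn n [⋀^Fin 2]→L[ℝ] ℝ}
    (hA : ∀ v w, A ![Complex.I • v, Complex.I • w] = A ![v, w])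
    (hB : ∀ v w, B ![Complex.I • v, Complex.I • w] = B ![v, w])
    (h : ∀ v, A ![v, Complex.I • v] = B ![v, Complex.I • v]) : A = B := by
  have hsymm : ∀ C : Cn n [⋀^Fin 2]→L[ℝ] ℝ,
      (∀ v w, C ![Complex.I • v, Complex.I • w] = C ![v, w]) → ∀ v w,
        twoFormBilin C w (Complex.I • v) = twoFormBilin C v (Complex.I • w) := by
    intro C hC v w
    rw [twoFormBilin_apply, twoFormBilin_apply, ← hC w, smul_smul, Complex.I_mul_I, neg_one_smul,
      twoForm_swap, ← twoFormBilin_apply, ← twoFormBilin_apply]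
    simp
  have hadd : ∀ C : Cn n [⋀^Fin 2]→L[ℝ] ℝ,
      (∀ v w, C ![Complex.I • v, Complex.I • w] = C ![v, w]) → ∀ v w,
        C ![v + w, Complex.I • (v + w)] = C ![v, Complex.I • v] + C ![w, Complex.I • w] +
          2 * C ![v, Complex.I • w] := by
    intro C hC v w
    have := hsymm C hC v w
    simp only [← twoFormBilin_apply, smul_add, map_add, add_apply]
    rw [this]
    ring
  apply twoForm_ext
  intro v w
  have h1 := hadd A hA v (-(Complex.I • w))
  have h2 := hadd B hB v (-(Complex.I • w))
  rw [h, h, h, ← smul_neg, smul_smul, Complex.I_mul_I, neg_one_smul, neg_neg] at h1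
  rw [← smul_neg, smul_smul, Complex.I_mul_I, neg_one_smul, neg_neg] at h2
  linarith

theorem mfderiv_symm_eq {e : OpenPartialHomeomorph V (Cn n)} {x : V}
    (he : e ∈ IsManifold.maximalAtlas 𝓘(ℂ, Cn n) ω V) (hx : x ∈ e.source) :
    (mfderiv 𝓘(ℝ, Cn n) 𝓘(ℝ, Cn n) e.symm (e x) : Cn n →L[ℝ] Cn n) =
      (fderiv ℂ (chartAt (Cn n) x ∘ e.symm) (e x)).restrictScalars ℝ := by
  have hd : MDifferentiableAt 𝓘(ℝ, Cn n) 𝓘(ℝ, Cn n) e.symm (e x) :=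
    (contMDiffAt_symm_of_mem_maximalAtlas (maximalAtlas_complex_subset_real he)
      (e.map_source hx)).mdifferentiableAt (by simp)
  have h0 := IsManifold.chart_mem_maximalAtlas (I := 𝓘(ℂ, Cn n)) (n := ω) x
  have h1 := ((contDiffAt_transition he h0 hx (mem_chart_source _ x)).differentiableAt
    (by simp)).hasFDerivAt.restrictScalars ℝ
  rw [← h1.fderiv]
  refine hd.mfderiv.trans ?_
  simp only [writtenInExtChartAt, mfld_simps, fderivWithin_univ]
  rw [e.left_inv hx]
  rfl

/-- Every point has a neighbourhood on which `κ = dd^c ρ` for a smooth function `ρ`. -/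
theorem exists_local_potential {κ : TwoForm n V} (hκ : IsKahlerForm κ) (x : V) :
    ∃ (U : Set V) (ρ : V → ℝ), IsOpen U ∧ x ∈ U ∧ ContMDiffOn 𝓘(ℝ, Cn n) 𝓘(ℝ, ℝ) ∞ ρ U ∧
      ∀ y ∈ U, ddc ρ y = κ y := by
  set e := chartAt (Cn n) x with he
  have hec : e ∈ IsManifold.maximalAtlas 𝓘(ℂ, Cn n) ω V := IsManifold.chart_mem_maximalAtlas x
  have her := maximalAtlas_complex_subset_real hec
  have hea : e ∈ atlas (Cn n) V := chart_mem_atlas _ x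
  have h11 : ∀ z ∈ e.target, ∀ v w,
      κ.inChart e z ![Complex.I • v, Complex.I • w] = κ.inChart e z ![v, w] := by
    intro z hz v w
    have hz' := e.map_target hz
    have hS := mfderiv_symm_eq hec hz'
    rw [e.right_inv hz] at hS
    have hc : ∀ v : Cn n, mfderiv 𝓘(ℝ, Cn n) 𝓘(ℝ, Cn n) e.symm z (Complex.I • v) =
        complexStructure (e.symm z) (mfderiv 𝓘(ℝ, Cn n) 𝓘(ℝ, Cn n) e.symm z v) := by
      intro v
      rw [hS]
      exact map_smul (fderiv ℂ (chartAt (Cn n) (e.symm z) ∘ e.symm) z) Complex.I v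
    have := hκ.type_one_one (e.symm z) (mfderiv 𝓘(ℝ, Cn n) 𝓘(ℝ, Cn n) e.symm z v)
      (mfderiv 𝓘(ℝ, Cn n) 𝓘(ℝ, Cn n) e.symm z w)
    have hcomp : ∀ a b : Cn n, κ.inChart e z ![a, b] = κ (e.symm z)
        ![mfderiv 𝓘(ℝ, Cn n) 𝓘(ℝ, Cn n) e.symm z a,
          mfderiv 𝓘(ℝ, Cn n) 𝓘(ℝ, Cn n) e.symm z b] := by
      intro a b
      refine congrArg (κ (e.symm z)) ?_
      ext i
      fin_cases i <;> rfl
    rw [hcomp, hcomp, ← this]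
    refine congrArg (κ (e.symm z)) ?_
    ext i
    fin_cases i
    · exact hc v
    · exact hc w
  obtain ⟨h, hh, hev⟩ := exists_extDeriv_dcModel_eq e.open_target (hκ.smooth e hea)
    (hκ.closed e hea) h11 (mem_chart_target (Cn n) x)
  obtain ⟨U, hU, hUo, hxU⟩ := eventually_nhds_iff.1 (((e.continuousAt
    (mem_chart_source _ x)).eventually hev).and (e.open_source.mem_nhds (mem_chart_source _ x)))
  refine ⟨U, h ∘ e, hUo, hxU, fun y hy => (contMDiffAt_comp_chart her (hU y hy).2
    hh.contDiffAt).contMDiffWithinAt, fun y hy => ?_⟩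
  obtain ⟨hyeq, hys⟩ := hU y hy
  have hsm : ContMDiffAt 𝓘(ℝ, Cn n) 𝓘(ℝ, ℝ) ∞ (h ∘ e) y :=
    contMDiffAt_comp_chart her hys hh.contDiffAt
  have hsm' := (contDiffAt_chartAt hsm).of_le two_le_infty
  refine twoForm_ext_of_type_one_one (A := ddc (h ∘ e) y) (B := κ y)
    (fun v w => extDeriv_dcModel_smul_I hsm' v w) (fun v w => hκ.type_one_one y v w) fun v => ?_
  have h1 := extDeriv_dcModel_apply_self hsm' v
  have h2 := lev_eq_leviForm hec hys hsm v
  have h3 : (h ∘ e) ∘ e.symm =ᶠ[𝓝 (e y)] h := by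
    filter_upwards [e.open_target.mem_nhds (e.map_source hys)] with z hz
    simp [e.right_inv hz]
  rw [leviForm_congr h3, ← extDeriv_dcModel_apply_self (hh.contDiffAt.of_le two_le_infty),
    hyeq] at h2
  rw [lev] at h2
  rw [h2] at h1
  have h4 := mul_left_cancel₀ (by positivity) h1
  refine h4.trans ?_
  have hinv := fderiv_transition_comp (IsManifold.chart_mem_maximalAtlas (I := 𝓘(ℂ, Cn n)) (n := ω) y)
    hec (mem_chart_source _ y) hys
  have hS := mfderiv_symm_eq hec hys
  have hid : ∀ a : Cn n, (mfderiv 𝓘(ℝ, Cn n) 𝓘(ℝ, Cn n) e.symm (e y) : Cn n →L[ℝ] Cn n)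
      (tangentCoord e y a) = a := fun a => by rw [hS]; exact hinv a
  have hyy := e.left_inv hys
  have hgen : ∀ (y' : V), y' = y → ∀ a b : Cn n, κ y' ![a, b] = κ y ![a, b] := by
    rintro y' rfl a b; rfl
  refine Eq.trans ?_ (hgen _ hyy v (Complex.I • v))
  refine congrArg (κ (e.symm (e y))) ?_
  ext i
  fin_cases i
  · exact hid v
  · refine Eq.trans ?_ (hid (Complex.I • v))
    rw [map_smul]
    rfl

/-! ### Smooth plurisubharmonic functions -/

/-- A smooth function with nonnegative Levi form is plurisubharmonic. -/
theorem isPshOn_of_lev_nonneg {U : Set V} (hU : IsOpen U) (hne : U.Nonempty) {u : V → ℝ}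
    (hu : ContMDiffOn 𝓘(ℝ, Cn n) 𝓘(ℝ, ℝ) ∞ u U) (hpos : ∀ x ∈ U, ∀ v : Cn n, 0 ≤ lev u x v) :
    IsPshOn n U (fun x => (u x : EReal)) := by
  obtain ⟨x₀, hx₀⟩ := hne
  refine ⟨(continuous_coe_real_ereal.comp_continuousOn hu.continuousOn).upperSemicontinuousOn,
    by simp, ⟨x₀, hx₀, by simp⟩, ?_⟩
  intro D f hD hDb hf hfU g hg hfg
  have hfc : ContinuousOn f D := hf.continuousOn
  set D' := D ∩ f ⁻¹' U with hD'
  have hD'o : IsOpen D' := hfc.isOpen_inter_preimage hD hU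
  have hloc : ∀ z ∈ D', ContDiffAt ℝ ∞ (u ∘ f) z ∧ ∀ v, 0 ≤ leviForm (u ∘ f) z v := by
    intro z hz
    set e := chartAt (Cn n) (f z) with he
    have hs := mem_chart_source (Cn n) (f z)
    have hfz : ContMDiffAt 𝓘(ℂ, ℂ) 𝓘(ℂ, Cn n) ω f z := hf.contMDiffAt (hD.mem_nhds hz.1)
    have hF : ContDiffAt ℂ ω (e ∘ f) z := by
      rw [← contMDiffAt_iff_contDiffAt]
      exact ContMDiffAt.comp z
        (contMDiffAt_of_mem_maximalAtlas (IsManifold.chart_mem_maximalAtlas (f z)) hs) hfz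
    have huz : ContMDiffAt 𝓘(ℝ, Cn n) 𝓘(ℝ, ℝ) ∞ u (f z) := hu.contMDiffAt (hU.mem_nhds hz.2)
    have hh := contDiffAt_chartAt huz
    have heq : u ∘ f =ᶠ[𝓝 z] (u ∘ e.symm) ∘ (e ∘ f) := by
      filter_upwards [hfz.continuousAt.eventually (e.open_source.mem_nhds hs)] with y hy
      simp [e.left_inv hy]
    refine ⟨(ContDiffAt.comp z hh ((hF.restrict_scalars ℝ).of_le le_top)).congr_of_eventuallyEq heq,
      fun v => ?_⟩
    rw [leviForm_congr heq, leviForm_comp_holomorphic (hF.of_le le_top) (hh.of_le two_le_infty)]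
    exact hpos (f z) hz.2 _
  have hsub : Metric.closedBall 0 1 ⊆ D' := fun z hz => ⟨hDb hz, hfU hz⟩
  have hmain := le_circleAverage_of_leviForm_nonneg hD'o hsub
    (fun z hz => (hloc z hz).1.contDiffWithinAt) (fun z hz v => (hloc z (hsub hz)).2 v)
  have hsph : Metric.sphere (0 : ℂ) |1| ⊆ Metric.closedBall 0 1 := by
    rw [abs_one]; exact Metric.sphere_subset_closedBall
  refine EReal.coe_le_coe_iff.2 (hmain.trans (Real.circleAverage_mono ?_ ?_ ?_))
  · refine ContinuousOn.circleIntegrable' ?_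
    intro z hz
    exact (hloc z (hsub (hsph hz))).1.continuousAt.continuousWithinAt
  · exact hg.continuousOn.circleIntegrable'
  · intro z hz
    rw [abs_one] at hz
    exact EReal.coe_le_coe_iff.1 (hfg z hz)

/-- `v` is tangent at `x` to the complex submanifold `X`: it is mapped into the linear subspace `W` by
the differential of some chart in which `X` is `W`. -/
def IsTangent (X : Set V) (x : V) (v : Cn n) : Prop :=
  ∃ (e : OpenPartialHomeomorph V (Cn n)) (W : Submodule ℂ (Cn n)), IsSubmanifoldChart X e W ∧
    x ∈ e.source ∧ tangentCoord e x v ∈ W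

/-- If a smooth function agrees on `X` with a plurisubharmonic function, its Levi form is
nonnegative in the directions tangent to `X`. -/
theorem lev_nonneg_of_isPshOn {X U : Set V} (hU : IsOpen U) {u : V → EReal} (hu : IsPshOn n U u)
    {w : V → ℝ} (hw : ContMDiffOn 𝓘(ℝ, Cn n) 𝓘(ℝ, ℝ) ∞ w U) (heq : ∀ y ∈ X ∩ U, u y = (w y : EReal))
    {x : V} (hx : x ∈ X ∩ U) {v : Cn n} (hv : IsTangent X x v) : 0 ≤ lev w x v := by
  obtain ⟨e, W, ⟨he, hW⟩, hxe, hvW⟩ := hv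
  set a := tangentCoord e x v with ha
  have hwx : ContMDiffAt 𝓘(ℝ, Cn n) 𝓘(ℝ, ℝ) ∞ w x := hw.contMDiffAt (hU.mem_nhds hx.2)
  rw [lev_eq_leviForm he hxe hwx, ← ha]
  set L : ℂ → Cn n := fun ζ => e x + ζ • a with hL
  have hLd : ContDiff ℂ ω L := by fun_prop
  have hLc : Continuous L := hLd.continuous
  have hL0 : L 0 = e x := by simp [hL]
  set D : Set ℂ := L ⁻¹' (e.target ∩ e.symm ⁻¹' U) with hD
  have hDo : IsOpen D := (e.isOpen_inter_preimage_symm hU).preimage hLc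
  have h0D : (0 : ℂ) ∈ D := by
    simp only [hD, mem_preimage, hL0, mem_inter_iff, e.left_inv hxe]
    exact ⟨e.map_source hxe, hx.2⟩
  have hX : ∀ ζ ∈ D, e.symm (L ζ) ∈ X ∩ U := by
    intro ζ hζ
    refine ⟨(hW _ (e.map_target hζ.1)).2 ?_, hζ.2⟩
    rw [e.right_inv hζ.1]
    exact W.add_mem ((hW x hxe).1 hx.1) (W.smul_mem _ hvW)
  set h : ℂ → ℝ := fun ζ => w (e.symm (L ζ)) with hh
  have hhd : ContDiffOn ℝ ∞ h D := by
    intro ζ hζ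
    have h1 := contDiffAt_comp_symm (maximalAtlas_complex_subset_real he) (e.map_target hζ.1)
      (hw.contMDiffAt (hU.mem_nhds hζ.2))
    rw [e.right_inv hζ.1] at h1
    exact (ContDiffAt.comp ζ h1 ((hLd.contDiffAt.restrict_scalars ℝ).of_le le_top)).contDiffWithinAt
  have hLx : ContDiffAt ℝ 2 (w ∘ e.symm) (L 0) := by
    rw [hL0]
    exact (contDiffAt_comp_symm (maximalAtlas_complex_subset_real he) hxe hwx).of_le two_le_infty
  have hfin : leviForm h 0 1 = leviForm (w ∘ e.symm) (e x) a := by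
    have := leviForm_comp_holomorphic (h := w ∘ e.symm) (hLd.contDiffAt.of_le le_top) hLx 1
    rw [hL0] at this
    have hd : HasDerivAt L a 0 := by
      have := ((hasDerivAt_id (0 : ℂ)).smul_const a).const_add (e x)
      rwa [one_smul] at this
    rw [hd.hasFDerivAt.fderiv, ContinuousLinearMap.toSpanSingleton_apply, one_smul] at this
    exact this
  rw [← hfin]
  -- for small `t`, the disc `ζ ↦ e⁻¹(e x + t ζ a)` lies in `X ∩ U`
  refine leviForm_nonneg_of_le_circleAverage (hDo.mem_nhds h0D) hhd ?_
  obtain ⟨r, hr, hball⟩ := Metric.mem_nhds_iff.1 (hDo.mem_nhds h0D)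
  filter_upwards [Ioo_mem_nhdsGT hr] with t ht
  have hS : ∀ ζ : ℂ, ‖ζ‖ ≤ 1 → (t : ℂ) * ζ ∈ D := by
    intro ζ hζ
    apply hball
    rw [mem_ball_zero_iff, norm_mul, Complex.norm_real, Real.norm_eq_abs, abs_of_pos ht.1]
    nlinarith [ht.1, ht.2, norm_nonneg ζ]
  set M : ℂ → ℂ := fun ζ => (t : ℂ) * ζ with hM
  have hMc : Continuous M := by fun_prop
  obtain ⟨g, U', hg, -, hU', -, hgeq⟩ := exists_contDiff_eq_near_compact (isCompact_sphere (0 : ℂ) 1)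
    (hDo.preimage hMc) (fun ζ hζ => hS ζ (by simpa using (mem_sphere_zero_iff_norm.1 hζ).le))
    (hhd.comp (by fun_prop : ContDiff ℝ ∞ M).contDiffOn fun ζ hζ => hζ)
  have hpsh := hu.2.2.2 (M ⁻¹' D) (fun ζ => e.symm (L (M ζ))) (hDo.preimage hMc)
    (fun ζ hζ => hS ζ (by simpa using hζ)) ?_ (fun ζ hζ => (hX _ (hS ζ (by simpa using hζ))).2) g
    hg.continuous ?_
  · have hM0 : M 0 = 0 := by simp [hM]
    simp only [hM0] at hpsh
    rw [heq _ (hX 0 h0D), EReal.coe_le_coe_iff] at hpsh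
    refine hpsh.trans_eq ?_
    rw [Real.circleAverage_congr_sphere (f₂ := fun ζ => h (M ζ))]
    · simp only [Real.circleAverage, circleMap, hM]
      simp
    · intro ζ hζ
      rw [abs_one] at hζ
      exact hgeq (hU' hζ)
  · intro ζ hζ
    have h1 : ContMDiffAt 𝓘(ℂ, Cn n) 𝓘(ℂ, Cn n) ω e.symm (L (M ζ)) :=
      contMDiffAt_symm_of_mem_maximalAtlas he hζ.1
    have h2 : ContDiffAt ℂ ω (fun ζ => L (M ζ)) ζ := by
      have : ContDiff ℂ ω M := by fun_prop
      exact (hLd.comp this).contDiffAt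
    exact (ContMDiffAt.comp (f := fun ζ => L (M ζ)) ζ h1 h2.contMDiffAt).contMDiffWithinAt
  · intro ζ hζ
    rw [hgeq (hU' hζ), heq _ (hX _ (hS ζ (by simpa using (mem_sphere_zero_iff_norm.1 hζ).le)))]
    exact le_rfl

end Kahler

/-! ### Positivity is open, and bounds on compact sets -/

section Homogeneous

variable {n : ℕ}

theorem pos_of_pos_on_sphere {f : Cn n → ℝ} (hf : ∀ (c : ℂ) v, f (c • v) = ‖c‖ ^ 2 * f v)
    (h : ∀ v ∈ Metric.sphere (0 : Cn n) 1, 0 < f v) {v : Cn n} (hv : v ≠ 0) : 0 < f v := by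
  have hn : 0 < ‖v‖ := norm_pos_iff.2 hv
  have h1 := h (((‖v‖⁻¹ : ℝ) : ℂ) • v) (by
    rw [mem_sphere_zero_iff_norm, norm_smul, Complex.norm_real, norm_inv, norm_norm,
      inv_mul_cancel₀ hn.ne'])
  rw [hf] at h1
  exact pos_of_mul_pos_right h1 (by positivity)

theorem exists_add_mul_pos {f g : Cn n → ℝ} (hf : ∀ (c : ℂ) v, f (c • v) = ‖c‖ ^ 2 * f v)
    (hg : ∀ (c : ℂ) v, g (c • v) = ‖c‖ ^ 2 * g v) (hfc : Continuous f) (hgc : Continuous g)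
    (hg0 : ∀ v, 0 ≤ g v) (h : ∀ v, v ≠ 0 → g v = 0 → 0 < f v) :
    ∃ A : ℝ, 0 ≤ A ∧ ∀ v, v ≠ 0 → 0 < f v + A * g v := by
  have hcov : Metric.sphere (0 : Cn n) 1 ⊆ ⋃ k : ℕ, {v | 0 < f v + k * g v} := by
    intro v hv
    rw [mem_iUnion]
    have hv0 : v ≠ 0 := by
      rintro rfl
      simp at hv
    rcases (hg0 v).eq_or_lt with h0 | h0
    · exact ⟨0, by simpa using h v hv0 h0.symm⟩
    · obtain ⟨k, hk⟩ := exists_nat_gt (-f v / g v)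
      refine ⟨k, ?_⟩
      rw [div_lt_iff₀ h0] at hk
      rw [mem_ofPred_eq]
      linarith
  have hdir : Directed (· ⊆ ·) fun k : ℕ => {v | 0 < f v + k * g v} := by
    refine directed_of_isDirected_le ?_
    intro i j hij v hv
    rw [mem_ofPred_eq] at hv ⊢
    have : (i : ℝ) * g v ≤ j * g v := by
      gcongr
      exact hg0 v
    linarith
  obtain ⟨k, hk⟩ := (isCompact_sphere (0 : Cn n) 1).elim_directed_cover _
    (fun k => isOpen_lt continuous_const (by fun_prop)) hcov hdir
  exact ⟨k, by positivity, fun v hv => pos_of_pos_on_sphere (f := fun v => f v + k * g v)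
    (fun c v => by rw [hf, hg]; ring) (fun v hv => hk hv) hv⟩

theorem continuous_leviForm (u : Cn n → ℝ) (z : Cn n) : Continuous (leviForm u z) := by
  unfold leviForm
  fun_prop

theorem continuousAt_leviForm {u : Cn n → ℝ} {z : Cn n}
    (hu : ContinuousAt (fderiv ℝ (fderiv ℝ u)) z) (v : Cn n) :
    ContinuousAt (fun p : Cn n × Cn n => leviForm u p.1 p.2) (z, v) := by
  have h1 : ContinuousAt (fun p : Cn n × Cn n => fderiv ℝ (fderiv ℝ u) p.1) (z, v) :=
    ContinuousAt.comp (x := (z, v)) hu continuousAt_fst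
  have h2 : ContinuousAt (fun p : Cn n × Cn n => p.2) (z, v) := continuousAt_snd
  have h3 : ContinuousAt (fun p : Cn n × Cn n => Complex.I • p.2) (z, v) := h2.const_smul Complex.I
  unfold leviForm
  exact ((h1.clm_apply h2).clm_apply h2).add ((h1.clm_apply h3).clm_apply h3)

end Homogeneous

section Bounds

variable {n : ℕ} {V : Type*} [TopologicalSpace V] [ChartedSpace (Cn n) V]
  [IsManifold 𝓘(ℂ, Cn n) ω V]

theorem eventually_lev_pos {u : V → ℝ} {x : V}
    (hu : ∀ᶠ y in 𝓝 x, ContMDiffAt 𝓘(ℝ, Cn n) 𝓘(ℝ, ℝ) ∞ u y)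
    (h : ∀ v : Cn n, v ≠ 0 → 0 < lev u x v) :
    ∀ᶠ y in 𝓝 x, ∀ v : Cn n, v ≠ 0 → 0 < lev u y v := by
  set e := chartAt (Cn n) x with he
  have hec : e ∈ IsManifold.maximalAtlas 𝓘(ℂ, Cn n) ω V := IsManifold.chart_mem_maximalAtlas x
  have hxs : x ∈ e.source := mem_chart_source _ x
  have hd := contDiffAt_chartAt hu.self_of_nhds
  have hd1 : ContDiffAt ℝ ∞ (fderiv ℝ (u ∘ e.symm)) (e x) := hd.fderiv_right (by simp)
  have hc2 : ContinuousAt (fderiv ℝ (fderiv ℝ (u ∘ e.symm))) (e x) :=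
    (hd1.fderiv_right (m := ∞) (by simp)).continuousAt
  have hcomp : ∀ᶠ z in 𝓝 (e x), ∀ v ∈ Metric.sphere (0 : Cn n) 1, 0 < leviForm (u ∘ e.symm) z v := by
    refine (isCompact_sphere (0 : Cn n) 1).eventually_forall_of_forall_eventually ?_
    intro v hv
    have hv0 : v ≠ 0 := by
      rintro rfl
      simp at hv
    have hcont := continuousAt_leviForm hc2 v
    exact hcont.eventually (lt_mem_nhds (h v hv0))
  filter_upwards [(e.continuousAt hxs).eventually hcomp, hu, e.open_source.mem_nhds hxs]
    with y h1 h2 h3 v hv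
  rw [lev_eq_leviForm hec h3 h2]
  exact pos_of_pos_on_sphere (fun c v => leviForm_smul _ _ v c) h1 (tangentCoord_ne_zero hec h3 hv)

variable {κ : TwoForm n V}

theorem hermForm_smul (hκ : IsKahlerForm κ) (x : V) (c : ℂ) (v : Cn n) :
    hermForm κ x (c • v : Cn n) = ‖c‖ ^ 2 * hermForm κ x v := by
  obtain ⟨U, ρ, hU, hx, hρ, hd⟩ := exists_local_potential hκ x
  rw [← lev_eq_hermForm (hρ.contMDiffAt (hU.mem_nhds hx)) (hd x hx),
    ← lev_eq_hermForm (hρ.contMDiffAt (hU.mem_nhds hx)) (hd x hx), lev_smul]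

theorem continuous_hermForm (hκ : IsKahlerForm κ) (x : V) :
    Continuous fun v : Cn n => hermForm κ x v := by
  obtain ⟨U, ρ, hU, hx, hρ, hd⟩ := exists_local_potential hκ x
  have : (fun v : Cn n => hermForm κ x v) = lev ρ x := by
    ext v
    exact (lev_eq_hermForm (hρ.contMDiffAt (hU.mem_nhds hx)) (hd x hx) v).symm
  rw [this]
  exact continuous_leviForm _ _

theorem hermForm_pos (hκ : IsKahlerForm κ) (x : V) {v : Cn n} (hv : v ≠ 0) :
    0 < hermForm κ x v :=
  mul_pos (by positivity) (hκ.pos x v hv)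

theorem hermForm_nonneg (hκ : IsKahlerForm κ) (x : V) (v : Cn n) : 0 ≤ hermForm κ x v := by
  rcases eq_or_ne v 0 with rfl | hv
  · have := hermForm_smul hκ x 0 (0 : Cn n)
    rw [zero_smul] at this
    rw [this]
    simp
  · exact (hermForm_pos hκ x hv).le

theorem eventually_lev_add_hermForm_pos (hκ : IsKahlerForm κ) {u : V → ℝ} {x : V}
    (hu : ContMDiff 𝓘(ℝ, Cn n) 𝓘(ℝ, ℝ) ∞ u) (c : ℝ)
    (h : ∀ v : Cn n, v ≠ 0 → 0 < lev u x v + c * hermForm κ x v) :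
    ∀ᶠ y in 𝓝 x, ∀ v : Cn n, v ≠ 0 → 0 < lev u y v + c * hermForm κ y v := by
  obtain ⟨U, ρ, hU, hx, hρ, hd⟩ := exists_local_potential hκ x
  have hs : ∀ y ∈ U, ContMDiffAt 𝓘(ℝ, Cn n) 𝓘(ℝ, ℝ) ∞ (fun y => c * ρ y) y := fun y hy =>
    contMDiffAt_const.mul (hρ.contMDiffAt (hU.mem_nhds hy))
  have hkey : ∀ y ∈ U, ∀ v : Cn n, lev (fun y => u y + c * ρ y) y v =
      lev u y v + c * hermForm κ y v := by
    intro y hy v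
    rw [lev_add (hu y) (hs y hy), lev_const_mul,
      lev_eq_hermForm (hρ.contMDiffAt (hU.mem_nhds hy)) (hd y hy)]
  have hUx := hU.mem_nhds hx
  have h1 := eventually_lev_pos (u := fun y => u y + c * ρ y) (x := x)
    (by filter_upwards [hUx] with y hy using (hu y).add (hs y hy))
    (fun v hv => by rw [hkey x hx]; exact h v hv)
  filter_upwards [h1, hUx] with y hy1 hy2 v hv
  rw [← hkey y hy2]
  exact hy1 v hv

/-- If `u` is strictly plurisubharmonic relatively to `cκ` in the directions in which the
semipositive Levi form of `w` degenerates, then so is `u + A w` in all directions, for `A` large. -/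
theorem exists_const_lev_pos (hκ : IsKahlerForm κ) {K : Set V} (hK : IsCompact K) {u w : V → ℝ}
    (hu : ContMDiff 𝓘(ℝ, Cn n) 𝓘(ℝ, ℝ) ∞ u) (hw : ContMDiff 𝓘(ℝ, Cn n) 𝓘(ℝ, ℝ) ∞ w) (c : ℝ)
    (hw0 : ∀ x ∈ K, ∀ v : Cn n, 0 ≤ lev w x v)
    (h : ∀ x ∈ K, ∀ v : Cn n, v ≠ 0 → lev w x v = 0 → 0 < lev u x v + c * hermForm κ x v) :
    ∃ A : ℝ, 0 ≤ A ∧ ∀ x ∈ K, ∀ v : Cn n, v ≠ 0 →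
      0 < lev u x v + A * lev w x v + c * hermForm κ x v := by
  suffices hs : ∃ A : ℝ, 0 ≤ A ∧ ∀ x ∈ K, x ∈ K → ∀ v : Cn n, v ≠ 0 →
      0 < lev u x v + A * lev w x v + c * hermForm κ x v by
    obtain ⟨A, hA, hs⟩ := hs
    exact ⟨A, hA, fun x hx => hs x hx hx⟩
  refine hK.induction_on (p := fun S => ∃ A : ℝ, 0 ≤ A ∧ ∀ x ∈ S, x ∈ K → ∀ v : Cn n, v ≠ 0 →
      0 < lev u x v + A * lev w x v + c * hermForm κ x v) ⟨0, le_rfl, by simp⟩ ?_ ?_ ?_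
  · rintro s t hst ⟨A, hA, ht⟩
    exact ⟨A, hA, fun x hx => ht x (hst hx)⟩
  · rintro s t ⟨A, hA, hs⟩ ⟨B, hB, ht⟩
    refine ⟨max A B, le_max_of_le_left hA, fun x hx hxK v hv => ?_⟩
    have h1 := mul_le_mul_of_nonneg_right (le_max_left A B) (hw0 x hxK v)
    have h2 := mul_le_mul_of_nonneg_right (le_max_right A B) (hw0 x hxK v)
    rcases hx with hx | hx
    · linarith [hs x hx hxK v hv]
    · linarith [ht x hx hxK v hv]
  · intro x hx
    obtain ⟨A, hA, hpos⟩ := exists_add_mul_pos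
      (f := fun v : Cn n => lev u x v + c * hermForm κ x v) (g := lev w x)
      (fun a v => by rw [lev_smul, hermForm_smul hκ]; ring) (fun a v => lev_smul w v a)
      ((continuous_leviForm _ _).add (continuous_const.mul (continuous_hermForm hκ x)))
      (continuous_leviForm _ _) (hw0 x hx) (h x hx)
    have hsm : ContMDiff 𝓘(ℝ, Cn n) 𝓘(ℝ, ℝ) ∞ (fun y => A * w y) := contMDiff_const.mul hw
    have hsum : ∀ y (v : Cn n), lev (fun y => u y + A * w y) y v = lev u y v + A * lev w y v := by
      intro y v
      rw [lev_add (hu y) (hsm y), lev_const_mul]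
    have hev := eventually_lev_add_hermForm_pos hκ (hu.add hsm) c (x := x) (fun v hv => by
      have h1 := hpos v hv
      have h2 := hsum x v
      simp only [Pi.add_def]
      rw [h2]
      linarith)
    simp only [Pi.add_def] at hev
    refine ⟨_, mem_nhdsWithin_of_mem_nhds hev, A, hA, fun y hy _ v hv => ?_⟩
    have := hy v hv
    rwa [hsum] at this

theorem exists_abs_lev_le [CompactSpace V] (hκ : IsKahlerForm κ) {u : V → ℝ}
    (hu : ContMDiff 𝓘(ℝ, Cn n) 𝓘(ℝ, ℝ) ∞ u) :
    ∃ C : ℝ, 0 ≤ C ∧ ∀ x (v : Cn n), |lev u x v| ≤ C * hermForm κ x v := by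
  have key : ∀ u : V → ℝ, ContMDiff 𝓘(ℝ, Cn n) 𝓘(ℝ, ℝ) ∞ u →
      ∃ C : ℝ, 0 ≤ C ∧ ∀ x ∈ univ, ∀ v : Cn n, v ≠ 0 → 0 < lev u x v + C * hermForm κ x v := by
    intro u hu
    refine isCompact_univ.induction_on (p := fun S => ∃ C : ℝ, 0 ≤ C ∧ ∀ x ∈ S, ∀ v : Cn n, v ≠ 0 →
      0 < lev u x v + C * hermForm κ x v) ⟨0, le_rfl, by simp⟩ ?_ ?_ ?_
    · rintro s t hst ⟨A, hA, ht⟩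
      exact ⟨A, hA, fun x hx => ht x (hst hx)⟩
    · rintro s t ⟨A, hA, hs⟩ ⟨B, hB, ht⟩
      refine ⟨max A B, le_max_of_le_left hA, fun x hx v hv => ?_⟩
      have h1 := mul_le_mul_of_nonneg_right (le_max_left A B) (hermForm_nonneg hκ x v)
      have h2 := mul_le_mul_of_nonneg_right (le_max_right A B) (hermForm_nonneg hκ x v)
      rcases hx with hx | hx
      · linarith [hs x hx v hv]
      · linarith [ht x hx v hv]
    · intro x _
      obtain ⟨A, hA, hpos⟩ := exists_add_mul_pos (f := fun v : Cn n => lev u x v)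
        (g := fun v : Cn n => hermForm κ x v)
        (fun a v => lev_smul u v a) (fun a v => hermForm_smul hκ x a v)
        (continuous_leviForm _ _) (continuous_hermForm hκ x) (hermForm_nonneg hκ x)
        (fun v hv h0 => absurd h0 (hermForm_pos hκ x hv).ne')
      exact ⟨_, mem_nhdsWithin_of_mem_nhds (eventually_lev_add_hermForm_pos hκ hu A hpos), A, hA,
        fun y hy => hy⟩
  obtain ⟨A, hA, h1⟩ := key u hu
  obtain ⟨B, hB, h2⟩ := key (fun y => (-1) * u y) (contMDiff_const.mul hu)
  refine ⟨max A B, le_max_of_le_left hA, fun x v => ?_⟩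
  rcases eq_or_ne v 0 with rfl | hv
  · rw [lev_zero_right, abs_zero]
    exact mul_nonneg (le_max_of_le_left hA) (hermForm_nonneg hκ x 0)
  have h3 := mul_le_mul_of_nonneg_right (le_max_left A B) (hermForm_nonneg hκ x v)
  have h4 := mul_le_mul_of_nonneg_right (le_max_right A B) (hermForm_nonneg hκ x v)
  have h5 := h1 x (mem_univ x) v hv
  have h6 := h2 x (mem_univ x) v hv
  rw [lev_const_mul] at h6
  rw [abs_le]
  constructor <;> linarith

end Bounds

/-! ### Local defining functions of a submanifold -/

section Model

variable {n : ℕ}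

set_option maxSynthPendingDepth 3 in
/-- A nonnegative smooth function which vanishes on a linear subspace is locally bounded by a
multiple of the squared distance to this subspace. -/
theorem eventually_le_norm_starProjection_sq {W : Submodule ℂ (Cn n)} {h : Cn n → ℝ} {z : Cn n}
    (hz : z ∈ W) (hh : ContDiffAt ℝ 2 h z) (hnn : ∀ᶠ y in 𝓝 z, 0 ≤ h y)
    (hW : ∀ᶠ y in 𝓝 z, y ∈ W → h y = 0) :
    ∃ C : ℝ, ∀ᶠ y in 𝓝 z, h y ≤ C * ‖Wᗮ.starProjection y‖ ^ 2 := by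
  set M := ‖fderiv ℝ (fderiv ℝ h) z‖ + 1 with hM
  have hc2 : ContinuousAt (fderiv ℝ (fderiv ℝ h)) z :=
    ((hh.fderiv_right (m := 1) (by norm_num)).fderiv_right (m := 0) (by norm_num)).continuousAt
  have hn : ContinuousAt (fun y => ‖fderiv ℝ (fderiv ℝ h) y‖) z := hc2.norm
  have hbd : ∀ᶠ y in 𝓝 z, ‖fderiv ℝ (fderiv ℝ h) y‖ ≤ M :=
    (hn.eventually (gt_mem_nhds (lt_add_one _))).mono fun _ hy => le_of_lt hy
  have hcd : ∀ᶠ y in 𝓝 z, ContDiffAt ℝ 2 h y := hh.eventually (by simp)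
  obtain ⟨r, hr, hball⟩ := Metric.eventually_nhds_iff_ball.1
    (hbd.and (hcd.and ((eventually_eventually_nhds.2 hnn).and hW)))
  refine ⟨M, ?_⟩
  filter_upwards [Metric.ball_mem_nhds z hr] with y hy
  set p := W.starProjection y with hp
  have hsum : p + Wᗮ.starProjection y = y := W.starProjection_add_starProjection_orthogonal y
  have hyp : y - p = Wᗮ.starProjection y := sub_eq_of_eq_add' hsum.symm
  have hpz : p ∈ Metric.ball z r := by
    have hpz' : p - z = W.starProjection (y - z) := by
      rw [map_sub, Submodule.starProjection_eq_self_iff.2 hz]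
    rw [mem_ball_iff_norm] at hy ⊢
    rw [hpz']
    exact (W.norm_starProjection_apply_le _).trans_lt hy
  have hpW : p ∈ W := W.starProjection_apply_mem y
  have hp0 : h p = 0 := (hball p hpz).2.2.2 hpW
  have hdp : fderiv ℝ h p = 0 := fderiv_eq_zero_of_nonneg (hball p hpz).2.2.1 hp0
  have hconv := convex_ball z r
  have hseg : segment ℝ p y ⊆ Metric.ball z r := hconv.segment_subset hpz hy
  have hd1 : ∀ w ∈ segment ℝ p y, ‖fderiv ℝ h w‖ ≤ M * ‖y - p‖ := by
    intro w hw
    have h1 := hconv.norm_image_sub_le_of_norm_fderiv_le (𝕜 := ℝ) (f := fderiv ℝ h) (C := M)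
      (fun x hx => (hasFDerivAt_fderiv (hball x hx).2.1).differentiableAt)
      (fun x hx => (hball x hx).1) hpz (hseg hw)
    rw [hdp, sub_zero] at h1
    refine h1.trans ?_
    gcongr
    obtain ⟨a, b, ha, hb, hab, rfl⟩ := hw
    have : a • p + b • y - p = b • (y - p) := by
      rw [← eq_sub_iff_add_eq] at hab
      rw [hab]
      module
    rw [this, norm_smul, Real.norm_of_nonneg hb]
    exact mul_le_of_le_one_left (norm_nonneg _) (by linarith)
  have h2 := (convex_segment p y).norm_image_sub_le_of_norm_fderiv_le (𝕜 := ℝ) (f := h)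
    (fun x hx => (hball x (hseg hx)).2.1.differentiableAt (by norm_num)) hd1
    (left_mem_segment ℝ p y) (right_mem_segment ℝ p y)
  rw [hp0, sub_zero, hyp, mul_assoc, ← sq] at h2
  exact (le_abs_self _).trans h2

theorem hasFDerivAt_norm_sq_clm (P : Cn n →L[ℂ] Cn n) (z : Cn n) :
    HasFDerivAt (fun y => ‖P y‖ ^ 2)
      (2 • (innerSL ℝ (P z)).comp (P.restrictScalars ℝ)) z :=
  ((P.restrictScalars ℝ).hasFDerivAt (x := z)).norm_sq

theorem leviForm_norm_sq_clm (P : Cn n →L[ℂ] Cn n) (z v : Cn n) :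
    leviForm (fun y => ‖P y‖ ^ 2) z v = 4 * ‖P v‖ ^ 2 := by
  have h1 : fderiv ℝ (fun y => ‖P y‖ ^ 2) =
      fun y => 2 • (innerSL ℝ (P y)).comp (P.restrictScalars ℝ) := by
    ext1 y
    exact (hasFDerivAt_norm_sq_clm P y).fderiv
  have h2 : ∀ a b : Cn n, fderiv ℝ (fderiv ℝ fun y => ‖P y‖ ^ 2) z a b =
      2 * inner ℝ (P a) (P b) := by
    intro a b
    have h3 : HasFDerivAt (fun y => innerSL ℝ (P y))
        ((innerSL ℝ).comp (P.restrictScalars ℝ)) z :=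
      (innerSL ℝ).hasFDerivAt.comp z ((P.restrictScalars ℝ).hasFDerivAt (x := z))
    have h4 := (h3.clm_comp (hasFDerivAt_const (P.restrictScalars ℝ) z)).const_smul (2 : ℕ)
    rw [h1]
    have h5 := h4.fderiv
    simp only [Pi.smul_def] at h5
    rw [h5]
    simp
  rw [leviForm, h2, h2, real_inner_self_eq_norm_sq, real_inner_self_eq_norm_sq, map_smul, norm_smul,
    Complex.norm_I]
  ring

/-- `log ‖P z‖²` is plurisubharmonic. -/
theorem gradSq_norm_sq_clm_le (P : Cn n →L[ℂ] Cn n) (z v : Cn n) :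
    gradSq (fun y => ‖P y‖ ^ 2) z v ≤
      ‖P z‖ ^ 2 * leviForm (fun y => ‖P y‖ ^ 2) z v := by
  rw [leviForm_norm_sq_clm, gradSq, (hasFDerivAt_norm_sq_clm P z).fderiv]
  have hre : ∀ a b : Cn n, inner ℝ a b = (inner ℂ a b).re := fun a b => by
    simp [PiLp.inner_apply, Complex.inner]
  have h1 := hre (P z) (P v)
  have h2 : inner ℝ (P z) (Complex.I • P v) = -(inner ℂ (P z) (P v)).im := by
    rw [hre, inner_smul_right]
    simp
  have h3 := norm_inner_le_norm (𝕜 := ℂ) (P z) (P v)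
  have h4 := Complex.sq_norm (inner ℂ (P z) (P v))
  rw [Complex.normSq_apply] at h4
  have h5 : ‖inner ℂ (P z) (P v)‖ ^ 2 ≤ (‖P z‖ * ‖P v‖) ^ 2 := by gcongr
  simp [h1, h2]
  nlinarith

end Model

section LocalDefining

variable {n : ℕ} {V : Type*} [TopologicalSpace V] [ChartedSpace (Cn n) V]
  [IsManifold 𝓘(ℂ, Cn n) ω V]

/-- `q` is a defining function of `X ∩ U` in the open set `U`, comparable to the squared distance
to `X` and with `log q` plurisubharmonic. -/
structure IsLocalDefining (X U : Set V) (q : V → ℝ) : Prop where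
  isOpen : IsOpen U
  smooth : ∀ y ∈ U, ContMDiffAt 𝓘(ℝ, Cn n) 𝓘(ℝ, ℝ) ∞ q y
  nonneg : ∀ y ∈ U, 0 ≤ q y
  eq_zero_iff : ∀ y ∈ U, q y = 0 ↔ y ∈ X
  /-- `log q` is plurisubharmonic. -/
  grad_le : ∀ y ∈ U, ∀ v : Cn n, grad q y v ≤ q y * lev q y v
  isTangent : ∀ y ∈ X ∩ U, ∀ v : Cn n, lev q y v = 0 → IsTangent X y v
  /-- `q` dominates locally all the smooth nonnegative functions which vanish on `X`. -/
  eventually_le : ∀ y ∈ X ∩ U, ∀ p : V → ℝ, ContMDiffAt 𝓘(ℝ, Cn n) 𝓘(ℝ, ℝ) ∞ p y →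
    (∀ᶠ y' in 𝓝 y, 0 ≤ p y') → (∀ᶠ y' in 𝓝 y, y' ∈ X → p y' = 0) →
    ∃ C : ℝ, ∀ᶠ y' in 𝓝 y, p y' ≤ C * q y'

theorem isLocalDefining_of_chart {X : Set V} {e : OpenPartialHomeomorph V (Cn n)}
    {W : Submodule ℂ (Cn n)} (he : IsSubmanifoldChart X e W) :
    IsLocalDefining (n := n) X e.source fun y => ‖Wᗮ.starProjection (e y)‖ ^ 2 := by
  obtain ⟨hec, hW⟩ := he
  have her := maximalAtlas_complex_subset_real hec
  have hsm : ∀ y ∈ e.source, ContMDiffAt 𝓘(ℝ, Cn n) 𝓘(ℝ, ℝ) ∞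
      (fun y => ‖Wᗮ.starProjection (e y)‖ ^ 2) y := fun y hy =>
    contMDiffAt_comp_chart her hy (h := fun z => ‖Wᗮ.starProjection z‖ ^ 2)
      ((contDiff_norm_sq ℝ).comp
        (Wᗮ.starProjection.restrictScalars ℝ).contDiff).contDiffAt
  have hzero : ∀ z, ‖Wᗮ.starProjection z‖ ^ 2 = 0 ↔ z ∈ W := by
    intro z
    rw [sq_eq_zero_iff, norm_eq_zero, Submodule.starProjection_apply_eq_zero_iff,
      Submodule.orthogonal_orthogonal]
  have heq : ∀ y ∈ e.source, (fun y => ‖Wᗮ.starProjection (e y)‖ ^ 2) ∘ e.symm =ᶠ[𝓝 (e y)]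
      fun z => ‖Wᗮ.starProjection z‖ ^ 2 := by
    intro y hy
    filter_upwards [e.open_target.mem_nhds (e.map_source hy)] with z hz
    simp [e.right_inv hz]
  have hlev : ∀ y ∈ e.source, ∀ v : Cn n, lev (fun y => ‖Wᗮ.starProjection (e y)‖ ^ 2) y v =
      4 * ‖Wᗮ.starProjection (tangentCoord e y v)‖ ^ 2 := by
    intro y hy v
    rw [lev_eq_leviForm hec hy (hsm y hy), leviForm_congr (heq y hy), leviForm_norm_sq_clm]
  refine ⟨e.open_source, hsm, fun y _ => by positivity, fun y hy => (hzero _).trans (hW y hy).symm,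
    fun y hy v => ?_, fun y hy v hv => ?_, fun y hy p hp hp0 hpX => ?_⟩
  · rw [hlev y hy, grad_eq_gradSq hec hy (hsm y hy), gradSq_congr (heq y hy)]
    refine (gradSq_norm_sq_clm_le _ _ _).trans_eq ?_
    rw [leviForm_norm_sq_clm]
  · refine ⟨e, W, ⟨hec, hW⟩, hy.2, (hzero _).1 ?_⟩
    rw [hlev y hy.2] at hv
    linarith
  · obtain ⟨C, hC⟩ := eventually_le_norm_starProjection_sq (W := W) (h := p ∘ e.symm) (z := e y)
      ((hW y hy.2).1 hy.1) ((contDiffAt_comp_symm her hy.2 hp).of_le two_le_infty)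
      (eventually_comp_symm (p := fun y => 0 ≤ p y) hy.2 hp0) (by
        filter_upwards [eventually_comp_symm hy.2 hpX, e.open_target.mem_nhds (e.map_source hy.2)]
          with z h1 h2 h3
        exact h1 ((hW _ (e.map_target h2)).2 (by rwa [e.right_inv h2])))
    refine ⟨C, ?_⟩
    filter_upwards [(e.continuousAt hy.2).eventually hC, e.open_source.mem_nhds hy.2] with y' h1 h2
    simpa [e.left_inv h2] using h1

theorem isLocalDefining_compl {X : Set V} (hX : IsClosed X) :
    IsLocalDefining (n := n) X Xᶜ fun _ => 1 where
  isOpen := hX.isOpen_compl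
  smooth _ _ := contMDiffAt_const
  nonneg _ _ := zero_le_one
  eq_zero_iff y hy := by simpa using hy
  grad_le y _ v := by simp [grad, lev, gradSq, leviForm, Function.comp_def]
  isTangent y hy := absurd hy.1 hy.2
  eventually_le y hy := absurd hy.1 hy.2

theorem exists_isLocalDefining {X : Set V} (hX : IsComplexSubmanifold n X) (x : V) :
    ∃ (U : Set V) (q : V → ℝ), x ∈ U ∧ IsLocalDefining (n := n) X U q := by
  by_cases hx : x ∈ X
  · obtain ⟨e, W, hxe, he⟩ := hX.2 x hx
    exact ⟨_, _, hxe, isLocalDefining_of_chart he⟩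
  · exact ⟨_, _, hx, isLocalDefining_compl hX.1⟩

end LocalDefining

/-! ### A global defining function -/

section CutOff

variable {E : Type*} [NormedAddCommGroup E] [NormedSpace ℂ E] [NormedSpace ℝ E]

/-- Cutting off a function `b` with `log b` plurisubharmonic: up to a multiple of `b`, the Levi form
of `a² b` dominates `|∂(a² b)|² / (a² b)`. Dividing by `a² b` is avoided, so that zeros of `a` are
harmless. -/
theorem exists_sq_fderiv_eq_of_sq_mul {a b : E → ℝ} {z : E} (ha : ContDiffAt ℝ 2 a z)
    (hb : ContDiffAt ℝ 2 b z) (hb0 : 0 < b z) {v : E} (hlog : gradSq b z v ≤ b z * leviForm b z v) :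
    ∃ r s : ℝ, 0 ≤ r ∧ 0 ≤ s ∧
      fderiv ℝ (fun y => a y * a y * b y) z v ^ 2 = a z * a z * b z * r ∧
      fderiv ℝ (fun y => a y * a y * b y) z (Complex.I • v) ^ 2 = a z * a z * b z * s ∧
      r + s ≤ leviForm (fun y => a y * a y * b y) z v +
        b z * (leviForm (fun y => a y * a y) z v - 4 * a z * leviForm a z v) := by
  have haa : ContDiffAt ℝ 2 (fun y => a y * a y) z := ha.mul ha
  have hd1 : fderiv ℝ (fun y => a y * a y) z = a z • fderiv ℝ a z + a z • fderiv ℝ a z :=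
    fderiv_fun_mul (ha.differentiableAt (by norm_num)) (ha.differentiableAt (by norm_num))
  have hd2 : fderiv ℝ (fun y => a y * a y * b y) z =
      (a z * a z) • fderiv ℝ b z + b z • fderiv ℝ (fun y => a y * a y) z :=
    fderiv_fun_mul (haa.differentiableAt (by norm_num)) (hb.differentiableAt (by norm_num))
  have hl1 := leviForm_mul ha ha v
  have hl2 := leviForm_mul haa hb v
  rw [hd1] at hl2 hd2
  rw [hd2]
  rw [gradSq] at hlog
  simp only [add_apply, smul_apply, smul_eq_mul] at hl2 ⊢
  set p := fderiv ℝ a z v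
  set p' := fderiv ℝ a z (Complex.I • v)
  set q := fderiv ℝ b z v
  set q' := fderiv ℝ b z (Complex.I • v)
  refine ⟨(a z * q + 2 * b z * p) ^ 2 / b z, (a z * q' + 2 * b z * p') ^ 2 / b z,
    by positivity, by positivity, ?_, ?_, ?_⟩
  · field_simp
    ring
  · field_simp
    ring
  · rw [← add_div, div_le_iff₀ hb0, hl2, hl1]
    nlinarith [mul_le_mul_of_nonneg_left hlog (mul_self_nonneg (a z))]

end CutOff

section GlobalDefining

variable {n : ℕ} {V : Type*} [TopologicalSpace V] [ChartedSpace (Cn n) V]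
  [IsManifold 𝓘(ℂ, Cn n) ω V]

theorem exists_cutoff [T2Space V] {U : Set V} {x : V} (hU : IsOpen U) (hx : x ∈ U) :
    ∃ θ : V → ℝ, ContMDiff 𝓘(ℝ, Cn n) 𝓘(ℝ, ℝ) ∞ θ ∧ tsupport θ ⊆ U ∧ (∀ᶠ y in 𝓝 x, θ y = 1) ∧
      ∀ y, 0 ≤ θ y ∧ θ y ≤ 1 := by
  obtain ⟨f, -, hf⟩ := (SmoothBumpFunction.nhds_basis_tsupport (I := 𝓘(ℝ, Cn n)) x).mem_iff.1
    (hU.mem_nhds hx)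
  exact ⟨f, f.contMDiff, hf, f.eventuallyEq_one, fun y => ⟨f.nonneg, f.le_one⟩⟩

variable {X U : Set V} {q θ : V → ℝ}

theorem IsLocalDefining.contMDiff_sq_mul (hq : IsLocalDefining (n := n) X U q)
    (hθ : ContMDiff 𝓘(ℝ, Cn n) 𝓘(ℝ, ℝ) ∞ θ) (hθU : tsupport θ ⊆ U) :
    ContMDiff 𝓘(ℝ, Cn n) 𝓘(ℝ, ℝ) ∞ fun x => θ x * θ x * q x := by
  refine contMDiff_of_tsupport fun x hx => ?_
  have hx' : x ∈ tsupport θ := by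
    refine closure_mono (fun y hy => ?_) hx
    rw [Function.mem_support] at hy ⊢
    exact fun h => hy (by simp [h])
  exact ((hθ x).mul (hθ x)).mul (hq.smooth x (hθU hx'))

theorem IsLocalDefining.sq_mul_nonneg (hq : IsLocalDefining (n := n) X U q)
    (hθU : tsupport θ ⊆ U) (x : V) : 0 ≤ θ x * θ x * q x := by
  by_cases hx : θ x = 0
  · simp [hx]
  · exact mul_nonneg (mul_self_nonneg _) (hq.nonneg x (hθU (subset_tsupport θ hx)))

theorem IsLocalDefining.sq_mul_eq_zero (hq : IsLocalDefining (n := n) X U q)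
    (hθU : tsupport θ ⊆ U) {x : V} (hxX : x ∈ X) : θ x * θ x * q x = 0 := by
  by_cases hx : θ x = 0
  · simp [hx]
  · rw [(hq.eq_zero_iff x (hθU (subset_tsupport θ hx))).2 hxX, mul_zero]

/-- On the support of the cut-off function, local defining functions are bounded by a multiple of
any function which dominates, near every point, some local defining function. -/
theorem IsLocalDefining.exists_le_mul [CompactSpace V] (hq : IsLocalDefining (n := n) X U q)
    (hθU : tsupport θ ⊆ U) {g : V → ℝ} (hg : Continuous g) (hg0 : ∀ x, 0 ≤ g x)
    (hgX : ∀ x, x ∉ X → 0 < g x)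
    (hdom : ∀ x ∈ X, ∃ (U' : Set V) (q' : V → ℝ), x ∈ U' ∧ IsLocalDefining (n := n) X U' q' ∧
      ∀ᶠ y in 𝓝 x, q' y ≤ g y) :
    ∃ C : ℝ, 0 ≤ C ∧ ∀ x ∈ tsupport θ, q x ≤ C * g x := by
  refine (isClosed_tsupport θ).isCompact.induction_on
    (p := fun S => ∃ C : ℝ, 0 ≤ C ∧ ∀ x ∈ S, q x ≤ C * g x) ⟨0, le_rfl, by simp⟩ ?_ ?_ ?_
  · rintro s t hst ⟨A, hA, ht⟩
    exact ⟨A, hA, fun x hx => ht x (hst hx)⟩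
  · rintro s t ⟨A, hA, hs⟩ ⟨B, hB, ht⟩
    refine ⟨max A B, le_max_of_le_left hA, fun x hx => ?_⟩
    rcases hx with hx | hx
    · exact (hs x hx).trans (mul_le_mul_of_nonneg_right (le_max_left A B) (hg0 x))
    · exact (ht x hx).trans (mul_le_mul_of_nonneg_right (le_max_right A B) (hg0 x))
  · intro x hx
    suffices h : ∃ C : ℝ, 0 ≤ C ∧ ∀ᶠ y in 𝓝 x, q y ≤ C * g y by
      obtain ⟨C, hC, h⟩ := h
      exact ⟨_, mem_nhdsWithin_of_mem_nhds h, C, hC, fun y hy => hy⟩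
    have hxU := hθU hx
    by_cases hxX : x ∈ X
    · obtain ⟨U', q', hxU', hq', hle⟩ := hdom x hxX
      obtain ⟨C, hC⟩ := hq'.eventually_le x ⟨hxX, hxU'⟩ q (hq.smooth x hxU)
        (by filter_upwards [hq.isOpen.mem_nhds hxU] with y hy using hq.nonneg y hy)
        (by filter_upwards [hq.isOpen.mem_nhds hxU] with y hy h using (hq.eq_zero_iff y hy).2 h)
      refine ⟨max C 0, le_max_right _ _, ?_⟩
      filter_upwards [hC, hle, hq'.isOpen.mem_nhds hxU'] with y h1 h2 h3
      calc q y ≤ C * q' y := h1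
        _ ≤ max C 0 * q' y := mul_le_mul_of_nonneg_right (le_max_left _ _) (hq'.nonneg y h3)
        _ ≤ max C 0 * g y := mul_le_mul_of_nonneg_left h2 (le_max_right _ _)
    · have hgx := hgX x hxX
      refine ⟨(|q x| + 1) / g x, by positivity, ?_⟩
      have hlt : q x < (|q x| + 1) / g x * g x := by
        rw [div_mul_cancel₀ _ hgx.ne']
        linarith [le_abs_self (q x)]
      have hc : ContinuousAt (fun y => (|q x| + 1) / g x * g y) x := by fun_prop
      filter_upwards [(hq.smooth x hxU).continuousAt.eventually_lt hc hlt] with y hy using hy.le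

/-- `q` cut off by `θ` satisfies the estimate needed for the sum, relatively to a function `g` which
dominates `q`. -/
theorem IsLocalDefining.exists_sq_fderiv_eq [CompactSpace V] {κ : TwoForm n V}
    (hκ : IsKahlerForm κ) (hq : IsLocalDefining (n := n) X U q)
    (hθ : ContMDiff 𝓘(ℝ, Cn n) 𝓘(ℝ, ℝ) ∞ θ) (hθU : tsupport θ ⊆ U) (hθ1 : ∀ y, 0 ≤ θ y ∧ θ y ≤ 1)
    {g : V → ℝ} (hg0 : ∀ x, 0 ≤ g x) (hqg : ∃ C : ℝ, 0 ≤ C ∧ ∀ x ∈ tsupport θ, q x ≤ C * g x) :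
    ∃ C : ℝ, 0 ≤ C ∧ ∀ x, x ∉ X → ∀ v : Cn n, ∃ r s : ℝ, 0 ≤ r ∧ 0 ≤ s ∧
      fderiv ℝ ((fun y => θ y * θ y * q y) ∘ (chartAt (Cn n) x).symm) (chartAt (Cn n) x x) v ^ 2 =
        θ x * θ x * q x * r ∧
      fderiv ℝ ((fun y => θ y * θ y * q y) ∘ (chartAt (Cn n) x).symm) (chartAt (Cn n) x x)
        (Complex.I • v) ^ 2 = θ x * θ x * q x * s ∧
      r + s ≤ lev (fun y => θ y * θ y * q y) x v + C * g x * hermForm κ x v := by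
  obtain ⟨A, hA, hA'⟩ := exists_abs_lev_le hκ hθ
  obtain ⟨B, hB, hB'⟩ := exists_abs_lev_le hκ (hθ.mul hθ)
  obtain ⟨D, hD, hqg⟩ := hqg
  refine ⟨D * (4 * A + B), by positivity, fun x hxX v => ?_⟩
  have hH := hermForm_nonneg hκ x v
  have hgx := hg0 x
  by_cases hx : x ∈ tsupport θ
  · have hxU := hθU hx
    have hqpos : 0 < q x := (hq.nonneg x hxU).lt_of_ne fun h => hxX ((hq.eq_zero_iff x hxU).1 h.symm)
    have hx' : (chartAt (Cn n) x).symm (chartAt (Cn n) x x) = x := by simp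
    have := exists_sq_fderiv_eq_of_sq_mul (z := chartAt (Cn n) x x) (v := v)
      ((contDiffAt_chartAt (hθ x)).of_le two_le_infty)
      ((contDiffAt_chartAt (hq.smooth x hxU)).of_le two_le_infty)
      (by rw [Function.comp_apply, hx']; exact hqpos)
      (by rw [Function.comp_apply, hx']; exact hq.grad_le x hxU v)
    simp only [Function.comp_apply, hx'] at this
    obtain ⟨r, s, hr, hs, h1, h2, h3⟩ := this
    refine ⟨r, s, hr, hs, h1, h2, h3.trans ?_⟩
    have h4 := abs_le.1 (hA' x v)
    have h5 := abs_le.1 (hB' x v)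
    have h6 : lev (fun y => θ y * θ y) x v - 4 * θ x * lev θ x v ≤
        (4 * A + B) * hermForm κ x v := by
      have h7 : θ x * -lev θ x v ≤ A * hermForm κ x v := by
        have hnn : 0 ≤ A * hermForm κ x v := by positivity
        calc θ x * -lev θ x v ≤ θ x * (A * hermForm κ x v) :=
              mul_le_mul_of_nonneg_left (neg_le.1 h4.1) (hθ1 x).1
          _ ≤ 1 * (A * hermForm κ x v) := mul_le_mul_of_nonneg_right (hθ1 x).2 hnn
          _ = _ := one_mul _
      have h8 := h5.2
      simp only [Pi.mul_def] at h8
      linarith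
    have h9 : q x * (lev (fun y => θ y * θ y) x v - 4 * θ x * lev θ x v) ≤
        D * (4 * A + B) * g x * hermForm κ x v :=
      calc _ ≤ q x * ((4 * A + B) * hermForm κ x v) := mul_le_mul_of_nonneg_left h6 hqpos.le
        _ ≤ (D * g x) * ((4 * A + B) * hermForm κ x v) :=
          mul_le_mul_of_nonneg_right (hqg x hx) (by positivity)
        _ = _ := by ring
    exact add_le_add_right h9 _
  · have hev : (fun y => θ y * θ y * q y) =ᶠ[𝓝 x] fun _ => 0 := by
      filter_upwards [(isClosed_tsupport θ).isOpen_compl.mem_nhds hx] with y hy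
      simp [image_eq_zero_of_notMem_tsupport hy]
    have hθx := image_eq_zero_of_notMem_tsupport hx
    have hev' := comp_symm_eventuallyEq (mem_chart_source (Cn n) x) hev
    refine ⟨0, 0, le_rfl, le_rfl, ?_, ?_, ?_⟩
    · rw [hev'.fderiv_eq]
      simp [Function.comp_def]
    · rw [hev'.fderiv_eq]
      simp [Function.comp_def]
    · rw [lev_congr hev]
      have : lev (fun _ => (0 : ℝ)) x v = 0 := leviForm_const _ _ _
      rw [this, zero_add, zero_add]
      positivity

/-- A closed complex submanifold of a compact Kähler manifold has a smooth defining function `g`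
such that `log g` is quasi-plurisubharmonic, and whose Levi form at the points of `X` degenerates only
in the directions tangent to `X`. -/
theorem exists_defining_function [CompactSpace V] [T2Space V] {κ : TwoForm n V}
    (hκ : IsKahlerForm κ) (hX : IsComplexSubmanifold n X) :
    ∃ (g : V → ℝ) (C : ℝ), ContMDiff 𝓘(ℝ, Cn n) 𝓘(ℝ, ℝ) ∞ g ∧ (∀ x, 0 ≤ g x) ∧
      (∀ x, g x = 0 ↔ x ∈ X) ∧ 0 ≤ C ∧
      (∀ x (v : Cn n), grad g x v ≤ g x * (lev g x v + C * g x * hermForm κ x v)) ∧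
      ∀ x ∈ X, ∀ v : Cn n, lev g x v = 0 → IsTangent X x v := by
  choose U q hxU hq using exists_isLocalDefining (n := n) hX
  choose θ hθ hθU hθx hθ1 using fun x => exists_cutoff (n := n) (hq x).isOpen (hxU x)
  obtain ⟨t, ht⟩ := CompactSpace.elim_nhds_subcover (fun x => {y | ∀ᶠ y' in 𝓝 y, θ x y' = 1})
    (fun x => eventually_eventually_nhds.2 (hθx x))
  have hcov : ∀ x, ∃ i ∈ t, ∀ᶠ y in 𝓝 x, θ i y = 1 := by
    intro x
    have : x ∈ (⊤ : Set V) := mem_univ x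
    rw [← ht] at this
    simpa using this
  set F : V → V → ℝ := fun i y => θ i y * θ i y * q i y with hF
  have hFs : ∀ i, ContMDiff 𝓘(ℝ, Cn n) 𝓘(ℝ, ℝ) ∞ (F i) := fun i =>
    (hq i).contMDiff_sq_mul (hθ i) (hθU i)
  have hF0 : ∀ i x, 0 ≤ F i x := fun i => (hq i).sq_mul_nonneg (hθU i)
  have hFX : ∀ i, ∀ x ∈ X, F i x = 0 := fun i x hx => (hq i).sq_mul_eq_zero (hθU i) hx
  set g : V → ℝ := fun y => ∑ i ∈ t, F i y with hg
  have hgs : ContMDiff 𝓘(ℝ, Cn n) 𝓘(ℝ, ℝ) ∞ g := contMDiff_finsetSum fun i _ => hFs i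
  have hg0 : ∀ x, 0 ≤ g x := fun x => Finset.sum_nonneg fun i _ => hF0 i x
  have hmemU : ∀ i x, (∀ᶠ y in 𝓝 x, θ i y = 1) → x ∈ U i := fun i x h =>
    hθU i (subset_tsupport _ (by simp [h.self_of_nhds]))
  have hgX : ∀ x, g x = 0 ↔ x ∈ X := by
    intro x
    refine ⟨fun h => ?_, fun h => Finset.sum_eq_zero fun i _ => hFX i x h⟩
    obtain ⟨i, hi, hi1⟩ := hcov x
    have h1 := (Finset.sum_eq_zero_iff_of_nonneg fun i _ => hF0 i x).1 h i hi
    simp only [hF, hi1.self_of_nhds, one_mul] at h1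
    exact ((hq i).eq_zero_iff x (hmemU i x hi1)).1 h1
  have hlevg : ∀ x (v : Cn n), lev g x v = ∑ i ∈ t, lev (F i) x v := fun x v =>
    leviForm_sum t (fun i _ => (contDiffAt_chartAt (hFs i x)).of_le two_le_infty) v
  have hdom : ∀ x ∈ X, ∃ (U' : Set V) (q' : V → ℝ), x ∈ U' ∧ IsLocalDefining (n := n) X U' q' ∧
      ∀ᶠ y in 𝓝 x, q' y ≤ g y := by
    intro x _
    obtain ⟨i, hi, hi1⟩ := hcov x
    refine ⟨U i, q i, hmemU i x hi1, hq i, hi1.mono fun y hy => ?_⟩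
    have h1 := Finset.single_le_sum (fun i _ => hF0 i y) hi
    simpa [hF, hy] using h1
  have hest := fun i => (hq i).exists_sq_fderiv_eq hκ (hθ i) (hθU i) (hθ1 i) hg0
    ((hq i).exists_le_mul (hθU i) hgs.continuous hg0
      (fun x hx => (hg0 x).lt_of_ne fun h => hx ((hgX x).1 h.symm)) hdom)
  choose C hC hest using hest
  refine ⟨g, ∑ i ∈ t, C i, hgs, hg0, hgX, Finset.sum_nonneg fun i _ => hC i, fun x v => ?_,
    fun x hx v hv => ?_⟩
  · by_cases hx : x ∈ X
    · rw [grad_eq_zero_of_nonneg (Eventually.of_forall hg0) ((hgX x).2 hx), (hgX x).2 hx, zero_mul]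
    · choose r s hr hs h1 h2 h3 using fun i => hest i x hx v
      have hd : ∀ w : Cn n, fderiv ℝ (g ∘ (chartAt (Cn n) x).symm) (chartAt (Cn n) x x) w =
          ∑ i ∈ t, fderiv ℝ (F i ∘ (chartAt (Cn n) x).symm) (chartAt (Cn n) x x) w := by
        intro w
        have : g ∘ (chartAt (Cn n) x).symm = fun z => ∑ i ∈ t, (F i ∘ (chartAt (Cn n) x).symm) z :=
          rfl
        rw [this, fderiv_fun_sum fun i _ => (contDiffAt_chartAt (hFs i x)).differentiableAt (by simp)]
        simp
      have e1 := Finset.sum_sq_le_sum_mul_sum_of_sq_le_mul t (fun i _ => hF0 i x)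
        (fun i _ => hr i) (fun i _ => (h1 i).le)
      have e2 := Finset.sum_sq_le_sum_mul_sum_of_sq_le_mul t (fun i _ => hF0 i x)
        (fun i _ => hs i) (fun i _ => (h2 i).le)
      rw [grad, gradSq, hd, hd]
      calc _ ≤ g x * (∑ i ∈ t, r i) + g x * ∑ i ∈ t, s i := add_le_add e1 e2
        _ = g x * ∑ i ∈ t, (r i + s i) := by rw [Finset.sum_add_distrib, mul_add]
        _ ≤ g x * ∑ i ∈ t, (lev (F i) x v + C i * g x * hermForm κ x v) :=
          mul_le_mul_of_nonneg_left (Finset.sum_le_sum fun i _ => h3 i) (hg0 x)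
        _ = _ := by rw [Finset.sum_add_distrib, ← Finset.sum_mul, ← Finset.sum_mul, hlevg]
  · obtain ⟨i, hi, hi1⟩ := hcov x
    rw [hlevg] at hv
    have h1 := (Finset.sum_eq_zero_iff_of_nonneg fun i _ =>
      lev_nonneg_of_nonneg (hFs i x) (Eventually.of_forall (hF0 i)) (hFX i x hx) v).1 hv i hi
    rw [lev_congr (w := q i) (by filter_upwards [hi1] with y hy; simp [hF, hy])] at h1
    exact (hq i).isTangent x ⟨hx, hmemU i x hi1⟩ v h1

end GlobalDefining

/-! ### Extension of smooth functions from a submanifold -/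

section Extension

variable {n : ℕ} {V : Type*} [TopologicalSpace V] [ChartedSpace (Cn n) V]
  [IsManifold 𝓘(ℂ, Cn n) ω V] {X : Set V}

theorem exists_smooth_extension [CompactSpace V] [T2Space V] (hX : IsComplexSubmanifold n X)
    {φ : X → ℝ} (hφ : IsSmoothOnSubmanifold n X φ) :
    ∃ f : V → ℝ, ContMDiff 𝓘(ℝ, Cn n) 𝓘(ℝ, ℝ) ∞ f ∧ ∀ x : X, f x = φ x := by
  set φ₀ : V → ℝ := Function.extend Subtype.val φ 0 with hφ₀
  have hval : ∀ x : X, φ₀ x = φ x := fun x => Subtype.val_injective.extend_apply φ 0 x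
  have hconv : ∀ x : V, Convex ℝ {r : ℝ | x ∈ X → r = φ₀ x} := by
    intro x r hr s hs a b _ _ hab hx
    rw [hr hx, hs hx, ← add_smul, hab, one_smul]
  suffices hloc : ∀ x : V, ∃ U ∈ 𝓝 x, ∃ g : V → ℝ, ContMDiffOn 𝓘(ℝ, Cn n) 𝓘(ℝ, ℝ) ∞ g U ∧
      ∀ y ∈ U, g y ∈ {r : ℝ | y ∈ X → r = φ₀ y} by
    obtain ⟨f, hf⟩ := exists_contMDiffMap_forall_mem_convex_of_local 𝓘(ℝ, Cn n) (n := ⊤) hconv hloc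
    exact ⟨f, f.contMDiff, fun x => (hf x x.2).trans (hval x)⟩
  intro x
  by_cases hx : x ∈ X
  · obtain ⟨e, W, hxe, he⟩ := hX.2 x hx
    have her := maximalAtlas_complex_subset_real he.1
    set π : Cn n →L[ℝ] W := W.orthogonalProjectionOnto.restrictScalars ℝ with hπ
    have hπW : ∀ z (hz : z ∈ W), ((π z : W) : Cn n) = z := fun z hz =>
      Submodule.starProjection_eq_self_iff.2 hz
    have hc : Continuous fun z => ((π z : W) : Cn n) := continuous_subtype_val.comp π.continuous
    set O : Set (Cn n) := {z | ((π z : W) : Cn n) ∈ e.target} with hO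
    have hOo : IsOpen O := e.open_target.preimage hc
    have hxO : e x ∈ O := by
      rw [hO, mem_ofPred_eq, hπW _ ((he.2 x hxe).1 hx)]
      exact e.map_source hxe
    refine ⟨e.source ∩ e ⁻¹' O, (e.isOpen_inter_preimage hOo).mem_nhds ⟨hxe, hxO⟩,
      fun y => φ₀ (e.symm (π (e y))), fun y hy => ?_, fun y hy hyX => ?_⟩
    · have hT : IsOpen {w : W | (w : Cn n) ∈ e.target} :=
        e.open_target.preimage continuous_subtype_val
      have h1 := (hφ e W he).contDiffAt (hT.mem_nhds (x := π (e y)) hy.2)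
      have h2 : ContDiffAt ℝ ∞ (fun z => φ₀ (e.symm (π z))) (e y) :=
        ContDiffAt.comp (e y) h1 π.contDiff.contDiffAt
      exact (contMDiffAt_comp_chart her hy.1 h2).contMDiffWithinAt
    · change φ₀ (e.symm (π (e y))) = φ₀ y
      rw [hπW _ ((he.2 y hy.1).1 hyX), e.left_inv hy.1]
  · exact ⟨Xᶜ, hX.1.isOpen_compl.mem_nhds hx, fun _ => 0, contMDiffOn_const,
      fun y hy hyX => absurd hyX hy⟩

theorem isSmoothOnSubmanifold_restrict {ψ : V → ℝ} (hψ : ContMDiff 𝓘(ℝ, Cn n) 𝓘(ℝ, ℝ) ∞ ψ) :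
    IsSmoothOnSubmanifold n X fun x : X => ψ x := by
  intro e W he
  have her := maximalAtlas_complex_subset_real he.1
  have hX : ∀ w : W, (w : Cn n) ∈ e.target → e.symm w ∈ X := fun w hw =>
    (he.2 _ (e.map_target hw)).2 (by rw [e.right_inv hw]; exact w.2)
  have hsm : ContDiffOn ℝ ∞ (fun w : W => ψ (e.symm w)) {w : W | (w : Cn n) ∈ e.target} := by
    intro w hw
    have h1 := contDiffAt_comp_symm her (e.map_target hw) (hψ (e.symm w))
    rw [e.right_inv hw] at h1
    exact (ContDiffAt.comp w h1
      (W.subtypeL.restrictScalars ℝ).contDiff.contDiffAt).contDiffWithinAt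
  refine hsm.congr fun w hw => ?_
  exact Subtype.val_injective.extend_apply (fun x : X => ψ x) 0 ⟨e.symm w, hX w hw⟩

end Extension

/-! ### Regularised maxima -/

section LogSum

variable {E : Type*} [NormedAddCommGroup E] [NormedSpace ℂ E] [NormedSpace ℝ E]

/-- The Levi form of `δ log (e ^ (Φ / δ) + B g)`, when `|∂g|² ≤ g T`. -/
theorem le_leviForm_log_exp_add {Φ g : E → ℝ} {z v : E} (hΦ : ContDiffAt ℝ 2 Φ z)
    (hg : ContDiffAt ℝ 2 g z) {δ B T : ℝ} (hδ : 0 < δ) (hB : 0 ≤ B) (hg0 : 0 ≤ g z) (hT : 0 ≤ T)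
    (hgrad : gradSq g z v ≤ g z * T) :
    Real.exp (Φ z / δ) * leviForm Φ z v - δ * B * (T - leviForm g z v) ≤
      (Real.exp (Φ z / δ) + B * g z) *
        leviForm (fun y => δ * Real.log (Real.exp (Φ y / δ) + B * g y)) z v := by
  have hexp : ∀ t, HasDerivAt (fun t => Real.exp (t / δ)) (Real.exp (t / δ) / δ) t := fun t => by
    simpa [div_eq_mul_inv] using ((hasDerivAt_id t).div_const δ).exp
  have hexp' : ∀ t, HasDerivAt (fun t => Real.exp (t / δ) / δ) (Real.exp (t / δ) / δ / δ) t :=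
    fun t => (hexp t).div_const δ
  have hP : ContDiffAt ℝ 2 (fun y => Real.exp (Φ y / δ)) z := (hΦ.div_const δ).exp
  have hQ : ContDiffAt ℝ 2 (fun y => B * g y) z := contDiffAt_const.mul hg
  have hS : ContDiffAt ℝ 2 (fun y => Real.exp (Φ y / δ) + B * g y) z := hP.add hQ
  set P := Real.exp (Φ z / δ) with hPdef
  have hPpos : 0 < P := Real.exp_pos _
  set S := P + B * g z with hSdef
  have hSpos : 0 < S := by positivity
  have hlP : leviForm (fun y => Real.exp (Φ y / δ)) z v =
      P / δ * leviForm Φ z v + P / δ / δ * gradSq Φ z v :=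
    leviForm_comp hΦ (Eventually.of_forall hexp) (hexp' _) v
  have hlS : leviForm (fun y => Real.exp (Φ y / δ) + B * g y) z v =
      P / δ * leviForm Φ z v + P / δ / δ * gradSq Φ z v + B * leviForm g z v := by
    rw [leviForm_add hP hQ, hlP, leviForm_const_mul]
  have hdS : ∀ w, fderiv ℝ (fun y => Real.exp (Φ y / δ) + B * g y) z w =
      P / δ * fderiv ℝ Φ z w + B * fderiv ℝ g z w := by
    intro w
    have h1 : HasFDerivAt (fun y => Real.exp (Φ y / δ)) ((P / δ) • fderiv ℝ Φ z) z :=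
      (hexp (Φ z)).comp_hasFDerivAt z (hΦ.differentiableAt (by norm_num)).hasFDerivAt
    have h2 := (hg.differentiableAt (by norm_num)).hasFDerivAt.const_mul B
    rw [(h1.fun_add h2).fderiv]
    simp
  have hlog : ∀ᶠ t in 𝓝 S, HasDerivAt Real.log t⁻¹ t :=
    (lt_mem_nhds hSpos).mono fun t ht => Real.hasDerivAt_log ht.ne'
  have hL := leviForm_comp (F := Real.log) (F' := fun t => t⁻¹) hS hlog
    (hasDerivAt_inv hSpos.ne') v
  have hgS : gradSq (fun y => Real.exp (Φ y / δ) + B * g y) z v =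
      (P / δ * fderiv ℝ Φ z v + B * fderiv ℝ g z v) ^ 2 +
        (P / δ * fderiv ℝ Φ z (Complex.I • v) + B * fderiv ℝ g z (Complex.I • v)) ^ 2 := by
    rw [gradSq, hdS, hdS]
  rw [leviForm_const_mul, hL, hlS, hgS, ← hPdef, ← hSdef]
  simp only [gradSq] at hgrad ⊢
  set a := fderiv ℝ Φ z v
  set a' := fderiv ℝ Φ z (Complex.I • v)
  set b := fderiv ℝ g z v
  set b' := fderiv ℝ g z (Complex.I • v)
  set L := leviForm Φ z v
  set M := leviForm g z v
  set γ := g z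
  -- the arithmetic-geometric inequality, from `|b|² ≤ γ T`
  have hab : 2 * (a / δ * b + a' / δ * b') ≤ T + γ * ((a / δ) ^ 2 + (a' / δ) ^ 2) := by
    rcases hg0.eq_or_lt with h0 | h0
    · rw [← h0, zero_mul] at hgrad
      have hb : b = 0 := by nlinarith [sq_nonneg b, sq_nonneg b']
      have hb' : b' = 0 := by nlinarith [sq_nonneg b, sq_nonneg b']
      rw [hb, hb', ← h0]
      simpa using hT
    · have h1 := sq_nonneg (γ * (a / δ) - b)
      have h2 := sq_nonneg (γ * (a' / δ) - b')
      refine le_of_mul_le_mul_left ?_ h0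
      nlinarith
  have hcs : (P / δ * a + B * b) ^ 2 + (P / δ * a' + B * b') ^ 2 ≤
      S * (P * ((a / δ) ^ 2 + (a' / δ) ^ 2) + B * T) := by
    have h1 := mul_le_mul_of_nonneg_left hab (mul_nonneg hPpos.le hB)
    have h2 := mul_le_mul_of_nonneg_left hgrad (mul_nonneg hB hB)
    have e1 : P / δ * a = P * (a / δ) := by ring
    have e2 : P / δ * a' = P * (a' / δ) := by ring
    rw [e1, e2, hSdef]
    nlinarith
  have hfin : S * (δ * (S⁻¹ * (P / δ * L + P / δ / δ * (a ^ 2 + a' ^ 2) + B * M) +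
      -(S ^ 2)⁻¹ * ((P / δ * a + B * b) ^ 2 + (P / δ * a' + B * b') ^ 2))) =
      P * L + δ * B * M + δ * (P * ((a / δ) ^ 2 + (a' / δ) ^ 2)) -
        δ * (((P / δ * a + B * b) ^ 2 + (P / δ * a' + B * b') ^ 2) / S) := by
    field_simp
    ring
  rw [hfin]
  have h3 : ((P / δ * a + B * b) ^ 2 + (P / δ * a' + B * b') ^ 2) / S ≤
      P * ((a / δ) ^ 2 + (a' / δ) ^ 2) + B * T := by
    rw [div_le_iff₀ hSpos, mul_comm _ S]
    exact hcs
  have h4 := mul_le_mul_of_nonneg_left h3 hδ.le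
  linarith

end LogSum

section Gluing

variable {n : ℕ} {V : Type*} [TopologicalSpace V] [ChartedSpace (Cn n) V]
  [IsManifold 𝓘(ℂ, Cn n) ω V] [CompactSpace V] [T2Space V] {X : Set V}

/-- A smooth function which is strictly plurisubharmonic relatively to `cκ` along `X` can be modified
outside `X` so as to be strictly plurisubharmonic relatively to `cκ` everywhere. -/
theorem exists_lev_add_hermForm_pos {κ : TwoForm n V} (hκ : IsKahlerForm κ)
    (hX : IsComplexSubmanifold n X) {f : V → ℝ} (hf : ContMDiff 𝓘(ℝ, Cn n) 𝓘(ℝ, ℝ) ∞ f) {c : ℝ}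
    (hc : 0 < c)
    (h : ∀ x ∈ X, ∀ v : Cn n, v ≠ 0 → IsTangent X x v → 0 < lev f x v + c * hermForm κ x v) :
    ∃ ψ : V → ℝ, ContMDiff 𝓘(ℝ, Cn n) 𝓘(ℝ, ℝ) ∞ ψ ∧ (∀ x ∈ X, ψ x = f x) ∧
      ∀ x (v : Cn n), v ≠ 0 → 0 < lev ψ x v + c * hermForm κ x v := by
  obtain ⟨g, C, hg, hg0, hgX, hC, hgrad, hgt⟩ := exists_defining_function hκ hX
  have hlevg : ∀ x ∈ X, ∀ v : Cn n, 0 ≤ lev g x v := fun x hx v =>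
    lev_nonneg_of_nonneg (hg x) (Eventually.of_forall hg0) ((hgX x).2 hx) v
  obtain ⟨A, -, hA⟩ := exists_const_lev_pos hκ hX.1.isCompact hf hg c hlevg
    fun x hx v hv h0 => h x hx v hv (hgt x hx v h0)
  set Φ : V → ℝ := fun x => f x + A * g x with hΦdef
  have hAg : ContMDiff 𝓘(ℝ, Cn n) 𝓘(ℝ, ℝ) ∞ fun x => A * g x := contMDiff_const.mul hg
  have hΦ : ContMDiff 𝓘(ℝ, Cn n) 𝓘(ℝ, ℝ) ∞ Φ := hf.add hAg
  have hΦX : ∀ x ∈ X, Φ x = f x := fun x hx => by simp [hΦdef, (hgX x).2 hx]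
  set N : Set V := {x | ∀ᶠ y in 𝓝 x, ∀ v : Cn n, v ≠ 0 → 0 < lev Φ y v + c * hermForm κ y v}
    with hN
  have hNo : IsOpen N := isOpen_setOfPred_eventually_nhds
  have hXN : X ⊆ N := fun x hx => eventually_lev_add_hermForm_pos hκ hΦ c fun v hv => by
    rw [lev_add (hf x) (hAg x), lev_const_mul]
    exact hA x hx v hv
  obtain ⟨g₀, hg₀, hg₀N⟩ := hNo.isClosed_compl.isCompact.exists_forall_le' hg.continuous.continuousOn
    (a := 0) fun x hx => (hg0 x).lt_of_ne fun h0 => hx (hXN ((hgX x).1 h0.symm))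
  obtain ⟨D, hD, hDΦ⟩ := exists_abs_lev_le hκ hΦ
  -- `δ` is small enough for the loss `δ C` in the region where `g` dominates
  set δ : ℝ := c / (2 * (C + 1)) with hδdef
  have hδ : 0 < δ := by positivity
  have hδC : δ * C ≤ c / 2 := by
    rw [hδdef, div_mul_eq_mul_div, div_le_div_iff₀ (by positivity) two_pos]
    nlinarith
  have hPc : Continuous fun x => Real.exp (Φ x / δ) :=
    Real.continuous_exp.comp (hΦ.continuous.div_const δ)
  obtain ⟨M, hM⟩ := isCompact_univ.exists_bound_of_continuousOn hPc.continuousOn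
  have hM' : ∀ x, Real.exp (Φ x / δ) ≤ |M| := fun x =>
    (le_abs_self _).trans ((hM x (mem_univ x)).trans (le_abs_self M))
  -- `B` is large enough for `B g` to dominate away from `X`
  set B : ℝ := 2 * (|M| * D + 1) / (g₀ * c) with hBdef
  have hB : 0 ≤ B := by positivity
  have hBg : |M| * D + 1 = B * g₀ * (c / 2) := by
    rw [hBdef]
    field_simp
  have hSpos : ∀ x, 0 < Real.exp (Φ x / δ) + B * g x := fun x =>
    add_pos_of_pos_of_nonneg (Real.exp_pos _) (mul_nonneg hB (hg0 x))
  refine ⟨fun x => δ * Real.log (Real.exp (Φ x / δ) + B * g x), ?_, ?_, ?_⟩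
  · intro x
    have hin : ContMDiffAt 𝓘(ℝ, Cn n) 𝓘(ℝ, ℝ × ℝ) ∞ (fun x => (Φ x, g x)) x :=
      (hΦ x).prodMk_space (hg x)
    have hout : ContDiffAt ℝ ∞ (fun p : ℝ × ℝ => δ * Real.log (Real.exp (p.1 / δ) + B * p.2))
        (Φ x, g x) := by
      refine contDiffAt_const.mul (ContDiffAt.log ?_ (hSpos x).ne')
      exact (contDiffAt_fst.div_const δ).exp.add (contDiffAt_const.mul contDiffAt_snd)
    exact ContMDiffAt.comp (f := fun x => (Φ x, g x)) (I' := 𝓘(ℝ, ℝ × ℝ))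
      (g := fun p : ℝ × ℝ => δ * Real.log (Real.exp (p.1 / δ) + B * p.2)) x hout.contMDiffAt hin
  · intro x hx
    simp only [(hgX x).2 hx, mul_zero, add_zero, Real.log_exp, hΦX x hx]
    field_simp
  · intro x v hv
    have hH := hermForm_pos hκ x hv
    have hgx := hg0 x
    set T := lev g x v + C * g x * hermForm κ x v with hT
    have hT0 : 0 ≤ T := by
      rcases hgx.eq_or_lt with h0 | h0
      · have := hlevg x ((hgX x).1 h0.symm) v
        rw [hT, ← h0]
        simpa using this
      · exact nonneg_of_mul_nonneg_right ((grad_nonneg g v).trans (hgrad x v)) h0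
    have hx' : (chartAt (Cn n) x).symm (chartAt (Cn n) x x) = x := by simp
    have hmain := le_leviForm_log_exp_add (v := v) ((contDiffAt_chartAt (hΦ x)).of_le two_le_infty)
      ((contDiffAt_chartAt (hg x)).of_le two_le_infty) hδ hB
      (by rw [Function.comp_apply, hx']; exact hgx) hT0
      (by rw [Function.comp_apply, hx']; exact hgrad x v)
    simp only [Function.comp_apply, hx'] at hmain
    change Real.exp (Φ x / δ) * lev Φ x v - δ * B * (T - lev g x v) ≤
      (Real.exp (Φ x / δ) + B * g x) *
        lev (fun x => δ * Real.log (Real.exp (Φ x / δ) + B * g x)) x v at hmain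
    set Ψ := lev (fun x => δ * Real.log (Real.exp (Φ x / δ) + B * g x)) x v
    have hP := Real.exp_pos (Φ x / δ)
    have hPM := hM' x
    set P := Real.exp (Φ x / δ)
    set H := hermForm κ x v
    have h1 : P * (lev Φ x v + c * H) + B * g x * (c / 2) * H ≤ (P + B * g x) * (Ψ + c * H) := by
      have h2 : δ * B * (T - lev g x v) ≤ B * g x * (c / 2) * H := by
        have h3 : 0 ≤ B * g x * H := by positivity
        have h4 := mul_le_mul_of_nonneg_right hδC h3
        rw [hT]
        linarith
      linarith
    refine pos_of_mul_pos_right (lt_of_lt_of_le ?_ h1) (hSpos x).le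
    by_cases hxN : x ∈ N
    · have h5 := hxN.self_of_nhds v hv
      exact add_pos_of_pos_of_nonneg (mul_pos hP h5) (by positivity)
    · have h5 := hg₀N x hxN
      have h6 := (abs_le.1 (hDΦ x v)).1
      have h7 : -(|M| * D * H) ≤ P * lev Φ x v := by
        have h8 := mul_le_mul_of_nonneg_left h6 hP.le
        have h9 := mul_le_mul_of_nonneg_right hPM (mul_nonneg hD hH.le)
        linarith
      have h10 : (|M| * D + 1) * H ≤ B * g x * (c / 2) * H := by
        rw [hBg]
        gcongr
      have h11 : 0 < P * (c * H) := by positivity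
      linarith

end Gluing

/-! ### Strictly `κ`-plurisubharmonic functions -/

section Strict

variable {n : ℕ} {V : Type*} [TopologicalSpace V] [ChartedSpace (Cn n) V]
  [IsManifold 𝓘(ℂ, Cn n) ω V]

theorem hermForm_const_smul (κ : TwoForm n V) (c : ℝ) (x : V) (v : Cn n) :
    hermForm (fun x => c • κ x) x v = c * hermForm κ x v := by
  change 2 * Real.pi * (c * κ x ![v, complexStructure x v]) =
    c * (2 * Real.pi * κ x ![v, complexStructure x v])
  ring

theorem ddc_const_mul {κ : TwoForm n V} (hκ : IsKahlerForm κ) {ρ : V → ℝ} {x : V}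
    (hρ : ContMDiffAt 𝓘(ℝ, Cn n) 𝓘(ℝ, ℝ) ∞ ρ x) (h : ddc ρ x = κ x) (c : ℝ) :
    ddc (fun y => c * ρ y) x = c • κ x := by
  have hs : ContMDiffAt 𝓘(ℝ, Cn n) 𝓘(ℝ, ℝ) ∞ (fun y => c * ρ y) x := contMDiffAt_const.mul hρ
  have hs' := (contDiffAt_chartAt hs).of_le two_le_infty
  refine twoForm_ext_of_type_one_one (A := ddc (fun y => c * ρ y) x) (B := c • κ x)
    (fun v w => extDeriv_dcModel_smul_I hs' v w)
    (fun v w => congrArg (c * ·) (hκ.type_one_one x v w)) fun v => ?_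
  have h1 := extDeriv_dcModel_apply_self hs' v
  have h2 : lev (fun y => c * ρ y) x v = c * hermForm κ x v := by
    rw [lev_const_mul, lev_eq_hermForm hρ h]
  have h3 := h1.trans (h2.trans (hermForm_const_smul κ c x v).symm)
  exact mul_left_cancel₀ (by positivity) h3

/-- A smooth function `ψ` such that `(1 - ε) κ + dd^c ψ` is positive is strictly
`κ`-plurisubharmonic. -/
theorem isStrictlyOmegaPsh_of_lev_pos [Nonempty V] {κ : TwoForm n V} (hκ : IsKahlerForm κ)
    {ε : ℝ} (hε : 0 < ε) (hε1 : ε < 1) {ψ : V → ℝ} (hψ : ContMDiff 𝓘(ℝ, Cn n) 𝓘(ℝ, ℝ) ∞ ψ)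
    (hpos : ∀ x (v : Cn n), v ≠ 0 → 0 < lev ψ x v + (1 - ε) * hermForm κ x v) :
    IsStrictlyOmegaPsh κ univ fun x : (univ : Set V) => (ψ x : EReal) := by
  refine ⟨ε, hε, hε1, ?_, fun x => EReal.coe_ne_top _,
    ⟨⟨Classical.arbitrary V, mem_univ _⟩, EReal.coe_ne_bot _⟩, fun x _ => ?_⟩
  · exact (continuous_coe_real_ereal.comp
      (hψ.continuous.comp continuous_subtype_val)).upperSemicontinuous
  obtain ⟨U, ρ, hU, hxU, hρ, hd⟩ := exists_local_potential hκ x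
  have hρ' : ContMDiffOn 𝓘(ℝ, Cn n) 𝓘(ℝ, ℝ) ∞ (fun y => (1 - ε) * ρ y) U :=
    contMDiffOn_const.mul hρ
  have hlev : ∀ y ∈ U, ∀ v : Cn n, lev (fun y => (1 - ε) * ρ y) y v =
      (1 - ε) * hermForm κ y v := fun y hy v => by
    rw [lev_const_mul, lev_eq_hermForm (hρ.contMDiffAt (hU.mem_nhds hy)) (hd y hy)]
  refine ⟨U, hU, hxU, fun y => (1 - ε) * ρ y, fun y => (((1 - ε) * ρ y + ψ y : ℝ) : EReal), hρ',
    isPshOn_of_lev_nonneg hU ⟨x, hxU⟩ hρ' fun y hy v => ?_,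
    fun y hy => ddc_const_mul hκ (hρ.contMDiffAt (hU.mem_nhds hy)) (hd y hy) _,
    isPshOn_of_lev_nonneg hU ⟨x, hxU⟩ (hρ'.add hψ.contMDiffOn) fun y hy v => ?_,
    fun y _ => (EReal.coe_add _ _).symm⟩
  · rw [hlev y hy]
    exact mul_nonneg (by linarith) (hermForm_nonneg hκ y v)
  · have h1 : lev (fun y => (1 - ε) * ρ y + ψ y) y v = (1 - ε) * hermForm κ y v + lev ψ y v := by
      rw [lev_add (hρ'.contMDiffAt (hU.mem_nhds hy)) (hψ y), hlev y hy]
    refine le_of_le_of_eq ?_ h1.symm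
    rcases eq_or_ne v 0 with rfl | hv
    · rw [lev_zero_right, add_zero]
      exact mul_nonneg (by linarith) (hermForm_nonneg hκ y 0)
    · linarith [hpos y v hv]

/-- A smooth extension of an `(1 - ε) κ|_X`-plurisubharmonic function has a Levi form bounded below
by `-(1 - ε) κ` in the directions tangent to `X`. -/
theorem lev_add_hermForm_nonneg_of_isOmegaPsh {κ : TwoForm n V} {X : Set V} {c : ℝ} {f : V → ℝ}
    (hf : ContMDiff 𝓘(ℝ, Cn n) 𝓘(ℝ, ℝ) ∞ f)
    (h : IsOmegaPsh (fun x => c • κ x) X fun x : X => (f x : EReal)) {x : V} (hx : x ∈ X)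
    {v : Cn n} (hv : IsTangent X x v) : 0 ≤ lev f x v + c * hermForm κ x v := by
  obtain ⟨U, hU, hxU, ρ, u, hρ, -, hd, hu, heq⟩ := h.2.2.2 x hx
  have h1 := lev_nonneg_of_isPshOn hU hu (hρ.add hf.contMDiffOn)
    (fun y hy => (heq ⟨y, hy.1⟩ hy.2).symm.trans (EReal.coe_add _ _).symm) ⟨hx, hxU⟩ hv
  have hρx := hρ.contMDiffAt (hU.mem_nhds hxU)
  have h2 : lev (fun y => ρ y + f y) x v = c * hermForm κ x v + lev f x v := by
    rw [lev_add hρx (hf x), lev_eq_hermForm (κ := fun x => c • κ x) hρx (hd x hxU), hermForm_const_smul]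
  have h3 := h1.trans_eq h2
  linarith

theorem IsStrictlyOmegaPsh.restrict {κ : TwoForm n V} {X : Set V} (hne : X.Nonempty) {ψ : V → ℝ}
    (hψ : Continuous ψ)
    (h : IsStrictlyOmegaPsh κ univ fun x : (univ : Set V) => (ψ x : EReal)) :
    IsStrictlyOmegaPsh κ X fun x : X => (ψ x : EReal) := by
  obtain ⟨ε, hε, hε1, -, -, -, hloc⟩ := h
  obtain ⟨x₀, hx₀⟩ := hne
  refine ⟨ε, hε, hε1, ?_, fun x => EReal.coe_ne_top _, ⟨⟨x₀, hx₀⟩, EReal.coe_ne_bot _⟩,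
    fun x _ => ?_⟩
  · exact (continuous_coe_real_ereal.comp
      (hψ.comp continuous_subtype_val)).upperSemicontinuous
  · obtain ⟨U, hU, hxU, ρ, u, hρ, hρp, hd, hu, heq⟩ := hloc x (mem_univ x)
    exact ⟨U, hU, hxU, ρ, u, hρ, hρp, hd, hu, fun y hy => heq ⟨y, mem_univ _⟩ hy⟩

end Strict

end OmegaPsh

theorem proposition2p1 {n : ℕ} {V : Type*} [TopologicalSpace V] [ChartedSpace (OmegaPsh.Cn n) V]
    [IsManifold 𝓘(ℂ, OmegaPsh.Cn n) ω V] [CompactSpace V] [T2Space V]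
    (κ : OmegaPsh.TwoForm n V) (hκ : OmegaPsh.IsKahlerForm κ)
    (X : Set V) (hX : OmegaPsh.IsComplexSubmanifold n X) (hne : X.Nonempty) :
    {φ : X → ℝ | OmegaPsh.IsStrictlyOmegaPsh κ X (fun x => (φ x : EReal)) ∧
        OmegaPsh.IsSmoothOnSubmanifold n X φ} =
      (fun (ψ : V → ℝ) (x : X) => ψ x) '' {ψ : V → ℝ |
        OmegaPsh.IsStrictlyOmegaPsh κ Set.univ (fun x : (Set.univ : Set V) => (ψ x : EReal)) ∧
        ContMDiff 𝓘(ℝ, OmegaPsh.Cn n) 𝓘(ℝ, ℝ) ∞ ψ} := by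
  refine Subset.antisymm ?_ ?_
  · rintro φ ⟨⟨ε, hε, hε1, hφ⟩, hφs⟩
    obtain ⟨f, hf, hfφ⟩ := OmegaPsh.exists_smooth_extension hX hφs
    obtain rfl : (fun x : X => f x) = φ := funext hfφ
    -- passing from `1 - ε` to `1 - ε / 2` makes the Levi form positive in the tangent directions
    obtain ⟨ψ, hψ, hψf, hpos⟩ := OmegaPsh.exists_lev_add_hermForm_pos hκ hX hf (c := 1 - ε / 2)
      (by linarith) fun x hx v hv ht => by
        have h1 := OmegaPsh.lev_add_hermForm_nonneg_of_isOmegaPsh hf hφ hx ht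
        have h2 := mul_pos hε (OmegaPsh.hermForm_pos hκ x hv)
        linarith
    have : Nonempty V := hne.to_type
    exact ⟨ψ, ⟨OmegaPsh.isStrictlyOmegaPsh_of_lev_pos hκ (half_pos hε) (by linarith) hψ hpos, hψ⟩,
      funext fun x => hψf x x.2⟩
  · rintro _ ⟨ψ, ⟨hψ, hψs⟩, rfl⟩
    exact ⟨hψ.restrict hne hψs.continuous, OmegaPsh.isSmoothOnSubmanifold_restrict hψs⟩
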